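/- Time is measured on a word RAM with procedure calls, with unit-cost arithmetic ($+$, truncated $-$, $\times$, integer $/$, $\bmod$) on words of logarithmic length, that is, with all words bounded by a fixed power of the size parameters of the input. A procedure works in a zero-initialised memory of its own, and each word passed to or from it costs one step. Let $\omega>2$ be such that two $k\times k$ matrices over $\mathbb{Z}_2$ can be multiplied in $O(k^\omega)$ time ($k\ge 1$). **Theorem.** There is an algorithm that, given any $p\ge 0$ and any nonempty finite simplicial complex $K$ with $n$ simplices (as the list of its simplices, in any order, each given by its vertices, which are numbered $0,1,\dots$), runs in $O(n^\omega)$ time, with a constant independent of $p$ and $K$, and computes an annotation of the $p$-simplices of $K$ as follows. Let $\sigma_1,\dots,\sigma_{n_p}$ be the $p$-simplices in the order of the input, $\partial_p$ the boundary matrix over $\mathbb{Z}_2$ ($\partial_0=0$), and $g=\dim H_p(K;\mathbb{Z}_2)$. The algorithm outputs: 1. the number $r$, a permutation (matrix) $P$ of the $p$-simplices and an $r\times(n_p-r)$ matrix $R$ with $\partial_pP=B_{opt}[I_r\mid R]$, where the columns of $B_{opt}$ are the earliest basis of $\partial_p$, in their original order; the earliest basis consists of the columns that are not in the span of the columns to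 their left. The first $r$ simplices in the permuted order are called non-sentinel, the others sentinel. The columns of the matrix with upper block $R$ and lower block $I_{n_p-r}$, with rows indexed by the permuted $p$-simplices, are the sentinel cycles $\gamma(\sigma)$ of the sentinel simplices $\sigma$, and they form a basis of the group of $p$-cycles; 2. $p$-cycles $h_1,\dots,h_g$ whose classes form a basis $H$ of $H_p(K;\mathbb{Z}_2)$; 3. a vector $a(\sigma)\in\mathbb{Z}_2^g$ for each $p$-simplex $\sigma$, with $a(\sigma)=0$ if $\sigma$ is non-sentinel, and $a(\sigma)$ the coordinate vector of $[\gamma(\sigma)]$ in $H$ if $\sigma$ is sentinel. For every $p$-cycle $z$, the sum $\sum_{\sigma\in z}a(\sigma)$ is the coordinate vector of $[z]$ in $H$. In particular $a$ is an annotation: two $p$-cycles are homologous if and only if their sums of annotations are equal. -/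

import Mathlib

/-! ### The machine

A word RAM. A program consists of a main command and a finite list of procedures. A command works
on a memory `ℕ → ℕ`, one word per address. Every word that is computed, written or used as an
address must be smaller than a bound `W`; in all uses below `W` is polynomial in the size of the
input, so that words have logarithmically many bits. Each literal, memory access, arithmetic
operation and command costs one step, and a procedure call costs in addition one step for each
word that is passed. -/

/-- The arithmetic operations on words. -/
inductive WordOp
  | add | sub | mul | div | mod

def WordOp.eval : WordOp → ℕ → ℕ → ℕ
  | .add, a, b => a + b
  | .sub, a, b => a - b
  | .mul, a, b => a * b
  | .div, a, b => a / b
  | .mod, a, b => a % b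

/-- Expressions: literals, the content of the memory at a computed address, and operations. -/
inductive WordExpr
  | lit (a : ℕ)
  | load (addr : WordExpr)
  | bin (o : WordOp) (a b : WordExpr)

namespace WordExpr

/-- The value of an expression in the memory `m`. -/
def eval (m : ℕ → ℕ) : WordExpr → ℕ
  | .lit a => a
  | .load e => m (e.eval m)
  | .bin o a b => o.eval (a.eval m) (b.eval m)

/-- The number of steps needed to evaluate an expression. -/
def cost : WordExpr → ℕ
  | .lit _ => 1
  | .load e => e.cost + 1
  | .bin _ a b => a.cost + b.cost + 1

/-- All values that occur in the evaluation of an expression are smaller than `W`. -/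
def Fits (W : ℕ) (m : ℕ → ℕ) : WordExpr → Prop
  | .lit a => a < W
  | .load e => e.Fits W m ∧ m (e.eval m) < W
  | .bin o a b => a.Fits W m ∧ b.Fits W m ∧ o.eval (a.eval m) (b.eval m) < W

end WordExpr

/-- Commands. `store a e` writes the value of `e` at the address `a`. `ite e c d` runs `c` if the
value of `e` is nonzero and `d` otherwise. `loop e c` runs `c` as long as the value of `e` is
nonzero. `call f src len dst len'` runs the procedure number `f` in a memory of its own, which
initially holds at `0, …, len - 1` a copy of the `len` words of the caller at `src, src + 1, …` and
is zero elsewhere, and then copies the first `len'` words of that memory to the addresses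
`dst, dst + 1, …` of the caller. -/
inductive Cmd
  | skip
  | store (addr val : WordExpr)
  | seq (c d : Cmd)
  | ite (e : WordExpr) (c d : Cmd)
  | loop (e : WordExpr) (c : Cmd)
  | call (f : ℕ) (src len dst len' : WordExpr)

/-- `Exec W procs c m m' t`: with words bounded by `W` and procedures `procs`, the command `c`
started in the memory `m` halts in the memory `m'` after exactly `t` steps. -/
inductive Exec (W : ℕ) (procs : List Cmd) : Cmd → (ℕ → ℕ) → (ℕ → ℕ) → ℕ → Prop
  | skip (m : ℕ → ℕ) : Exec W procs .skip m m 1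
  | store (m : ℕ → ℕ) (a e : WordExpr) (ha : a.Fits W m) (he : e.Fits W m) :
      Exec W procs (.store a e) m (Function.update m (a.eval m) (e.eval m)) (a.cost + e.cost + 1)
  | seq (m₀ m₁ m₂ : ℕ → ℕ) (c d : Cmd) (t₁ t₂ : ℕ)
      (hc : Exec W procs c m₀ m₁ t₁) (hd : Exec W procs d m₁ m₂ t₂) :
      Exec W procs (.seq c d) m₀ m₂ (t₁ + t₂ + 1)
  | ite_true (m m' : ℕ → ℕ) (e : WordExpr) (c d : Cmd) (t : ℕ)
      (he : e.Fits W m) (h : e.eval m ≠ 0) (hc : Exec W procs c m m' t) :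
      Exec W procs (.ite e c d) m m' (e.cost + t + 1)
  | ite_false (m m' : ℕ → ℕ) (e : WordExpr) (c d : Cmd) (t : ℕ)
      (he : e.Fits W m) (h : e.eval m = 0) (hd : Exec W procs d m m' t) :
      Exec W procs (.ite e c d) m m' (e.cost + t + 1)
  | loop_stop (m : ℕ → ℕ) (e : WordExpr) (c : Cmd)
      (he : e.Fits W m) (h : e.eval m = 0) :
      Exec W procs (.loop e c) m m (e.cost + 1)
  | loop_step (m₀ m₁ m₂ : ℕ → ℕ) (e : WordExpr) (c : Cmd) (t₁ t₂ : ℕ)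
      (he : e.Fits W m₀) (h : e.eval m₀ ≠ 0) (hc : Exec W procs c m₀ m₁ t₁)
      (hl : Exec W procs (.loop e c) m₁ m₂ t₂) :
      Exec W procs (.loop e c) m₀ m₂ (e.cost + t₁ + t₂ + 1)
  | call (m m' : ℕ → ℕ) (f : ℕ) (src len dst len' : WordExpr) (c : Cmd) (t : ℕ)
      (hf : procs[f]? = some c)
      (hsrc : src.Fits W m) (hlen : len.Fits W m) (hdst : dst.Fits W m) (hlen' : len'.Fits W m)
      (hin : src.eval m + len.eval m ≤ W) (hout : dst.eval m + len'.eval m ≤ W)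
      (hc : Exec W procs c (fun i => if i < len.eval m then m (src.eval m + i) else 0) m' t) :
      Exec W procs (.call f src len dst len') m
        (fun a => if dst.eval m ≤ a ∧ a < dst.eval m + len'.eval m
          then m' (a - dst.eval m) else m a)
        (src.cost + len.cost + dst.cost + len'.cost + len.eval m + len'.eval m + t + 1)

structure Program where
  procs : List Cmd
  main : Cmd

/-- With words bounded by `W`, the program `P`, started in the memory that holds the list `input`
from address `0` on and is zero elsewhere, halts within `T` steps in a memory that holds the list
`output` from address `0` on. -/
def Program.Computes (P : Program) (W : ℕ) (T : ℝ) (input output : List ℕ) : Prop :=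
  ∃ (m : ℕ → ℕ) (t : ℕ), Exec W P.procs P.main (fun i => input.getD i 0) m t ∧
    (t : ℝ) ≤ T ∧ ∀ (i : ℕ) (hi : i < output.length), m i = output[i]

/-- The entries of a matrix over `ℤ/2`, row by row, as a list of numbers `0` and `1`. -/
def bitList {a b : ℕ} (A : Matrix (Fin a) (Fin b) (ZMod 2)) : List ℕ :=
  (List.ofFn fun i => List.ofFn fun j => (A i j).val).flatten

/-- Two `k × k` matrices over `ℤ/2` can be multiplied in `O(k ^ ω)` time. -/
def MatMulInTime (ω : ℝ) : Prop :=
  ∃ (P : Program) (c : ℕ) (C : ℝ), ∀ k : ℕ, 1 ≤ k →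
    ∀ A B : Matrix (Fin k) (Fin k) (ZMod 2),
      P.Computes ((k + 2) ^ c) (C * (k : ℝ) ^ ω) (k :: (bitList A ++ bitList B)) (bitList (A * B))

/-! ### Simplicial homology over `ℤ/2` -/

section Homology

variable {v : ℕ} (K : AbstractSimplicialComplex (Fin v))

/-- The faces with `k` vertices. The `p`-simplices are `Face K (p + 1)`, and `Face K 0` is empty
since faces are nonempty. -/
abbrev Face (k : ℕ) : Type := {s : Finset (Fin v) // s ∈ K.faces ∧ s.card = k}

noncomputable instance (k : ℕ) : Fintype (Face K k) := Fintype.ofFinite _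

/-- The group of `p`-chains. -/
abbrev Chain (p : ℕ) : Type := Face K (p + 1) → ZMod 2

/-- The boundary matrix `∂_p`. It has no rows for `p = 0`. -/
def boundaryMatrix (p : ℕ) : Matrix (Face K p) (Face K (p + 1)) (ZMod 2) :=
  Matrix.of fun τ σ => if τ.1 ⊆ σ.1 then 1 else 0

/-- The group of `p`-cycles. -/
noncomputable def cycles (p : ℕ) : Submodule (ZMod 2) (Chain K p) :=
  LinearMap.ker (boundaryMatrix K p).mulVecLin

/-- The group of `p`-boundaries. -/
noncomputable def boundaries (p : ℕ) : Submodule (ZMod 2) (Chain K p) :=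
  LinearMap.range (boundaryMatrix K (p + 1)).mulVecLin

/-- The homology group `H_p`. -/
abbrev Homology (p : ℕ) : Type := cycles K p ⧸ (boundaries K p).submoduleOf (cycles K p)

variable {K}

/-- The homology class of a cycle. -/
noncomputable def homologyClass {p : ℕ} (z : cycles K p) : Homology K p :=
  Submodule.Quotient.mk z

/-- The sum of the values of `a` over the simplices of the chain `z`. -/
noncomputable def sumOver {p g : ℕ} (a : Face K (p + 1) → Fin g → ZMod 2) (z : Chain K p) :
    Fin g → ZMod 2 :=
  ∑ σ with z σ ≠ 0, a σ

/-- Annotations: vectors of length `dim H_p` on the `p`-simplices whose sums over two cycles agree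
if and only if the cycles are homologous. -/
def IsAnnotation {p g : ℕ} (a : Face K (p + 1) → Fin g → ZMod 2) : Prop :=
  g = Module.finrank (ZMod 2) (Homology K p) ∧
    ∀ z z' : cycles K p,
      homologyClass z = homologyClass z' ↔ sumOver a z.1 = sumOver a z'.1

end Homology

/-! ### Input and output -/

/-- A list of all simplices of `K`, each of them once, in any order. -/
structure Listing {v : ℕ} (K : AbstractSimplicialComplex (Fin v)) where
  list : List (Finset (Fin v))
  nodup : list.Nodup
  mem_iff : ∀ s, s ∈ list ↔ s ∈ K.faces

namespace Listing

variable {v : ℕ} {K : AbstractSimplicialComplex (Fin v)} (l : Listing K)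

/-- The number of simplices of the complex. -/
def size : ℕ := l.list.length

/-- The input of the algorithm: the numbers `p` and `n`, and for each simplex the number of its
vertices followed by the sorted list of its vertices. -/
def input (p : ℕ) : List ℕ :=
  p :: l.list.length ::
    (l.list.map fun s => s.card :: (s.sort (· ≤ ·)).map (fun x => (x : ℕ))).flatten

/-- The faces with `k` vertices in the order of the list. -/
def facesOfCard (k : ℕ) : List (Finset (Fin v)) := l.list.filter fun s => s.card = k

/-- The number of faces with `k` vertices. -/
abbrev count (k : ℕ) : ℕ := (l.facesOfCard k).length

theorem mem_facesOfCard (k : ℕ) (s : Finset (Fin v)) :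
    s ∈ l.facesOfCard k ↔ s ∈ K.faces ∧ s.card = k := by
  simp [facesOfCard, l.mem_iff]

/-- The numbering of the faces with `k` vertices in the order of the list. -/
def enum (k : ℕ) : Fin (l.count k) ≃ Face K k :=
  (List.Nodup.getEquiv (l.facesOfCard k) (l.nodup.filter _)).trans
    (Equiv.subtypeEquivRight (l.mem_facesOfCard k))

end Listing

/-- What the algorithm computes for a complex with `N` simplices of dimension `p`, numbered
`0, …, N - 1`: a permutation `order` of the simplices, that is, of the columns of `∂_p`, split into
`r` first and `s` last ones; a matrix `R`; the incidence vectors of `g` chains; and a vector of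
length `g` for each simplex. -/
structure AnnotationOutput (N : ℕ) where
  r : ℕ
  s : ℕ
  g : ℕ
  order : Fin r ⊕ Fin s ≃ Fin N
  R : Matrix (Fin r) (Fin s) (ZMod 2)
  hom : Matrix (Fin g) (Fin N) (ZMod 2)
  ann : Matrix (Fin N) (Fin g) (ZMod 2)

namespace AnnotationOutput

/-- The output as it is written to the memory. -/
def toList {N : ℕ} (o : AnnotationOutput N) : List ℕ :=
  [o.r, o.s, o.g] ++ (List.ofFn fun i => (o.order (.inl i) : ℕ)) ++
    (List.ofFn fun j => (o.order (.inr j) : ℕ)) ++ bitList o.R ++ bitList o.hom ++ bitList o.ann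

variable {v : ℕ} {K : AbstractSimplicialComplex (Fin v)} {l : Listing K} {p : ℕ}
  (o : AnnotationOutput (l.count (p + 1)))

/-- The simplex in a given place of the permuted order. -/
def simplex (x : Fin o.r ⊕ Fin o.s) : Face K (p + 1) := l.enum (p + 1) (o.order x)

/-- The annotation of a simplex. -/
def annotation (σ : Face K (p + 1)) : Fin o.g → ZMod 2 := o.ann ((l.enum (p + 1)).symm σ)

/-- The `i`-th of the `g` computed chains. -/
def homChain (i : Fin o.g) : Chain K p := fun σ => o.hom i ((l.enum (p + 1)).symm σ)

/-- The permuted boundary matrix `∂_p P`. -/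
def permutedBoundary : Matrix (Face K p) (Fin o.r ⊕ Fin o.s) (ZMod 2) :=
  (boundaryMatrix K p).submatrix id o.simplex

/-- The first `r` columns of `∂_p P`. -/
def firstColumns : Matrix (Face K p) (Fin o.r) (ZMod 2) := o.permutedBoundary.submatrix id Sum.inl

/-- The first `r` columns of `∂_p P` form the earliest basis of the columns of `∂_p`, in
the original order: a column belongs to them if and only if it is not in the span of the columns
to its left. -/
def EarliestBasis : Prop :=
  StrictMono (fun i => o.order (.inl i)) ∧
    ∀ i : Fin (l.count (p + 1)),
      (∃ a, o.order (.inl a) = i) ↔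
        (boundaryMatrix K p).col (l.enum (p + 1) i) ∉
          Submodule.span (ZMod 2)
            ((fun j => (boundaryMatrix K p).col (l.enum (p + 1) j)) '' {j | j < i})

/-- The decomposition `∂_p P = B_opt [I_r | R]`. -/
def Decomposition : Prop :=
  o.EarliestBasis ∧ o.permutedBoundary = o.firstColumns * Matrix.fromCols 1 o.R

/-- The sentinel cycle of the `j`-th of the `s` last simplices: the `j`-th column of the matrix
with upper part `R` and lower part the identity, with rows indexed by the permuted simplices. -/
def sentinelCycle (j : Fin o.s) : Chain K p := fun σ =>
  Matrix.fromRows o.R (1 : Matrix (Fin o.s) (Fin o.s) (ZMod 2))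
    (o.order.symm ((l.enum (p + 1)).symm σ)) j

/-- The sentinel cycles form a basis of the cycle group. -/
def SentinelCycleBasis : Prop :=
  LinearIndependent (ZMod 2) o.sentinelCycle ∧
    Submodule.span (ZMod 2) (Set.range o.sentinelCycle) = cycles K p

end AnnotationOutput

/-! ### Reasoning about programs -/

namespace WordExpr

/-! Two Gaussian eliminations yield everything. Take the reduced row echelon form of `∂_p` and move
each nonzero row to the row whose number is its pivot column. The result `Y` is a square, upper
triangular, idempotent matrix with the same kernel as `∂_p`, so `∂_p Y = ∂_p` and `1 - Y` is a
projection onto the cycles. The pivots are the columns outside the span of the columns to their left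
(`Echelon.pivot_iff`), and `R` consists of the entries of `Y` in pivot rows and free columns. The
columns of `1 - Y` are zero at the pivots and are the sentinel cycles elsewhere (`columnCycle_inl`,
`columnCycle_inr`).

Let `Y'` be the same form of `[∂_{p+1} | 1 - Y]`. A pivot in the right block marks a column cycle
that is not a combination of boundaries and earlier column cycles; these cycles are the `h_i`. The
identity `[∂_{p+1} | 1 - Y] Y' = [∂_{p+1} | 1 - Y]` writes every column cycle, modulo boundaries, as
a combination of the `h_i`, and the coefficients, entries of `Y'`, are the annotations
(`homologyClass_column`). The classes of the `h_i` are independent because `Y'` is upper triangular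
with unit vectors as pivot columns (`linearIndependent`). Finally `z = (1 - Y) z` for a cycle `z`,
so `z` is the sum of the column cycles of its simplices, and summing annotations over `z` gives the
coordinates of its class.

For the running time, all matrices are padded with zeros to size `N × N`, where `N` is a power of
two with `n ≤ N ≤ 2n`. The elimination (`Run.rref`) halves only the rows: reduce the upper half,
clear its pivot columns in the lower half, reduce the lower half, clear its pivot columns in the
upper half. A clearing is a product of an `h × h` and an `h × N` matrix, done as `N / h` square
products in time `O(N h^(ω-1))`. Since `2^(ω-1) > 2`, the recursion `T(2h) = 2 T(h) + O(N h^(ω-1))`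
gives `O(N^ω)` (`rrefTime_le`). Rows are never sorted and row operations never recorded: pivots are
remembered by position, and equality of kernels is all that is carried along.

The incidence matrices are found by comparing all pairs of vertices, with a factor of order `p²` per
pair of simplices. A `p`-simplex has `2^(p+1) - 1` faces, so whenever such pairs exist `p` is
logarithmic in `n` and the factor is absorbed by `n^(ω-2)` (`incidenceTime_le`).

On the machine, all words in memory stay below a polynomial bound `X`, and each expression is a
polynomial of bounded degree in them, so overflow is excluded once and for all by `X ^ 200 < W`. -/

instance : Add WordExpr := ⟨bin .add⟩
instance : Sub WordExpr := ⟨bin .sub⟩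
instance : Mul WordExpr := ⟨bin .mul⟩
instance : Div WordExpr := ⟨bin .div⟩
instance : Mod WordExpr := ⟨bin .mod⟩
instance (n : ℕ) : OfNat WordExpr n := ⟨lit n⟩

/-- The content of the register `r`. -/
def reg (r : ℕ) : WordExpr := load (lit r)

/-- The address of the entry `e` of the slot `k`. The size of the slots is held in register `2`. -/
def adr (k : ℕ) (e : WordExpr) : WordExpr := lit 64 + lit k * reg 2 + e

/-- The entry `e` of the slot `k`. -/
def ld (k : ℕ) (e : WordExpr) : WordExpr := load (adr k e)

/-- `1` if `a < b` and `0` otherwise. -/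
def lt (a b : WordExpr) : WordExpr := 1 - (1 - (b - a))

/-- `1` if `a = b` and `0` otherwise. -/
def eq (a b : WordExpr) : WordExpr := 1 - ((a - b) + (b - a))

section
variable (m : ℕ → ℕ) (a b : WordExpr)

@[simp] theorem eval_add : (a + b).eval m = a.eval m + b.eval m := rfl
@[simp] theorem eval_sub : (a - b).eval m = a.eval m - b.eval m := rfl
@[simp] theorem eval_mul : (a * b).eval m = a.eval m * b.eval m := rfl
@[simp] theorem eval_div : (a / b).eval m = a.eval m / b.eval m := rfl
@[simp] theorem eval_mod : (a % b).eval m = a.eval m % b.eval m := rfl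
@[simp] theorem eval_ofNat (n : ℕ) : (no_index (OfNat.ofNat n) : WordExpr).eval m = OfNat.ofNat n := rfl
@[simp] theorem eval_reg (r : ℕ) : (reg r).eval m = m r := rfl
@[simp] theorem eval_lt : (lt a b).eval m = if a.eval m < b.eval m then 1 else 0 := by
  simp only [lt, eval_sub, eval_ofNat]; split_ifs <;> omega
@[simp] theorem eval_eq : (eq a b).eval m = if a.eval m = b.eval m then 1 else 0 := by
  simp only [eq, eval_sub, eval_ofNat, eval_add]; split_ifs <;> omega

end

/-! ### Degrees of expressions and word size -/

/-- A bound for the degree of the value of an expression as a function of the words in memory. -/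
def weight : WordExpr → ℕ
  | lit _ => 1
  | load e => e.weight
  | bin _ a b => a.weight + b.weight

def maxLit : WordExpr → ℕ
  | lit a => a
  | load e => e.maxLit
  | bin _ a b => max a.maxLit b.maxLit

/-- Expressions of bounded size with bounded literals. -/
def Small (e : WordExpr) : Prop :=
  e.weight ≤ 100 ∧ e.maxLit ≤ 100 ∧ e.cost ≤ 200

instance (e : WordExpr) : Decidable e.Small :=
  inferInstanceAs (Decidable (e.weight ≤ 100 ∧ e.maxLit ≤ 100 ∧ e.cost ≤ 200))

theorem weight_pos (e : WordExpr) : 1 ≤ e.weight := by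
  induction e with
  | lit => simp [weight]
  | load e ih => simpa [weight] using ih
  | bin o a b iha ihb => simp only [weight]; omega

/-- Because of this a sum may be charged like a product, and `weight` can add up the weights of the
arguments for every operation. -/
theorem pow_add_pow_le {X a b : ℕ} (hX : 2 ≤ X) (ha : 1 ≤ a) (hb : 1 ≤ b) :
    X ^ a + X ^ b ≤ X ^ (a + b) := by
  have h1 : X ≤ X ^ a := Nat.le_self_pow (by omega) X
  have h2 : X ≤ X ^ b := Nat.le_self_pow (by omega) X
  rw [pow_add]
  nlinarith

theorem eval_le {X : ℕ} (hX : 2 ≤ X) {m : ℕ → ℕ} (hm : ∀ a, m a ≤ X) (e : WordExpr)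
    (he : e.maxLit ≤ X) : e.eval m ≤ X ^ e.weight := by
  induction e with
  | lit a => simpa [weight, eval, maxLit] using he
  | load e ih =>
    exact (hm _).trans (Nat.le_self_pow (by have := weight_pos e; simp only [weight]; omega) X)
  | bin o a b iha ihb =>
    simp only [maxLit, max_le_iff] at he
    have ha := iha he.1
    have hb := ihb he.2
    have hab := pow_add_pow_le hX (weight_pos a) (weight_pos b)
    have hmul : a.eval m * b.eval m ≤ X ^ (a.weight + b.weight) := by
      rw [pow_add]; exact Nat.mul_le_mul ha hb
    cases o <;> simp only [eval, WordOp.eval, weight]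
    · omega
    · omega
    · exact hmul
    · exact (Nat.div_le_self _ _).trans (by omega)
    · exact (Nat.mod_le _ _).trans (by omega)

/-- Intermediate values and addresses have to be small too. No subexpression has a larger weight
than the whole, so the one inequality for the whole serves for all of them. -/
theorem fits_of_pow_lt {X W : ℕ} (hX : 2 ≤ X) {m : ℕ → ℕ} (hm : ∀ a, m a ≤ X) (e : WordExpr)
    (he : e.maxLit ≤ X) (hW : X ^ e.weight < W) : e.Fits W m := by
  have key := eval_le hX hm e he
  induction e with
  | lit a => exact lt_of_le_of_lt key hW
  | load e ih =>
    exact ⟨ih he hW (eval_le hX hm e he), lt_of_le_of_lt key hW⟩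
  | bin o a b iha ihb =>
    have he' := he
    simp only [maxLit, max_le_iff] at he'
    have hpow : ∀ c, c ≤ a.weight + b.weight → X ^ c < W := fun c hc =>
      lt_of_le_of_lt (Nat.pow_le_pow_right (by omega) hc) hW
    exact ⟨iha he'.1 (hpow _ (by omega)) (eval_le hX hm a he'.1),
      ihb he'.2 (hpow _ (by omega)) (eval_le hX hm b he'.2), lt_of_le_of_lt key hW⟩

end WordExpr

/-! ### Executions in larger machines -/

open WordExpr

/-- Allows the given multiplication program to run inside the annotation program, where the word
bound is larger and further procedures are appended behind its own. `W` enters an execution only as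
an upper bound. -/
theorem Exec.mono {W W' : ℕ} {procs procs' : List Cmd} (hW : W ≤ W')
    (hp : ∀ (f : ℕ) (c : Cmd), procs[f]? = some c → procs'[f]? = some c) {c : Cmd} {m m' : ℕ → ℕ} {t : ℕ}
    (h : Exec W procs c m m' t) : Exec W' procs' c m m' t := by
  have hF : ∀ (e : WordExpr) (m : ℕ → ℕ), e.Fits W m → e.Fits W' m := by
    intro e m
    induction e with
    | lit a => exact fun h => lt_of_lt_of_le h hW
    | load e ih => exact fun h => ⟨ih h.1, lt_of_lt_of_le h.2 hW⟩
    | bin o a b iha ihb => exact fun h => ⟨iha h.1, ihb h.2.1, lt_of_lt_of_le h.2.2 hW⟩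
  induction h with
  | skip m => exact .skip m
  | store m a e ha he => exact .store m a e (hF _ _ ha) (hF _ _ he)
  | seq m₀ m₁ m₂ c d t₁ t₂ _ _ ih1 ih2 => exact .seq _ _ _ _ _ _ _ ih1 ih2
  | ite_true m m' e c d t he h _ ih => exact .ite_true _ _ _ _ _ _ (hF _ _ he) h ih
  | ite_false m m' e c d t he h _ ih => exact .ite_false _ _ _ _ _ _ (hF _ _ he) h ih
  | loop_stop m e c he h => exact Exec.loop_stop _ _ _ (hF _ _ he) h
  | loop_step m₀ m₁ m₂ e c t₁ t₂ he h _ _ ih1 ih2 =>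
    exact .loop_step _ _ _ _ _ _ _ (hF _ _ he) h ih1 ih2
  | call m m' f src len dst len' c t hf h1 h2 h3 h4 h5 h6 _ ih =>
    exact .call _ _ _ _ _ _ _ _ _ (hp _ _ hf) (hF _ _ h1) (hF _ _ h2) (hF _ _ h3) (hF _ _ h4)
      (h5.trans hW) (h6.trans hW) ih

/-- A machine with words smaller than `W`, for computations in which all words in memory are at
most `X`. -/
structure RAM where
  X : ℕ
  W : ℕ
  procs : List Cmd
  hX : 100 ≤ X
  hW : X ^ 200 < W

variable {R : RAM}

theorem RAM.pow_lt (R : RAM) {w : ℕ} (hw : w ≤ 200) : R.X ^ w < R.W :=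
  lt_of_le_of_lt (Nat.pow_le_pow_right (by have := R.hX; omega) hw) R.hW

theorem RAM.fits (R : RAM) {m : ℕ → ℕ} (hm : ∀ a, m a ≤ R.X) {e : WordExpr} (he : e.Small) :
    e.Fits R.W m := by
  obtain ⟨_, _, _⟩ := he
  have := R.hX
  exact fits_of_pow_lt (by omega) hm e (by omega) (R.pow_lt (by omega))

theorem WordExpr.Small.cost_le {e : WordExpr} (he : e.Small) : e.cost ≤ 200 := he.2.2

/-- A call needs its address plus its length to be at most `W`. Two summands of weight at most 100
are the reason for the exponent 200 in `RAM`. -/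
theorem RAM.add_le (R : RAM) {m : ℕ → ℕ} (hm : ∀ a, m a ≤ R.X) {e e' : WordExpr} (he : e.Small)
    (he' : e'.Small) : e.eval m + e'.eval m ≤ R.W := by
  obtain ⟨_, _, _⟩ := he
  obtain ⟨_, _, _⟩ := he'
  have := R.hX
  have h1 := eval_le (X := R.X) (by omega) hm e (by omega)
  have h2 := eval_le (X := R.X) (by omega) hm e' (by omega)
  have h3 := pow_add_pow_le (X := R.X) (by omega) (weight_pos e) (weight_pos e')
  have h4 := R.pow_lt (w := e.weight + e'.weight) (by omega)
  omega

/-! ### Rules for correctness with time bounds -/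

/-- Started in a memory `m` with words at most `R.X`, the command `c` halts within `T` steps in
a memory with words at most `R.X` that satisfies `Q`. -/
def Run (R : RAM) (c : Cmd) (m : ℕ → ℕ) (T : ℕ) (Q : (ℕ → ℕ) → Prop) : Prop :=
  (∀ a, m a ≤ R.X) →
    ∃ m' t, Exec R.W R.procs c m m' t ∧ t ≤ T ∧ (∀ a, m' a ≤ R.X) ∧ Q m'

/-- A sequence of commands. -/
def prog : List Cmd → Cmd
  | [] => .skip
  | c :: l => .seq c (prog l)

namespace Run

variable {c d : Cmd} {m : ℕ → ℕ} {T T' T₁ : ℕ} {Q Q' : (ℕ → ℕ) → Prop}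

theorem le (h : Run R c m T' Q) (hT : T' ≤ T) : Run R c m T Q := fun hm =>
  let ⟨m', t, h1, h2, h3⟩ := h hm
  ⟨m', t, h1, h2.trans hT, h3⟩

theorem imp (h : Run R c m T Q') (hQ : ∀ m', Q' m' → Q m') : Run R c m T Q := fun hm =>
  let ⟨m', t, h1, h2, h3, h4⟩ := h hm
  ⟨m', t, h1, h2, h3, hQ _ h4⟩

theorem bounded (h : (∀ a, m a ≤ R.X) → Run R c m T Q) : Run R c m T Q := fun hm => h hm hm

theorem nil (hT : 1 ≤ T) (h : Q m) : Run R (prog []) m T Q := fun hm =>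
  ⟨m, 1, .skip m, hT, hm, h⟩

/-- The time that remains is introduced as a variable with an additive equation, so that long
sequences need no truncated subtraction. The extra step is the one charged by `seq`. -/
theorem cons {l : List Cmd} (h₁ : Run R c m T₁ Q') (hT : T₁ + 1 ≤ T)
    (h₂ : ∀ m' T', T₁ + 1 + T' = T → Q' m' → Run R (prog l) m' T' Q) :
    Run R (prog (c :: l)) m T Q := fun hm =>
  let ⟨_, _, e1, l1, b1, q1⟩ := h₁ hm
  let ⟨T₂, hT₂⟩ := Nat.exists_eq_add_of_le hT
  let ⟨m2, _, e2, l2, b2, q2⟩ := h₂ _ T₂ hT₂.symm q1 b1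
  ⟨m2, _, .seq _ _ _ _ _ _ _ e1 e2, by omega, b2, q2⟩

theorem store {a e : WordExpr} (ha : a.Small) (he : e.Small)
    (hv : (∀ a, m a ≤ R.X) → e.eval m ≤ R.X) :
    Run R (.store a e) m 401 (fun m' => m' = Function.update m (a.eval m) (e.eval m)) := fun hm =>
  ⟨_, _, .store m a e (R.fits hm ha) (R.fits hm he), by
    have := ha.cost_le; have := he.cost_le; omega, by
    intro b
    by_cases hb : b = a.eval m
    · subst hb; simpa using hv hm
    · simpa [Function.update_of_ne hb] using hm b, rfl⟩

theorem ite_true {e : WordExpr} (he : e.Small) (h : e.eval m ≠ 0) (hc : Run R c m T Q) :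
    Run R (.ite e c d) m (T + 201) Q := fun hm =>
  let ⟨m', _, h1, h2, h3, h4⟩ := hc hm
  ⟨m', _, .ite_true _ _ _ _ _ _ (R.fits hm he) h h1, by have := he.cost_le; omega, h3, h4⟩

theorem ite_false {e : WordExpr} (he : e.Small) (h : e.eval m = 0) (hd : Run R d m T Q) :
    Run R (.ite e c d) m (T + 201) Q := fun hm =>
  let ⟨m', _, h1, h2, h3, h4⟩ := hd hm
  ⟨m', _, .ite_false _ _ _ _ _ _ (R.fits hm he) h h1, by have := he.cost_le; omega, h3, h4⟩

theorem loop {e : WordExpr} (he : e.Small) (n : ℕ) (I : ℕ → (ℕ → ℕ) → Prop) (h0 : I 0 m)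
    (hstep : ∀ j < n, ∀ m', I j m' → e.eval m' ≠ 0 ∧ Run R c m' T (I (j + 1)))
    (hend : ∀ m', I n m' → e.eval m' = 0) :
    Run R (.loop e c) m (n * (T + 201) + 201) (I n) := by
  -- Induction on the number `k` of iterations still to come, which keeps the final assertion `I n`
  -- fixed.
  have key : ∀ k ≤ n, ∀ m', I (n - k) m' → Run R (.loop e c) m' (k * (T + 201) + 201) (I n) := by
    intro k
    induction k with
    | zero =>
      intro _ m' hI hm
      refine ⟨m', _, Exec.loop_stop _ _ _ (R.fits hm he) (hend _ hI), ?_, hm, hI⟩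
      have := he.cost_le; omega
    | succ k ih =>
      intro hk m' hI hm
      obtain ⟨h1, h2⟩ := hstep (n - (k + 1)) (by omega) m' hI
      obtain ⟨m1, t1, e1, l1, b1, q1⟩ := h2 hm
      rw [show n - (k + 1) + 1 = n - k by omega] at q1
      obtain ⟨m2, t2, e2, l2, b2, q2⟩ := ih (by omega) m1 q1 b1
      refine ⟨m2, _, .loop_step _ _ _ _ _ _ _ (R.fits hm he) h1 e1 e2, ?_, b2, q2⟩
      have := he.cost_le
      rw [Nat.succ_mul]; omega
  simpa using key n le_rfl m (by simpa using h0)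

/-- Only the words copied back have to be at most `X`. This form serves the given multiplication
program, about whose memory nothing is known beyond the bound `W`; the remaining procedures satisfy
`Run` and use `call_run`. -/
theorem call {f : ℕ} {src len dst len' : WordExpr} (hf : R.procs[f]? = some c)
    (h1 : src.Small) (h2 : len.Small) (h3 : dst.Small) (h4 : len'.Small)
    (hc : (∀ a, m a ≤ R.X) → ∃ m' t, Exec R.W R.procs c
      (fun i => if i < len.eval m then m (src.eval m + i) else 0) m' t ∧ t ≤ T ∧
      (∀ i < len'.eval m, m' i ≤ R.X) ∧ Q' m') :
    Run R (.call f src len dst len') m (len.eval m + len'.eval m + T + 801) (fun m' =>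
      ∃ mc, Q' mc ∧ m' = fun a => if dst.eval m ≤ a ∧ a < dst.eval m + len'.eval m
          then mc (a - dst.eval m) else m a) := fun hm => by
  obtain ⟨mc, t, e, l, b, q⟩ := hc hm
  refine ⟨_, _, .call _ _ _ _ _ _ _ _ _ hf (R.fits hm h1) (R.fits hm h2) (R.fits hm h3)
    (R.fits hm h4) (R.add_le hm h1 h2) (R.add_le hm h3 h4) e, ?_, ?_, mc, q, rfl⟩
  · have := h1.cost_le; have := h2.cost_le; have := h3.cost_le; have := h4.cost_le; omega
  · intro a
    split_ifs with h
    · exact b _ (by omega)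
    · exact hm a

theorem call_run {f : ℕ} {src len dst len' : WordExpr} (hf : R.procs[f]? = some c)
    (h1 : src.Small) (h2 : len.Small) (h3 : dst.Small) (h4 : len'.Small)
    (hc : Run R c (fun i => if i < len.eval m then m (src.eval m + i) else 0) T Q') :
    Run R (.call f src len dst len') m (len.eval m + len'.eval m + T + 801) (fun m' =>
      ∃ mc, Q' mc ∧ m' = fun a => if dst.eval m ≤ a ∧ a < dst.eval m + len'.eval m
          then mc (a - dst.eval m) else m a) :=
  call hf h1 h2 h3 h4 fun hm =>
    let ⟨m', t, e, l, b, q⟩ := hc (by intro a; beta_reduce; split_ifs; exacts [hm _, Nat.zero_le _])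
    ⟨m', t, e, l, fun i _ => b i, q⟩

end Run

/-! ### Registers, slots and the basic commands on them -/

/-- The entry `j` of the slot `k`, for slots of size `S`. -/
def slot (S : ℕ) (m : ℕ → ℕ) (k j : ℕ) : ℕ := m (64 + k * S + j)

@[simp] theorem WordExpr.eval_adr (m : ℕ → ℕ) (k : ℕ) (e : WordExpr) :
    (adr k e).eval m = 64 + k * m 2 + e.eval m := rfl

@[simp] theorem WordExpr.eval_ld (m : ℕ → ℕ) (k : ℕ) (e : WordExpr) :
    (ld k e).eval m = slot (m 2) m k (e.eval m) := rfl

theorem slot_addr_ne {S k k' j j' : ℕ} (hk : k ≠ k') (hj : j < S) (hj' : j' < S) :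
    64 + k * S + j ≠ 64 + k' * S + j' := by
  rcases Nat.lt_or_gt_of_ne hk with h | h
  · have := Nat.mul_le_mul_right S (Nat.succ_le_of_lt h)
    rw [Nat.succ_mul] at this; omega
  · have := Nat.mul_le_mul_right S (Nat.succ_le_of_lt h)
    rw [Nat.succ_mul] at this; omega

@[simp] theorem slot_update {S : ℕ} {m : ℕ → ℕ} {k j r v : ℕ} (hr : r < 64) :
    slot S (Function.update m r v) k j = slot S m k j := by
  unfold slot; rw [Function.update_of_ne (by omega)]

/-- The registers with numbers less than `60` and the slots other than `k` are the same. -/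
structure Near (S k : ℕ) (m m' : ℕ → ℕ) : Prop where
  reg : ∀ r < 60, m' r = m r
  oth : ∀ k' j, k' ≠ k → j < S → slot S m' k' j = slot S m k' j

/-- The memory `m'` results from `m` by writing `g 0, …, g (len - 1)` to the slot `k` from the
entry `o` on. -/
structure Wrote (S k o len : ℕ) (g : ℕ → ℕ) (m m' : ℕ → ℕ) : Prop extends Near S k m m' where
  new : ∀ j < len, slot S m' k (o + j) = g j
  old : ∀ j < S, (j < o ∨ o + len ≤ j) → slot S m' k j = slot S m k j

/-- Writes the values of `e` for `reg 63 = 0, …, n - 1` to the slot `k` from the entry `o` on. -/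
def tab (k : ℕ) (o n e : WordExpr) : Cmd :=
  prog [.store (lit 63) 0, .loop (n - reg 63)
    (prog [.store (adr k (o + reg 63)) e, .store (lit 63) (reg 63 + 1)])]

/-- Runs `c` for `reg r = 0, …, n - 1`. -/
def forr (r : ℕ) (n : WordExpr) (c : Cmd) : Cmd :=
  prog [.store (lit r) 0, .loop (n - reg r) (prog [c, .store (lit r) (reg r + 1)])]

/-- Runs the procedure `f` with `a` in register `0` and the first `n` words of its slot `0` copied
from the slot `k`, and copies the first `l` words of its slot `0` back to the slot `k'`. In both
slots the registers of the procedure take up the first `64` words. -/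
def send (f k : ℕ) (a n : WordExpr) (k' : ℕ) (l : WordExpr) : Cmd :=
  prog [tab k 0 1 a, tab k 1 1 (reg 1), tab k 2 1 (reg 2),
    .call f (adr k 0) (64 + n) (adr k' 0) (64 + l)]

/-- Writes the values of `e` for those `reg r = 0, …, n - 1` for which `p = 1` to the slot `k`. The
register `c` holds the number of these values. -/
def filt (r k c : ℕ) (n e p : WordExpr) : Cmd :=
  prog [.store (lit c) 0, forr r n
    (prog [tab k (reg c) 1 e, .store (lit c) (reg c + p)])]

namespace Run

variable {m : ℕ → ℕ} {S T : ℕ}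

theorem set {r v : ℕ} {e : WordExpr} (hr : r ≤ 63) (he : e.Small) (hv : e.eval m = v)
    (hX : (∀ a, m a ≤ R.X) → v ≤ R.X) :
    Run R (.store (lit r) e) m 401 (fun m' => m' = Function.update m r v) := by
  have := Run.store (R := R) (m := m) (a := lit r) (e := e)
    ⟨by simp [weight], by simp [maxLit]; omega, by simp [cost]⟩ he (by rwa [hv])
  rw [hv] at this
  exact this

/-- The value of `e` may depend on entries already written, hence the hypothesis `Wrote S k ov j g m
m'` for it; `o` and `n` may use only what `Near` preserves. Register 63 is the counter, which is why
`Near` promises nothing about the registers from 60 on. -/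
theorem tab {k ov nv : ℕ} {o n e : WordExpr} {g : ℕ → ℕ} (hS : m 2 = S)
    (hsm : (n - reg 63).Small ∧ (adr k (o + reg 63)).Small ∧ e.Small)
    (ho : ∀ m', Near S k m m' → o.eval m' = ov) (hn : ∀ m', Near S k m m' → n.eval m' = nv)
    (hb : ov + nv ≤ S)
    (he : ∀ j < nv, ∀ m', m' 63 = j → Wrote S k ov j g m m' → e.eval m' = g j)
    (hg : (∀ a, m a ≤ R.X) → ∀ j < nv, g j ≤ R.X) :
    Run R (tab k o n e) m (1100 * (nv + 1)) (Wrote S k ov nv g m) := by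
  refine bounded fun hm => ?_
  have hSX : S ≤ R.X := hS ▸ hm 2
  have hX := R.hX
  refine Run.cons (Run.set (by norm_num) (by decide) (v := 0) (by simp) (fun _ => by omega))
    (by omega) fun m1 T1 hT1 h1 => ?_
  refine Run.cons (Q' := Wrote S k ov nv g m) (Run.imp (Run.loop (T := 805) hsm.1 nv
    (fun j m' => m' 63 = j ∧ Wrote S k ov j g m m') ?_ ?_ ?_) fun m' h => h.2)
    (by lia) (fun m' T' hT' h => Run.nil (by lia) h)
  · subst h1
    exact ⟨by simp, ⟨fun r hr => Function.update_of_ne (by omega) _ _,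
      fun _ _ _ _ => slot_update (by norm_num)⟩, fun j hj => by omega,
      fun _ _ _ => slot_update (by norm_num)⟩
  · rintro j hj m2 ⟨h63, hw⟩
    refine ⟨by rw [eval_sub, eval_reg, hn m2 hw.toNear, h63]; omega, ?_⟩
    refine Run.cons (Run.store hsm.2.1 hsm.2.2 (fun _ => ?_)) (by omega) fun m3 T3 hT3 h3 =>
      Run.cons (Run.set (by norm_num) (by decide) (v := j + 1) ?_ (fun _ => by omega)) (by omega)
        fun m4 T4 hT4 h4 => Run.nil (by omega) ?_
    · rw [he j hj m2 h63 hw]; exact hg hm j hj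
    · subst h3
      simp only [eval_add, eval_reg, eval_ofNat, eval_adr]
      rw [Function.update_of_ne (by omega), h63]
    · rw [he j hj m2 h63 hw, eval_adr, hw.reg 2 (by norm_num), hS, eval_add, eval_reg,
        ho m2 hw.toNear, h63] at h3
      subst h4
      refine ⟨by simp, ⟨fun r hr => ?_, fun k' i hk hi => ?_⟩, fun i hi => ?_, fun i hi h => ?_⟩
      · rw [Function.update_of_ne (by omega), h3, Function.update_of_ne (by omega), hw.reg r hr]
      · rw [slot_update (by norm_num), ← hw.oth k' i hk hi, h3]
        exact Function.update_of_ne (slot_addr_ne hk hi (by omega)) _ _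
      · rw [slot_update (by norm_num), h3]
        rcases Nat.lt_succ_iff_lt_or_eq.mp hi with hi | rfl
        · rw [← hw.new i hi]
          exact Function.update_of_ne (by omega) _ _
        · exact Function.update_self _ _ _
      · rw [slot_update (by norm_num), ← hw.old i hi (by omega), h3]
        exact Function.update_of_ne (by omega) _ _
  · rintro m2 ⟨h63, hw⟩
    simp [h63, hn m2 hw.toNear]

theorem forr {r nv : ℕ} {n : WordExpr} {c : Cmd} {I : ℕ → (ℕ → ℕ) → Prop} (hr : r ≤ 63)
    (hsm : (n - reg r).Small) (hnX : (∀ a, m a ≤ R.X) → nv ≤ R.X)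
    (hn : ∀ j m', I j m' → n.eval m' = nv) (h0 : I 0 (Function.update m r 0))
    (hstep : ∀ j < nv, ∀ m', (∀ a, m' a ≤ R.X) → I j m' → m' r = j →
      Run R c m' T (fun m'' => m'' r = j ∧ I (j + 1) (Function.update m'' r (j + 1)))) :
    Run R (forr r n c) m (nv * (T + 1000) + 1000) (I nv) := by
  refine bounded fun hm => ?_
  have hnX := hnX hm
  have hX := R.hX
  refine Run.cons (Run.set hr (by decide) (v := 0) (by simp) (fun _ => by omega))
    (by omega) fun m1 T1 hT1 h1 => ?_
  refine Run.cons (Q' := I nv) (Run.imp (Run.loop (T := T + 404) hsm nv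
    (fun j m' => m' r = j ∧ I j m') ?_ ?_ ?_) fun m' h => h.2)
    (by lia) (fun m' T' hT' h => Run.nil (by lia) h)
  · subst h1
    exact ⟨by simp, h0⟩
  · rintro j hj m2 ⟨hmr, hI⟩
    refine ⟨by rw [eval_sub, eval_reg, hn j m2 hI, hmr]; omega, ?_⟩
    refine Run.bounded fun hm2 => Run.cons (hstep j hj m2 hm2 hI hmr) (by omega)
      fun m3 T3 hT3 h3 => Run.cons (Run.set hr ?_ (v := j + 1) (by simp [h3.1]) (fun _ => by omega))
        (by omega) fun m4 T4 hT4 h4 => Run.nil (by omega) ?_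
    · refine ⟨?_, ?_, ?_⟩
      · change 1 + 1 ≤ 100; norm_num
      · change max r 1 ≤ 100; omega
      · change 2 + 1 + 1 ≤ 200; norm_num
    · rw [h4]; exact ⟨by simp, h3.2⟩
  · rintro m2 ⟨hmr, hI⟩
    simp [hmr, hn nv m2 hI]

/-- What is known after `send`, for the final memory `mc` of the procedure. -/
structure _root_.Sent (S k k' l : ℕ) (m mc m' : ℕ → ℕ) : Prop where
  reg : ∀ r < 60, m' r = m r
  res : ∀ r < 60, slot S m' k' r = mc r
  new : ∀ j < l, slot S m' k' (64 + j) = slot S mc 0 j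
  src : k ≠ k' → ∀ j < S, 3 ≤ j → slot S m' k j = slot S m k j
  oth : ∀ k'' j, k'' ≠ k → k'' ≠ k' → j < S → slot S m' k'' j = slot S m k'' j

/-- The slot is copied to the beginning of the new memory, so its entry `64 + j` becomes the entry
`j` of the slot `0` there, and conversely on return. Only the entries 0, 1, 2 of the source are
overwritten, by the argument, the matrix size and the slot size; if the result goes elsewhere, the
same slot can be sent again. -/
theorem send {f k k' av nv lv : ℕ} {a n l : WordExpr} {c : Cmd} {Q : (ℕ → ℕ) → Prop}
    (hf : R.procs[f]? = some c) (hS : m 2 = S)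
    (hsm : a.Small ∧ (64 + n).Small ∧ (64 + l).Small ∧ (adr k (2 + reg 63)).Small ∧
      (adr k (1 + reg 63)).Small ∧ (adr k (0 + reg 63)).Small ∧ (adr k 0).Small ∧ (adr k' 0).Small)
    (ha : ∀ m', Near S k m m' → a.eval m' = av) (hn : ∀ m', Near S k m m' → n.eval m' = nv)
    (hl : ∀ m', Near S k m m' → l.eval m' = lv) (hnS : 64 + nv ≤ S) (hlS : 64 + lv ≤ S)
    (hav : (∀ a, m a ≤ R.X) → av ≤ R.X)
    (hc : ∀ mc, mc 0 = av → mc 1 = m 1 → mc 2 = S →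
      (∀ j < nv, slot S mc 0 j = slot S m k (64 + j)) → Run R c mc T Q) :
    Run R (send f k a n k' l) m (T + nv + lv + 8000)
      (fun m' => ∃ mc, Q mc ∧ Sent S k k' lv m mc m') := by
  refine bounded fun hm => ?_
  refine Run.cons (Run.tab (nv := 1) (ov := 0) (g := fun _ => av) hS
    ⟨by decide, hsm.2.2.2.2.2.1, hsm.1⟩ (fun _ _ => rfl) (fun _ _ => rfl) (by omega)
    (fun j hj m' _ hw => ha m' hw.toNear) (fun _ _ _ => hav hm)) (by omega) fun m1 T1 hT1 h1 => ?_
  refine Run.cons (Run.tab (S := S) (nv := 1) (ov := 1) (g := fun _ => m 1)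
    (by rw [h1.reg 2 (by norm_num), hS]) ⟨by decide, hsm.2.2.2.2.1, by decide⟩ (fun _ _ => rfl)
    (fun _ _ => rfl) (by omega)
    (fun j hj m' _ hw => by rw [eval_reg, hw.reg 1 (by norm_num), h1.reg 1 (by norm_num)])
    (fun _ _ _ => hm 1)) (by omega) fun m2 T2 hT2 h2 => ?_
  refine Run.cons (Run.tab (S := S) (nv := 1) (ov := 2) (g := fun _ => S)
    (by rw [h2.reg 2 (by norm_num), h1.reg 2 (by norm_num), hS])
    ⟨by decide, hsm.2.2.2.1, by decide⟩ (fun _ _ => rfl) (fun _ _ => rfl) (by omega)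
    (fun j hj m' _ hw => by
      rw [eval_reg, hw.reg 2 (by norm_num), h2.reg 2 (by norm_num), h1.reg 2 (by norm_num), hS])
    (fun _ _ _ => hS ▸ hm 2)) (by omega) fun m3 T3 hT3 h3 => ?_
  have near : Near S k m m3 := ⟨fun r hr => by rw [h3.reg r hr, h2.reg r hr, h1.reg r hr],
    fun k' j hk hj => by rw [h3.oth k' j hk hj, h2.oth k' j hk hj, h1.oth k' j hk hj]⟩
  have hold : ∀ j < S, 3 ≤ j → slot S m3 k j = slot S m k j := fun j hj h => by
    rw [h3.old j hj (by omega), h2.old j hj (by omega), h1.old j hj (by omega)]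
  have e0 : slot S m3 k 0 = av := by
    rw [h3.old 0 (by omega) (by omega), h2.old 0 (by omega) (by omega)]
    exact h1.new 0 (by omega)
  have e1 : slot S m3 k 1 = m 1 := by
    rw [h3.old 1 (by omega) (by omega)]
    exact h2.new 0 (by omega)
  have e2 : slot S m3 k 2 = S := h3.new 0 (by omega)
  have m32 : m3 2 = S := by rw [near.reg 2 (by norm_num), hS]
  refine Run.cons (Run.call_run hf hsm.2.2.2.2.2.2.1 hsm.2.1 hsm.2.2.2.2.2.2.2 hsm.2.2.1
    (hc _ ?_ ?_ ?_ ?_)) (by simp only [eval_add, eval_ofNat, hn m3 near, hl m3 near]; omega) fun m4 T4 hT4 h4 =>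
    Run.nil (by simp only [eval_add, eval_ofNat, hn m3 near, hl m3 near] at hT4; omega) ?_
  · simp only [eval_add, eval_ofNat, hn m3 near, eval_adr, m32]
    simpa [slot] using e0
  · simp only [eval_add, eval_ofNat, hn m3 near, eval_adr, m32]
    rw [if_pos (by omega)]
    simpa [slot] using e1
  · simp only [eval_add, eval_ofNat, hn m3 near, eval_adr, m32]
    rw [if_pos (by omega)]
    simpa [slot] using e2
  · intro j hj
    simp only [eval_add, eval_ofNat, hn m3 near, eval_adr, m32]
    rw [← hold (64 + j) (by omega) (by omega)]
    unfold slot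
    beta_reduce
    rw [if_pos (by omega)]
    congr 1
    omega
  · obtain ⟨mc, hq, h4⟩ := h4
    simp only [eval_add, eval_ofNat, hl m3 near, eval_adr, m32] at h4
    have hne : ∀ k'' j, k'' ≠ k' → j < S → slot S m4 k'' j = slot S m3 k'' j := by
      intro k'' j hk hj
      rw [h4]
      unfold slot
      beta_reduce
      rw [if_neg]
      intro h
      obtain ⟨i, hi⟩ := Nat.exists_eq_add_of_le h.1
      exact slot_addr_ne hk hj (show i < S by omega) (by omega)
    refine ⟨mc, hq, fun r hr => ?_, fun r hr => ?_, fun j hj => ?_, fun hk j hj h => ?_,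
      fun k'' j hk hk' hj => ?_⟩
    · rw [← near.reg r hr, h4]
      exact if_neg (by omega)
    · rw [h4]
      unfold slot
      beta_reduce
      rw [if_pos (by omega)]
      congr 1
      omega
    · rw [h4]
      unfold slot
      beta_reduce
      rw [if_pos (by omega)]
      congr 1
      omega
    · rw [hne k j hk hj, hold j hj h]
    · rw [hne k'' j hk' hj, near.oth k'' j hk hj]

/-- What is known in the course of `filt`. -/
structure _root_.Filtering (S r k c : ℕ) (m m' : ℕ → ℕ) : Prop where
  reg : ∀ x < 60, x ≠ r → x ≠ c → m' x = m x
  oth : ∀ k' j, k' ≠ k → j < S → slot S m' k' j = slot S m k' j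

structure _root_.Filtered (S r k c : ℕ) (L : List ℕ) (m m' : ℕ → ℕ) : Prop
    extends Filtering S r k c m m' where
  count : m' c = L.length
  new : ∀ a (h : a < L.length), slot S m' k a = L[a]

/-- No branching is needed: every value is written at the current end of the list, but the counter
advances only by `p`. A rejected value is overwritten by the next one or left behind the end. -/
theorem filt {r k c nv : ℕ} {n e p : WordExpr} {g : ℕ → ℕ} {P : ℕ → Prop} [DecidablePred P]
    (hr : r < 60) (hc : c < 60) (hrc : r ≠ c) (h2r : 2 ≠ r) (h2c : 2 ≠ c) (hS : m 2 = S)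
    (hsm : (n - reg r).Small ∧ (adr k (reg c + reg 63)).Small ∧ e.Small ∧ (reg c + p).Small)
    (hb : nv ≤ S) (hn : ∀ m', Filtering S r k c m m' → n.eval m' = nv)
    (he : ∀ j < nv, ∀ m', m' r = j → Filtering S r k c m m' → e.eval m' = g j)
    (hp : ∀ j < nv, ∀ m', m' r = j → Filtering S r k c m m' → p.eval m' = if P j then 1 else 0)
    (hg : (∀ a, m a ≤ R.X) → ∀ j < nv, g j ≤ R.X) :
    Run R (filt r k c n e p) m (4000 * (nv + 1))
      (Filtered S r k c (((List.range nv).filter P).map g) m) := by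
  refine bounded fun hm => ?_
  have hSX : S ≤ R.X := hS ▸ hm 2
  have hX := R.hX
  refine Run.cons (Run.set (by omega) (by decide) (v := 0) (by simp) (fun _ => by omega))
    (by omega) fun m1 T1 hT1 h1 => ?_
  refine Run.cons (Q' := Filtered S r k c (((List.range nv).filter P).map g) m)
    (Run.forr (T := 2800) (nv := nv)
      (I := fun j => Filtered S r k c (((List.range j).filter P).map g) m) (by omega) hsm.1
      (fun _ => by omega) (fun j m' h => hn m' h.toFiltering) ?_ ?_) (by lia) (fun m' T' hT' h => Run.nil (by lia) h)
  · subst h1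
    refine ⟨⟨fun x hx hxr hxc => ?_, fun k' j hk hj => ?_⟩, ?_, fun a ha => absurd ha (by simp)⟩
    · rw [Function.update_of_ne hxr, Function.update_of_ne hxc]
    · rw [slot_update (by omega), slot_update (by omega)]
    · rw [Function.update_of_ne hrc.symm]; simp
  · intro j hj m2 _ hI hmr
    set L := ((List.range j).filter P).map g with hL
    have hLj : L.length ≤ j := by
      rw [hL, List.length_map]
      exact (List.length_filter_le _ _).trans (by simp)
    have hnear : ∀ m', Near S k m2 m' → Filtering S r k c m m' := fun m' h =>
      ⟨fun x hx hxr hxc => by rw [h.reg x hx, hI.reg x hx hxr hxc],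
        fun k' j hk hj => by rw [h.oth k' j hk hj, hI.oth k' j hk hj]⟩
    refine Run.cons (Run.tab (S := S) (nv := 1) (ov := L.length) (g := fun _ => g j)
      (by rw [hI.reg 2 (by norm_num) h2r h2c, hS]) ⟨by decide, hsm.2.1, hsm.2.2.1⟩
      (fun m' h => by rw [eval_reg, h.reg c hc, hI.count]) (fun _ _ => rfl) (by omega)
      (fun _ _ m' _ hw => he j hj m' (by rw [hw.reg r hr, hmr]) (hnear m' hw.toNear))
      (fun _ _ _ => hg hm j hj)) (by omega) fun m3 T3 hT3 h3 => ?_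
    refine Run.cons (Run.set (v := L.length + if P j then 1 else 0) (by omega) hsm.2.2.2 ?_ ?_)
      (by omega) fun m4 T4 hT4 h4 => Run.nil (by omega) ?_
    · rw [eval_add, eval_reg, h3.reg c hc, hI.count,
        hp j hj m3 (by rw [h3.reg r hr, hmr]) (hnear m3 h3.toNear)]
    · intro _
      split_ifs <;> omega
    · have hL' : ((List.range (j + 1)).filter P).map g = L ++ if P j then [g j] else [] := by
        rw [List.range_succ, List.filter_append, List.map_append, ← hL]
        by_cases h : P j <;> simp [h]
      rw [hL']
      subst h4
      refine ⟨?_, ⟨fun x hx hxr hxc => ?_, fun k' i hk hi => ?_⟩, ?_, fun a ha => ?_⟩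
      · rw [Function.update_of_ne hrc, h3.reg r hr, hmr]
      · rw [Function.update_of_ne hxr, Function.update_of_ne hxc, h3.reg x hx,
          hI.reg x hx hxr hxc]
      · rw [slot_update (by omega), slot_update (by omega), h3.oth k' i hk hi, hI.oth k' i hk hi]
      · rw [Function.update_of_ne hrc.symm, Function.update_self]
        split_ifs <;> simp
      · rw [slot_update (by omega), slot_update (by omega)]
        by_cases haL : a < L.length
        · rw [List.getElem_append_left haL, h3.old a (by omega) (by omega), hI.new a haL]
        · by_cases hP : P j
          · simp only [hP, if_true, List.length_append, List.length_singleton] at ha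
            obtain rfl : a = L.length := by omega
            simpa [hP] using h3.new 0 (by omega)
          · simp [hP] at ha; omega
end Run

/-! ### Products of matrices -/

/-- The entries of the `h × N` matrix `A` are stored in the slot `k` from the entry `o` on. -/
def Holds (S : ℕ) (m : ℕ → ℕ) (k o h N : ℕ) (A : ℕ → ℕ → ZMod 2) : Prop :=
  ∀ q < h * N, slot S m k (o + q) = (A (q / N) (q % N)).val

theorem ZMod.val_two_le (x : ZMod 2) : x.val ≤ 1 := Nat.lt_succ_iff.mp x.val_lt

theorem add_mul_lt {i h j N : ℕ} (hi : i < h) (hj : j < N) : i * N + j < h * N :=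
  calc i * N + j < i * N + N := by omega
    _ = (i + 1) * N := by ring
    _ ≤ h * N := Nat.mul_le_mul_right _ hi

theorem div_lt_of_lt_mul {q h N : ℕ} (hq : q < h * N) : q / N < h :=
  Nat.div_lt_of_lt_mul (by rwa [Nat.mul_comm])

theorem mod_lt_of_lt_mul {q h N : ℕ} (hq : q < h * N) : q % N < N :=
  Nat.mod_lt _ (Nat.pos_of_ne_zero (by rintro rfl; simp at hq))

theorem mul_add_div' {i j N : ℕ} (hj : j < N) : (i * N + j) / N = i := by
  rw [Nat.mul_comm, Nat.mul_add_div (by omega), Nat.div_eq_of_lt hj, Nat.add_zero]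

theorem mul_add_mod' {i j N : ℕ} (hj : j < N) : (i * N + j) % N = j := by
  rw [Nat.mul_comm, Nat.mul_add_mod, Nat.mod_eq_of_lt hj]

theorem div_mul_add_mod (q N : ℕ) : q / N * N + q % N = q := by
  rw [Nat.mul_comm]; exact Nat.div_add_mod q N

theorem Holds.get {S k o h N : ℕ} {m : ℕ → ℕ} {A : ℕ → ℕ → ZMod 2} (H : Holds S m k o h N A)
    {i j : ℕ} (hi : i < h) (hj : j < N) : slot S m k (o + (i * N + j)) = (A i j).val := by
  rw [H _ (add_mul_lt hi hj), mul_add_div' hj, mul_add_mod' hj]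

theorem Holds.congr {S k o h N k' o' : ℕ} {m m' : ℕ → ℕ} {A : ℕ → ℕ → ZMod 2}
    (H : Holds S m k o h N A)
    (hs : ∀ q < h * N, slot S m' k' (o' + q) = slot S m k (o + q)) : Holds S m' k' o' h N A :=
  fun q hq => by rw [hs q hq, H q hq]

/-- The procedure `f` multiplies `k × k` matrices in time `TM k` for `k ≤ N`. -/
def MulProc (R : RAM) (f N : ℕ) (TM : ℕ → ℕ) : Prop :=
  ∃ c, R.procs[f]? = some c ∧ ∀ k, 1 ≤ k → k ≤ N → ∀ (A B : ℕ → ℕ → ZMod 2) (m : ℕ → ℕ),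
    m 0 = k → (∀ q < k * k, m (1 + q) = (A (q / k) (q % k)).val) →
    (∀ q < k * k, m (1 + k * k + q) = (B (q / k) (q % k)).val) →
    (∀ a, 1 + 2 * (k * k) ≤ a → m a = 0) →
    ∃ m' t, Exec R.W R.procs c m m' t ∧ t ≤ TM k ∧
      ∀ q < k * k, m' q = (∑ t ∈ Finset.range k, A (q / k) t * B t (q % k)).val

/-- Multiplies an `h × h` matrix with an `h × N` matrix, where `h` divides `N`. -/
def bmul (f : ℕ) : Cmd := prog [
  tab 1 0 1 (reg 0),
  tab 1 1 (reg 0 * reg 0) (ld 0 (0 + reg 63)),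
  forr 10 (reg 1 / reg 0) (prog [
    tab 1 (1 + reg 0 * reg 0) (reg 0 * reg 0)
      (ld 0 (reg 0 * reg 0 + (reg 63 / reg 0 * reg 1 + (reg 10 * reg 0 + reg 63 % reg 0)))),
    .call f (adr 1 0) (1 + 2 * (reg 0 * reg 0)) (adr 2 (reg 10 * (reg 0 * reg 0)))
      (reg 0 * reg 0)]),
  tab 0 0 (reg 0 * reg 1)
    (ld 2 (reg 63 % reg 1 / reg 0 * (reg 0 * reg 0) +
      (reg 63 / reg 1 * reg 0 + reg 63 % reg 1 % reg 0)))]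

namespace Run

variable {m : ℕ → ℕ} {S h N f : ℕ} {TM : ℕ → ℕ} {G E : ℕ → ℕ → ZMod 2}

structure BmulInv (S h N : ℕ) (G E : ℕ → ℕ → ZMod 2) (b : ℕ) (m : ℕ → ℕ) : Prop where
  r0 : m 0 = h
  r1 : m 1 = N
  r2 : m 2 = S
  hE : Holds S m 0 (h * h) h N E
  len : slot S m 1 0 = h
  hG : Holds S m 1 1 h h G
  prod : ∀ b' < b, ∀ q < h * h, slot S m 2 (b' * (h * h) + q) =
    (∑ t ∈ Finset.range h, G (q / h) t * E t (b' * h + q % h)).val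

/-- The `h × N` matrix is cut into `N / h` square blocks of columns. Slot 1 has the layout `h`, `G`,
block that the multiplication expects, so only the block changes from call to call; the products are
lined up in slot 2, and their rows are interleaved at the end. -/
theorem bmul (hf : MulProc R f N TM) (m0 : m 0 = h) (m1 : m 1 = N) (m2 : m 2 = S) (h1 : 1 ≤ h)
    (hd : h ∣ N) (hN : 0 < N) (hS : 3 * (N * N) + N + 200 ≤ S) (hG : Holds S m 0 0 h h G)
    (hE : Holds S m 0 (h * h) h N E) :
    Run R (bmul f) m ((N / h) * (TM h + 1103 * (h * h) + 5000) + 2200 * (h * N) + 10000)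
      (fun m' => Holds S m' 0 0 h N (fun i j => ∑ t ∈ Finset.range h, G i t * E t j)) := by
  have hhN : h ≤ N := Nat.le_of_dvd hN hd
  have hh : h * h ≤ h * N := Nat.mul_le_mul_left _ hhN
  have hNN : h * N ≤ N * N := Nat.mul_le_mul_right _ hhN
  have hX := R.hX
  have hnb : N / h * (h * h) = h * N := by
    rw [← Nat.mul_assoc, Nat.div_mul_cancel hd, Nat.mul_comm]
  refine bounded fun hm => ?_
  have hSX : S ≤ R.X := m2 ▸ hm 2
  refine Run.cons (Run.tab (S := S) (ov := 0) (nv := 1) (g := fun _ => h) m2 (by decide)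
    (fun _ _ => rfl) (fun _ _ => rfl) (by omega)
    (fun j hj m' _ hw => by simp [hw.reg, m0]) (fun hm j hj => m0 ▸ hm 0)) (by omega)
    fun ma T1 hT1 ha => ?_
  refine Run.cons (Run.tab (S := S) (ov := 1) (nv := h * h)
    (g := fun q => (G (q / h) (q % h)).val) (by simp [ha.reg, m2]) (by decide)
    (fun _ _ => rfl) (fun m' hm' => by simp [hm'.reg, ha.reg, m0]) (by omega)
    (fun j hj m' h63 hw => by
      rw [eval_ld, hw.reg 2 (by norm_num), ha.reg 2 (by norm_num), m2, eval_add, eval_reg, h63,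
        eval_ofNat, hw.oth 0 _ (by norm_num) (by omega), ha.oth 0 _ (by norm_num) (by omega),
        hG j hj])
    (fun hm j hj => (ZMod.val_two_le _).trans (by omega))) (by omega) fun mb T2 hT2 hb => ?_
  refine Run.cons (Run.forr (T := TM h + 1103 * (h * h) + 4000) (nv := N / h)
    (I := BmulInv S h N G E) (by norm_num) (by decide)
    (fun hm => (Nat.div_le_self _ _).trans (by rw [← m1]; omega))
    (fun j m' hI => by simp [hI.r0, hI.r1]) ?_ ?_) ?_ fun mc T3 hT3 hc => ?_
  · refine ⟨by simp [hb.reg, ha.reg, m0], by simp [hb.reg, ha.reg, m1],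
      by simp [hb.reg, ha.reg, m2], hE.congr fun q hq => ?_, ?_, fun q hq => ?_,
      fun b' hb' => absurd hb' (by simp)⟩
    · rw [slot_update (by norm_num), hb.oth 0 _ (by norm_num) (by omega),
        ha.oth 0 _ (by norm_num) (by omega)]
    · rw [slot_update (by norm_num), hb.old 0 (by omega) (by omega)]
      exact ha.new 0 (by omega)
    · rw [slot_update (by norm_num)]
      exact hb.new q hq
  · intro b hbn md hmd hI hr10
    have hbh : b * (h * h) + h * h ≤ h * N := by
      rw [← hnb, ← Nat.succ_mul]
      exact Nat.mul_le_mul_right _ hbn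
    have hbh' : b * h + h ≤ N := by
      rw [← Nat.succ_mul, ← Nat.div_mul_cancel hd]
      exact Nat.mul_le_mul_right _ hbn
    refine Run.cons (Run.tab (S := S) (ov := 1 + h * h) (nv := h * h)
      (g := fun q => (E (q / h) (b * h + q % h)).val) hI.r2 (by decide)
      (fun m' hm' => by simp [hm'.reg, hI.r0]) (fun m' hm' => by simp [hm'.reg, hI.r0]) (by omega)
      (fun j hj m' h63 hw => ?_) (fun hm j hj => (ZMod.val_two_le _).trans (by omega))) (by omega)
      fun me T4 hT4 he => ?_
    · have hj1 := mod_lt_of_lt_mul hj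
      have hlt := add_mul_lt (div_lt_of_lt_mul hj) (show b * h + j % h < N by omega)
      simp only [eval_ld, eval_add, eval_mul, eval_div, eval_mod, eval_reg, h63,
        hw.reg 2 (by norm_num), hw.reg 1 (by norm_num), hw.reg 0 (by norm_num),
        hw.reg 10 (by norm_num), hI.r0, hI.r1, hI.r2, hr10]
      rw [hw.oth 0 _ (by norm_num) (by omega)]
      exact hI.hE.get (div_lt_of_lt_mul hj) (by omega)
    · obtain ⟨c, hc, hspec⟩ := hf
      have e0 : me 0 = h := by rw [he.reg 0 (by norm_num), hI.r0]
      have e2 : me 2 = S := by rw [he.reg 2 (by norm_num), hI.r2]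
      have e10 : me 10 = b := by rw [he.reg 10 (by norm_num), hr10]
      refine Run.cons (Run.call (T := TM h)
        (Q' := fun m' => ∀ q < h * h, m' q =
          (∑ t ∈ Finset.range h, G (q / h) t * E t (b * h + q % h)).val) hc (by decide) (by decide)
        (by decide) (by decide) fun hme => ?_) ?_ fun mf T5 hT5 hf => Run.nil ?_ ?_
      · simp only [eval_add, eval_mul, eval_reg, eval_ofNat, eval_adr, e0, e2]
        refine Exists.elim (hspec h h1 hhN G (fun i j => E i (b * h + j))
          (fun i => if i < 1 + 2 * (h * h) then me (64 + 1 * S + 0 + i) else 0) ?_ ?_ ?_ ?_)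
          fun m' ⟨t, hex, ht, hq⟩ => ?_
        rotate_left 4
        · exact ⟨m', t, hex, ht, fun q hq' => by
            rw [hq q hq']; exact (ZMod.val_two_le _).trans (by omega), hq⟩
        · rw [if_pos (by omega)]
          exact (he.old 0 (by omega) (by omega)).trans hI.len
        · intro q hq
          rw [if_pos (by omega)]
          exact (he.old (1 + q) (by omega) (by omega)).trans (hI.hG q hq)
        · intro q hq
          rw [if_pos (by omega)]
          exact he.new q hq
        -- The call passes exactly `1 + 2 * (h * h)` words; the memory of the procedure is zero
        -- beyond, as in `Program.Computes`.
        · intro a ha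
          rw [if_neg (by omega)]
      · simp only [eval_add, eval_mul, eval_reg, eval_ofNat, e0]; omega
      · simp only [eval_add, eval_mul, eval_reg, eval_ofNat, e0] at hT5; omega
      · obtain ⟨mr, hr, hmf⟩ := hf
        simp only [eval_mul, eval_reg, eval_adr, e0, e2, e10] at hmf
        have hreg : ∀ x < 60, mf x = me x := fun x hx => by rw [hmf]; exact if_neg (by omega)
        have hoth : ∀ k j, k ≤ 1 → j < S → slot S mf k j = slot S me k j := fun k j hk hj => by
          have : k * S ≤ 1 * S := Nat.mul_le_mul_right _ hk
          rw [hmf]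
          exact if_neg (by omega)
        refine ⟨?_, ?_, ?_, ?_, hI.hE.congr fun q hq => ?_, ?_, hI.hG.congr fun q hq => ?_,
          fun b' hb' q hq => ?_⟩
        · exact (hreg 10 (by norm_num)).trans e10
        · rw [Function.update_of_ne (by norm_num)]
          exact (hreg 0 (by norm_num)).trans e0
        · rw [Function.update_of_ne (by norm_num)]
          exact (hreg 1 (by norm_num)).trans (by rw [he.reg 1 (by norm_num), hI.r1])
        · rw [Function.update_of_ne (by norm_num)]
          exact (hreg 2 (by norm_num)).trans e2
        · rw [slot_update (by norm_num), hoth 0 _ (by omega) (by omega),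
            he.oth 0 _ (by norm_num) (by omega)]
        · rw [slot_update (by norm_num), hoth 1 _ (by omega) (by omega),
            he.old 0 (by omega) (by omega), hI.len]
        · rw [slot_update (by norm_num), hoth 1 _ (by omega) (by omega),
            he.old _ (by omega) (by omega)]
        · rw [slot_update (by norm_num)]
          rcases Nat.lt_succ_iff_lt_or_eq.mp hb' with hb' | rfl
          · have : b' * (h * h) + h * h ≤ b * (h * h) := by
              rw [← Nat.succ_mul]
              exact Nat.mul_le_mul_right _ hb'
            rw [← hI.prod b' hb' q hq, ← he.oth 2 _ (by norm_num) (by omega), hmf]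
            exact if_neg (by omega)
          · rw [← hr q hq, hmf]
            unfold slot
            beta_reduce
            rw [if_pos (by omega)]
            congr 1
            omega
  · have : N / h * (TM h + 1103 * (h * h) + 4000 + 1000) =
      N / h * (TM h + 1103 * (h * h) + 5000) := by ring
    omega
  · refine Run.cons (Run.tab (S := S) (ov := 0) (nv := h * N)
      (g := fun q => (∑ t ∈ Finset.range h, G (q / N) t * E t (q % N)).val) hc.r2 (by decide)
      (fun _ _ => rfl) (fun m' hm' => by simp [hm'.reg, hc.r0, hc.r1]) (by omega)
      (fun j hj m' h63 hw => ?_) (fun hm j hj => (ZMod.val_two_le _).trans (by omega))) ?_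
      fun md T4 hT4 hd => Run.nil ?_ fun q hq => hd.new q hq
    · have hj1 := mod_lt_of_lt_mul hj
      have hj2 := div_lt_of_lt_mul hj
      have hj3 : j % N / h < N / h := Nat.div_lt_div_of_lt_of_dvd hd hj1
      have hj4 : j / N * h + j % N % h < h * h := add_mul_lt hj2 (Nat.mod_lt _ (by omega))
      have hlt := add_mul_lt hj3 hj4
      simp only [eval_ld, eval_add, eval_mul, eval_div, eval_mod, eval_reg, h63,
        hw.reg 2 (by norm_num), hw.reg 1 (by norm_num), hw.reg 0 (by norm_num), hc.r0, hc.r1, hc.r2]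
      rw [hw.oth 2 _ (by norm_num) (by omega), hc.prod _ hj3 _ hj4,
        mul_add_div' (Nat.mod_lt _ (by omega)), mul_add_mod' (Nat.mod_lt _ (by omega)),
        div_mul_add_mod]
    · have : N / h * (TM h + 1103 * (h * h) + 4000 + 1000) =
        N / h * (TM h + 1103 * (h * h) + 5000) := by ring
      omega
    · have : N / h * (TM h + 1103 * (h * h) + 4000 + 1000) =
        N / h * (TM h + 1103 * (h * h) + 5000) := by ring
      omega

end Run

/-! ### Gaussian elimination -/

/-- The nonzero rows of the `h × N` matrix `E` have their first nonzero entry in the columns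
`piv i`, and these columns are distinct unit vectors. For zero rows `piv i = N`. -/
structure Reduced (h N : ℕ) (E : ℕ → ℕ → ZMod 2) (piv : ℕ → ℕ) : Prop where
  le : ∀ i < h, piv i ≤ N
  unit : ∀ i < h, ∀ i' < h, piv i' < N → E i (piv i') = if i = i' then 1 else 0
  zero : ∀ i < h, ∀ j < N, j < piv i → E i j = 0

/-- The vector `x` is in the kernel of the `h × N` matrix `A`. -/
def InKer (h N : ℕ) (A : ℕ → ℕ → ZMod 2) (x : ℕ → ZMod 2) : Prop :=
  ∀ i < h, ∑ j ∈ Finset.range N, A i j * x j = 0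

/-- Zero columns are visible in the kernel. They are the one property that has to pass from a matrix
to its reduced form, so equality of kernels can replace a record of row operations. -/
theorem InKer.single_iff {h N : ℕ} {A : ℕ → ℕ → ZMod 2} {j : ℕ} (hj : j < N) :
    InKer h N A (fun j' => if j' = j then 1 else 0) ↔ ∀ i < h, A i j = 0 := by
  simp [InKer, hj]

/-- The product that has to be added to `B` to clear the columns of the pivots of `E`. -/
def clearing (h N : ℕ) (B E : ℕ → ℕ → ZMod 2) (piv : ℕ → ℕ) (i j : ℕ) : ZMod 2 :=
  ∑ t ∈ Finset.range h, (if piv t < N then B i (piv t) else 0) * E t j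

/-- The matrix with the first `h` rows from `A` and the following from `B`. -/
def stack {α : Type*} (h : ℕ) (A B : ℕ → α) (i : ℕ) : α := if i < h then A i else B (i - h)

theorem stack_left {α : Type*} {h i : ℕ} (A B : ℕ → α) (hi : i < h) : stack h A B i = A i :=
  if_pos hi

theorem stack_right {α : Type*} (h i : ℕ) (A B : ℕ → α) : stack h A B (h + i) = B i := by
  unfold stack; rw [if_neg (by omega), Nat.add_sub_cancel_left]

theorem forall_lt_add {h : ℕ} {P : ℕ → Prop} :
    (∀ i < h + h, P i) ↔ (∀ i < h, P i) ∧ ∀ i < h, P (h + i) := by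
  refine ⟨fun H => ⟨fun i hi => H i (by omega), fun i hi => H _ (by omega)⟩, fun H i hi => ?_⟩
  by_cases h' : i < h
  · exact H.1 i h'
  · have := H.2 (i - h) (by omega)
    rwa [Nat.add_sub_cancel' (by omega)] at this

theorem inKer_stack {h N : ℕ} {A B : ℕ → ℕ → ZMod 2} {x : ℕ → ZMod 2} :
    InKer (h + h) N (stack h A B) x ↔ InKer h N A x ∧ InKer h N B x := by
  unfold InKer
  rw [forall_lt_add]
  refine and_congr (forall₂_congr fun i hi => ?_) (forall₂_congr fun i hi => ?_)
  · rw [stack_left _ _ hi]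
  · rw [stack_right]

/-- The rows that are added are combinations of rows of `E`, and these vanish on `x`. -/
theorem inKer_clear_iff {h N : ℕ} {B E : ℕ → ℕ → ZMod 2} {piv : ℕ → ℕ} {x : ℕ → ZMod 2}
    (hE : InKer h N E x) :
    InKer h N (fun i j => B i j + clearing h N B E piv i j) x ↔ InKer h N B x := by
  refine forall₂_congr fun i hi => ?_
  have : ∑ j ∈ Finset.range N, clearing h N B E piv i j * x j = 0 := by
    simp only [clearing, Finset.sum_mul]
    rw [Finset.sum_comm]
    refine Finset.sum_eq_zero fun t ht => ?_
    simp only [mul_assoc, ← Finset.mul_sum]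
    rw [hE t (Finset.mem_range.mp ht), mul_zero]
  simp only [add_mul, Finset.sum_add_distrib, this, add_zero]

/-- The pivot column of `E` is a unit vector, so the product reproduces the entry of `B`, and the
two cancel in characteristic 2. -/
theorem clear_pivot {h N : ℕ} {B E : ℕ → ℕ → ZMod 2} {piv : ℕ → ℕ} (hE : Reduced h N E piv)
    {i t : ℕ} (ht : t < h) (hp : piv t < N) :
    B i (piv t) + clearing h N B E piv i (piv t) = 0 := by
  unfold clearing
  rw [Finset.sum_eq_single_of_mem t (Finset.mem_range.mpr ht)]
  · rw [if_pos hp, hE.unit t ht t ht hp, if_pos rfl, mul_one]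
    exact CharTwo.add_self_eq_zero _
  · intro s hs hst
    rw [hE.unit s (Finset.mem_range.mp hs) t ht hp, if_neg hst, mul_zero]

theorem clearing_eq_zero {h N : ℕ} {B E : ℕ → ℕ → ZMod 2} {piv : ℕ → ℕ} {i j : ℕ}
    (hE : ∀ t < h, piv t < N → B i (piv t) ≠ 0 → E t j = 0) : clearing h N B E piv i j = 0 := by
  refine Finset.sum_eq_zero fun t ht => ?_
  split_ifs with hp
  · by_cases hB : B i (piv t) = 0
    · rw [hB, zero_mul]
    · rw [hE t (Finset.mem_range.mp ht) hp hB, mul_zero]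
  · rw [zero_mul]

theorem stack_self {α : Type*} (h : ℕ) (A : ℕ → α) : stack h A (fun i => A (h + i)) = A := by
  funext i
  unfold stack
  split_ifs with hi
  · rfl
  · exact congrArg A (by omega)

/-! ### Merging two reduced halves -/

section
variable {h N : ℕ} {A₁ A₂ E₁ E₂ : ℕ → ℕ → ZMod 2} {p₁ p₂ : ℕ → ℕ}

/-- Clearing by `E₁` is harmless on the kernel of `E₁`, clearing by `E₂` on the kernel of `E₂`. On
the common kernel each clearing can therefore be undone with the help of the other half. -/
theorem inKer_stack_clear (k₁ : ∀ x, InKer h N A₁ x ↔ InKer h N E₁ x)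
    (k₂ : ∀ x, InKer h N (fun i j => A₂ i j + clearing h N A₂ E₁ p₁ i j) x ↔ InKer h N E₂ x)
    (x : ℕ → ZMod 2) :
    InKer (h + h) N (stack h A₁ A₂) x ↔
      InKer (h + h) N (stack h (fun i j => E₁ i j + clearing h N E₁ E₂ p₂ i j) E₂) x := by
  rw [inKer_stack, inKer_stack, k₁]
  constructor
  · rintro ⟨h1, h2⟩
    have h3 := (k₂ x).mp ((inKer_clear_iff h1).mpr h2)
    exact ⟨(inKer_clear_iff h3).mpr h1, h3⟩
  · rintro ⟨h1, h3⟩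
    have h1 := (inKer_clear_iff h3).mp h1
    exact ⟨h1, (inKer_clear_iff h1).mp ((k₂ x).mpr h3)⟩

theorem Reduced.stack_clear (r₁ : Reduced h N E₁ p₁) (r₂ : Reduced h N E₂ p₂)
    (k₂ : ∀ x, InKer h N (fun i j => A₂ i j + clearing h N A₂ E₁ p₁ i j) x ↔ InKer h N E₂ x) :
    Reduced (h + h) N (stack h (fun i j => E₁ i j + clearing h N E₁ E₂ p₂ i j) E₂)
      (stack h p₁ p₂) := by
  -- The unit vector at an upper pivot lies in the kernel of the cleared lower half, hence in that
  -- of `E₂`: reducing the lower half cannot refill the cleared columns.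
  have hz : ∀ t < h, p₁ t < N → ∀ i < h, E₂ i (p₁ t) = 0 := fun t ht hp =>
    (InKer.single_iff hp).mp ((k₂ _).mp ((InKer.single_iff hp).mpr fun i hi =>
      clear_pivot r₁ ht hp))
  constructor
  · refine forall_lt_add.mpr ⟨fun i hi => ?_, fun i hi => ?_⟩
    · rw [stack_left _ _ hi]; exact r₁.le i hi
    · rw [stack_right]; exact r₂.le i hi
  · refine forall_lt_add.mpr ⟨fun i hi => forall_lt_add.mpr ⟨fun t ht hp => ?_, fun t ht hp => ?_⟩,
      fun i hi => forall_lt_add.mpr ⟨fun t ht hp => ?_, fun t ht hp => ?_⟩⟩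
    · rw [stack_left _ _ ht] at hp ⊢
      rw [stack_left _ _ hi, clearing_eq_zero fun s hs _ _ => hz t ht hp s hs, add_zero,
        r₁.unit i hi t ht hp]
    · rw [stack_right] at hp ⊢
      rw [stack_left _ _ hi, clear_pivot r₂ ht hp, if_neg (by omega)]
    · rw [stack_left _ _ ht] at hp ⊢
      rw [stack_right, hz t ht hp i hi, if_neg (by omega)]
    · rw [stack_right] at hp ⊢
      rw [stack_right, r₂.unit i hi t ht hp]
      simp
  · refine forall_lt_add.mpr ⟨fun i hi j hj hp => ?_, fun i hi j hj hp => ?_⟩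
    · rw [stack_left _ _ hi] at hp ⊢
      rw [r₁.zero i hi j hj hp, zero_add]
      -- If `E₁ i (p₂ t) ≠ 0`, then `p₁ i ≤ p₂ t`, so the row of `E₂` that is added begins no
      -- further left than the row `i` of `E₁`, and the leading zeros survive.
      refine clearing_eq_zero fun t ht hpt hne => r₂.zero t ht j hj ?_
      by_contra hlt
      exact hne (r₁.zero i hi _ hpt (by omega))
    · rw [stack_right] at hp ⊢
      exact r₂.zero i hi j hj hp

end

/-! ### The recursive elimination on the machine -/

/-- Computes in the slot `4` the product that clears in the matrix in the slot `tk` the pivots of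
the reduced matrix in the slot `pk`. -/
def clearCmd (f tk : ℕ) (o : WordExpr) (pk : ℕ) : Cmd := prog [
  tab 3 64 (reg 3 * reg 3)
    (lt (ld pk (64 + (reg 3 * reg 1 + reg 63 % reg 3))) (reg 1) *
      ld tk (o + (reg 63 / reg 3 * reg 1 + ld pk (64 + (reg 3 * reg 1 + reg 63 % reg 3))))),
  tab 3 (64 + reg 3 * reg 3) (reg 3 * reg 1) (ld pk (64 + reg 63)),
  send f 3 (reg 3) (reg 3 * reg 3 + reg 3 * reg 1) 4 (reg 3 * reg 1)]

/-- The recursive procedure, of number `fR`, that reduces an `h × N` matrix, where `fB` is the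
number of `bmul`. -/
def rref (fB fR : ℕ) : Cmd := .ite (reg 0 - 1)
  (prog [
    .store (lit 3) (reg 0 / 2),
    tab 1 64 (reg 3 * reg 1) (ld 0 (0 + reg 63)),
    send fR 1 (reg 3) (reg 3 * reg 1) 2 (reg 3 * reg 1 + reg 3),
    clearCmd fB 0 (reg 3 * reg 1) 2,
    tab 1 64 (reg 3 * reg 1) ((ld 0 (reg 3 * reg 1 + reg 63) + ld 4 (64 + reg 63)) % 2),
    send fR 1 (reg 3) (reg 3 * reg 1) 5 (reg 3 * reg 1 + reg 3),
    clearCmd fB 2 64 5,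
    tab 0 0 (reg 3 * reg 1) ((ld 2 (64 + reg 63) + ld 4 (64 + reg 63)) % 2),
    tab 0 (reg 3 * reg 1) (reg 3 * reg 1) (ld 5 (64 + reg 63)),
    tab 0 (2 * (reg 3 * reg 1)) (reg 3) (ld 2 (64 + (reg 3 * reg 1 + reg 63))),
    tab 0 (2 * (reg 3 * reg 1) + reg 3) (reg 3) (ld 5 (64 + (reg 3 * reg 1 + reg 63)))])
  (prog [
    .store (lit 4) (reg 1),
    forr 10 (reg 1) (.store (lit 4) (ld 0 (reg 1 - 1 - reg 10) * (reg 1 - 1 - reg 10) +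
      (1 - ld 0 (reg 1 - 1 - reg 10)) * reg 4)),
    tab 0 (reg 1) 1 (reg 4)])

/-- A time bound for `bmul`. -/
def bmulTime (TM : ℕ → ℕ) (N h : ℕ) : ℕ :=
  (N / h) * (TM h + 1103 * (h * h) + 5000) + 2200 * (h * N) + 10000

/-- A time bound for `rref` for matrices with `2 ^ j` rows. -/
def rrefTime (TM : ℕ → ℕ) (N : ℕ) : ℕ → ℕ
  | 0 => 2000 * N + 10000
  | j + 1 => 2 * rrefTime TM N j + 2 * bmulTime TM N (2 ^ j) + 20000 * (2 ^ j * N) + 100000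

namespace Run

variable {m : ℕ → ℕ} {S h N f fB fR : ℕ} {TM : ℕ → ℕ}

/-- Gathering the columns of `B` at the pivots into an `h × h` matrix, with zero columns for the
zero rows of `E`, turns the whole correction into a single use of `bmul` and makes row or column
permutations unnecessary. -/
theorem clearCmd (hf : MulProc R f N TM) (hfB : R.procs[fB]? = some (_root_.bmul f)) {tk pk ov : ℕ}
    {o : WordExpr} {B E : ℕ → ℕ → ZMod 2} {piv : ℕ → ℕ} (m1 : m 1 = N) (m2 : m 2 = S)
    (m3 : m 3 = h) (h1 : 1 ≤ h) (hd : h ∣ N) (hN : 0 < N) (hS : 3 * (N * N) + N + 200 ≤ S)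
    (htk : tk < 3) (hpk : pk ≠ 3 ∧ pk ≠ 4) (hsm : (lt (ld pk (64 + (reg 3 * reg 1 + reg 63 % reg 3)))
        (reg 1) * ld tk (o + (reg 63 / reg 3 * reg 1 +
          ld pk (64 + (reg 3 * reg 1 + reg 63 % reg 3))))).Small ∧ (ld pk (64 + reg 63)).Small)
    (ho : ∀ m', Near S 3 m m' → o.eval m' = ov) (hov : ov ≤ h * N + 64)
    (hB : Holds S m tk ov h N B) (hE : Holds S m pk 64 h N E)
    (hp : ∀ i < h, slot S m pk (64 + (h * N + i)) = piv i) :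
    Run R (clearCmd fB tk o pk) m (bmulTime TM N h + 5000 * (h * N) + 15000) (fun m' =>
      (∀ r < 60, m' r = m r) ∧
      (∀ k j, k ≠ 3 → k ≠ 4 → j < S → slot S m' k j = slot S m k j) ∧
      Holds S m' 4 64 h N (clearing h N B E piv)) := by
  have hhN : h ≤ N := Nat.le_of_dvd hN hd
  have hh : h * h ≤ h * N := Nat.mul_le_mul_left _ hhN
  have hNN : h * N ≤ N * N := Nat.mul_le_mul_right _ hhN
  have hX := R.hX
  refine Run.cons (Run.tab (S := S) (ov := 64) (nv := h * h)
    (g := fun q => (if piv (q % h) < N then B (q / h) (piv (q % h)) else 0).val) m2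
    ⟨by decide, by decide, hsm.1⟩ (fun _ _ => rfl) (fun m' hm' => by simp [hm'.reg, m3]) (by omega)
    (fun j hj m' h63 hw => ?_) (fun hm j hj => (ZMod.val_two_le _).trans (by omega))) (by omega)
    fun ma T1 hT1 ha => ?_
  · have hj1 := mod_lt_of_lt_mul hj
    have hj2 := div_lt_of_lt_mul hj
    simp only [eval_ld, eval_add, eval_mul, eval_div, eval_mod, eval_reg, h63, eval_lt, eval_ofNat,
      hw.reg 2 (by norm_num), hw.reg 1 (by norm_num), hw.reg 3 (by norm_num), m3, m1, m2,
      ho m' hw.toNear]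
    rw [hw.oth pk _ hpk.1 (by omega), hp _ hj1]
    split_ifs with hlt
    · have := add_mul_lt hj2 hlt
      rw [one_mul, hw.oth tk _ (by omega) (by omega)]
      exact hB.get hj2 hlt
    -- The pivot of a zero row is `N`. The load then hits a word outside the row in question, but
    -- the factor `lt` cancels it.
    · rw [zero_mul, ZMod.val_zero]
  refine Run.cons (Run.tab (S := S) (ov := 64 + h * h) (nv := h * N)
    (g := fun q => (E (q / N) (q % N)).val) (by rw [ha.reg 2 (by norm_num), m2])
    ⟨by decide, by decide, hsm.2⟩ (fun m' hm' => by simp [hm'.reg, ha.reg, m3])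
    (fun m' hm' => by simp [hm'.reg, ha.reg, m3, m1]) (by omega)
    (fun j hj m' h63 hw => ?_) (fun hm j hj => (ZMod.val_two_le _).trans (by omega))) (by omega)
    fun mb T2 hT2 hb => ?_
  · simp only [eval_ld, eval_add, eval_reg, h63, eval_ofNat,
      hw.reg 2 (by norm_num), ha.reg 2 (by norm_num), m2]
    rw [hw.oth pk _ hpk.1 (by omega), ha.oth pk _ hpk.1 (by omega), hE j hj]
  have b1 : mb 1 = N := by rw [hb.reg 1 (by norm_num), ha.reg 1 (by norm_num), m1]
  have b2 : mb 2 = S := by rw [hb.reg 2 (by norm_num), ha.reg 2 (by norm_num), m2]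
  have b3 : mb 3 = h := by rw [hb.reg 3 (by norm_num), ha.reg 3 (by norm_num), m3]
  refine Run.cons (Run.send (S := S) (av := h) (nv := h * h + h * N) (lv := h * N) hfB b2
    (by decide) (fun m' hm' => by simp [hm'.reg, b3]) (fun m' hm' => by simp [hm'.reg, b1, b3])
    (fun m' hm' => by simp [hm'.reg, b1, b3]) (by omega) (by omega) (fun hm => b3 ▸ hm 3)
    (T := bmulTime TM N h) (fun mc c0 c1 c2 hc => Run.bmul hf c0 (c1.trans b1) c2 h1 hd hN hS
      (G := fun i t => if piv t < N then B i (piv t) else 0) (E := E) ?_ ?_)) (by omega)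
    fun mc T3 hT3 ⟨mr, hr, hs⟩ => Run.nil (by omega) ?_
  · intro q hq
    rw [Nat.zero_add, hc q (by omega), hb.old _ (by omega) (by omega)]
    exact ha.new q hq
  · intro q hq
    rw [hc _ (by omega), ← Nat.add_assoc]
    exact hb.new q hq
  · refine ⟨fun r hr => by rw [hs.reg r hr, hb.reg r hr, ha.reg r hr], fun k j hk hk' hj => by
      rw [hs.oth k j hk hk' hj, hb.oth k j hk hj, ha.oth k j hk hj], fun q hq => ?_⟩
    rw [hs.new q hq]
    have := hr q hq
    rwa [Nat.zero_add] at this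

/-- A single row over `ℤ/2` is already reduced; only its pivot is missing. The scan runs from right
to left, so the last hit is the first nonzero entry, and the initial value `N` remains for a zero
row. -/
theorem rref_leaf {A : ℕ → ℕ → ZMod 2} (m0 : m 0 = 1) (m1 : m 1 = N) (m2 : m 2 = S) (hN : 0 < N)
    (hS : 3 * (N * N) + N + 200 ≤ S) (hA : Holds S m 0 0 1 N A) :
    Run R (rref fB fR) m (2000 * N + 10000) (fun m' => ∃ E piv, Reduced 1 N E piv ∧
      (∀ x, InKer 1 N A x ↔ InKer 1 N E x) ∧ Holds S m' 0 0 1 N E ∧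
      ∀ i < 1, slot S m' 0 (1 * N + i) = piv i) := by
  refine bounded fun hm => ?_
  have hNX : N ≤ R.X := m1 ▸ hm 1
  have hA' : ∀ j < N, slot S m 0 j = (A 0 j).val := fun j hj => by
    have := hA.get (i := 0) (by omega) hj
    rwa [Nat.zero_mul, Nat.zero_add, Nat.zero_add] at this
  refine Run.le (Run.ite_false (T := 2000 * N + 9000) (by decide) (by simp [m0]) ?_) (by omega)
  refine Run.cons (Run.set (v := N) (by norm_num) (by decide) (by simp [m1]) (fun _ => hNX))
    (by omega) fun ma T1 hT1 ha => ?_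
  refine Run.cons (Run.forr (T := 401) (nv := N)
    (I := fun j m' => (∀ r, r ≠ 4 → r ≠ 10 → r < 60 → m' r = m r) ∧
      (∀ i < S, slot S m' 0 i = slot S m 0 i) ∧ m' 4 ≤ N ∧ (m' 4 < N → A 0 (m' 4) = 1) ∧
      ∀ i < N, N - j ≤ i → i < m' 4 → A 0 i = 0) (by norm_num) (by decide) (fun _ => hNX)
    (fun j m' hI => by simp [hI.1, m1]) ?_ ?_) (by omega) fun mb T2 hT2 hb => ?_
  · subst ha
    refine ⟨fun r h4 h10 hr => ?_, fun i hi => ?_, ?_, ?_, fun i hi hi' _ => by omega⟩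
    · rw [Function.update_of_ne h10, Function.update_of_ne h4]
    · rw [slot_update (by norm_num), slot_update (by norm_num)]
    · simp
    · simp
  · rintro j hj mb hmb ⟨hr, hs, hle, h1, h0⟩ h10
    have hbit : slot S mb 0 (N - 1 - j) = (A 0 (N - 1 - j)).val := by
      rw [hs _ (by omega), hA' _ (by omega)]
    have hval := (show ∀ x : ZMod 2, x = 0 ∨ x = 1 by decide) (A 0 (N - 1 - j))
    refine Run.imp (Run.set (v := if A 0 (N - 1 - j) = 1 then N - 1 - j else mb 4) (by norm_num)
      (by decide) ?_ (fun _ => by split_ifs <;> omega)) fun mc hc => ?_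
    · simp only [eval_add, eval_mul, eval_sub, eval_ld, eval_reg, eval_ofNat, h10,
        hr 1 (by norm_num) (by norm_num) (by norm_num),
        hr 2 (by norm_num) (by norm_num) (by norm_num), m1, m2, hbit]
      rcases hval with h | h
      · simp [h]
      · simp [h, ZMod.val_one]
    · subst hc
      refine ⟨by simp [h10], fun r h4 h10 hr' => ?_, fun i hi => ?_, ?_, ?_, ?_⟩
      · rw [Function.update_of_ne h10, Function.update_of_ne h4, hr r h4 h10 hr']
      · rw [slot_update (by norm_num), slot_update (by norm_num), hs i hi]
      all_goals
        rw [Function.update_of_ne (by norm_num), Function.update_self]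
        split_ifs with h
      · omega
      · exact hle
      · exact fun _ => h
      · exact h1
      · intro i hi h2 h3; omega
      · intro i hi h2 h3
        by_cases hij : i = N - 1 - j
        · subst hij; exact hval.resolve_right h
        · exact h0 i hi (by omega) h3
  · obtain ⟨hr, hs, hle, h1, h0⟩ := hb
    have e1 : mb 1 = N := by rw [hr 1 (by norm_num) (by norm_num) (by norm_num), m1]
    have e2 : mb 2 = S := by rw [hr 2 (by norm_num) (by norm_num) (by norm_num), m2]
    have hNN : N * 1 ≤ N * N := Nat.mul_le_mul_left _ hN
    refine Run.cons (Run.tab (S := S) (ov := N) (nv := 1) (g := fun _ => mb 4) e2 (by decide)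
      (fun m' hm' => by simp [hm'.reg, e1]) (fun _ _ => rfl) (by omega)
      (fun j hj m' _ hw => by simp [hw.reg]) (fun hm _ _ => hm 4)) (by omega)
      fun mc T3 hT3 hc => Run.nil (by omega) ?_
    refine ⟨A, fun _ => mb 4, ⟨fun _ _ => hle, ?_, ?_⟩, fun x => Iff.rfl, hA.congr fun q hq => ?_,
      fun i hi => ?_⟩
    · intro i hi i' hi' hlt
      obtain rfl : i = 0 := by omega
      obtain rfl : i' = 0 := by omega
      simpa using h1 hlt
    · intro i hi j hj hlt
      obtain rfl : i = 0 := by omega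
      exact h0 j hj (by omega) hlt
    · rw [hc.old _ (by omega) (by omega), hs _ (by omega)]
    · obtain rfl : i = 0 := by omega
      rw [one_mul]
      exact hc.new 0 hi

theorem rref_output {mg : ℕ → ℕ} {E₁ E₂ C : ℕ → ℕ → ZMod 2} {p₁ p₂ : ℕ → ℕ} (g1 : mg 1 = N)
    (g2 : mg 2 = S) (g3 : mg 3 = h) (hN : 0 < N) (hS : 2 * (h * N) + h * 2 + 200 ≤ S)
    (l₁ : ∀ i < h, p₁ i ≤ N) (l₂ : ∀ i < h, p₂ i ≤ N) (hE₁ : Holds S mg 2 64 h N E₁)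
    (hE₂ : Holds S mg 5 64 h N E₂) (hC : Holds S mg 4 64 h N C)
    (hp₁ : ∀ i < h, slot S mg 2 (64 + (h * N + i)) = p₁ i)
    (hp₂ : ∀ i < h, slot S mg 5 (64 + (h * N + i)) = p₂ i) :
    Run R (prog [
      _root_.tab 0 0 (reg 3 * reg 1) ((ld 2 (64 + reg 63) + ld 4 (64 + reg 63)) % 2),
      _root_.tab 0 (reg 3 * reg 1) (reg 3 * reg 1) (ld 5 (64 + reg 63)),
      _root_.tab 0 (2 * (reg 3 * reg 1)) (reg 3) (ld 2 (64 + (reg 3 * reg 1 + reg 63))),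
      _root_.tab 0 (2 * (reg 3 * reg 1) + reg 3) (reg 3) (ld 5 (64 + (reg 3 * reg 1 + reg 63)))])
      mg (2200 * (h * N) + 2200 * h + 5000) (fun m' =>
        Holds S m' 0 0 (h + h) N (stack h (fun i j => E₁ i j + C i j) E₂) ∧
        ∀ i < h + h, slot S m' 0 ((h + h) * N + i) = stack h p₁ p₂ i) := by
  have hX := R.hX
  refine bounded fun hm => ?_
  refine Run.cons (Run.tab (S := S) (ov := 0) (nv := h * N)
    (g := fun q => (E₁ (q / N) (q % N) + C (q / N) (q % N)).val)
    g2 (by decide) (fun _ _ => rfl) (fun m' hm' => by simp [hm'.reg, g3, g1]) (by omega)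
    (fun q hq m' h63 hw => by
      simp only [eval_mod, eval_add, eval_ld, eval_reg, eval_ofNat, h63,
        hw.reg 2 (by norm_num), g2]
      rw [hw.oth 2 _ (by norm_num) (by omega), hw.oth 4 _ (by norm_num) (by omega),
        hE₁ q hq, hC q hq, ZMod.val_add])
    (fun _ _ _ => (ZMod.val_two_le _).trans (by omega))) (by omega) fun mh T8 hT8 hh => ?_
  refine Run.cons (Run.tab (S := S) (ov := h * N) (nv := h * N)
    (g := fun q => (E₂ (q / N) (q % N)).val)
    (by simp [hh.reg, g2]) (by decide) (fun m' hm' => by simp [hm'.reg, hh.reg, g3, g1])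
    (fun m' hm' => by simp [hm'.reg, hh.reg, g3, g1]) (by omega)
    (fun q hq m' h63 hw => by
      simp only [eval_add, eval_ld, eval_reg, eval_ofNat, h63,
        hw.reg 2 (by norm_num), hh.reg 2 (by norm_num), g2]
      rw [hw.oth 5 _ (by norm_num) (by omega), hh.oth 5 _ (by norm_num) (by omega),
        hE₂ q hq])
    (fun _ _ _ => (ZMod.val_two_le _).trans (by omega))) (by omega) fun mi T9 hT9 hi => ?_
  have hNX : N ≤ R.X := g1 ▸ hm 1
  refine Run.cons (Run.tab (S := S) (ov := 2 * (h * N)) (nv := h) (g := p₁)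
    (by simp [hi.reg, hh.reg, g2]) (by decide)
    (fun m' hm' => by simp [hm'.reg, hi.reg, hh.reg, g3, g1])
    (fun m' hm' => by simp [hm'.reg, hi.reg, hh.reg, g3]) (by omega)
    (fun q hq m' h63 hw => by
      simp only [eval_add, eval_ld, eval_mul, eval_reg, eval_ofNat, h63,
        hw.reg 2 (by norm_num), hi.reg 2 (by norm_num), hh.reg 2 (by norm_num), g2,
        hw.reg 1 (by norm_num), hi.reg 1 (by norm_num), hh.reg 1 (by norm_num), g1,
        hw.reg 3 (by norm_num), hi.reg 3 (by norm_num), hh.reg 3 (by norm_num), g3]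
      rw [hw.oth 2 _ (by norm_num) (by omega), hi.oth 2 _ (by norm_num) (by omega),
        hh.oth 2 _ (by norm_num) (by omega), hp₁ q hq])
    (fun _ i hi => (l₁ i hi).trans hNX)) (by omega) fun mj T10 hT10 hj => ?_
  refine Run.cons (Run.tab (S := S) (ov := 2 * (h * N) + h) (nv := h) (g := p₂)
    (by simp [hj.reg, hi.reg, hh.reg, g2]) (by decide)
    (fun m' hm' => by simp [hm'.reg, hj.reg, hi.reg, hh.reg, g3, g1])
    (fun m' hm' => by simp [hm'.reg, hj.reg, hi.reg, hh.reg, g3]) (by omega)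
    (fun q hq m' h63 hw => by
      simp only [eval_add, eval_ld, eval_mul, eval_reg, eval_ofNat, h63, hw.reg 2 (by norm_num),
        hj.reg 2 (by norm_num), hi.reg 2 (by norm_num), hh.reg 2 (by norm_num), g2,
        hw.reg 1 (by norm_num), hj.reg 1 (by norm_num), hi.reg 1 (by norm_num),
        hh.reg 1 (by norm_num), g1, hw.reg 3 (by norm_num), hj.reg 3 (by norm_num),
        hi.reg 3 (by norm_num), hh.reg 3 (by norm_num), g3]
      rw [hw.oth 5 _ (by norm_num) (by omega), hj.oth 5 _ (by norm_num) (by omega),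
        hi.oth 5 _ (by norm_num) (by omega),
        hh.oth 5 _ (by norm_num) (by omega), hp₂ q hq])
    (fun _ i hi => (l₂ i hi).trans hNX)) (by omega) fun mk T11 hT11 hk =>
      Run.nil (by omega) ?_
  refine ⟨?_, ?_⟩
  · intro q hq
    rw [Nat.add_mul] at hq
    rw [Nat.zero_add, hk.old _ (by omega) (by omega), hj.old _ (by omega) (by omega)]
    by_cases hlt : q < h * N
    · rw [hi.old _ (by omega) (by omega), stack_left _ _ (div_lt_of_lt_mul hlt)]
      have := hh.new q hlt
      rwa [Nat.zero_add] at this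
    · obtain ⟨q, rfl⟩ := Nat.exists_eq_add_of_le (Nat.le_of_not_lt hlt)
      rw [hi.new q (by omega), Nat.mul_comm h N, Nat.mul_add_div hN, Nat.mul_add_mod,
        stack_right]
  · refine forall_lt_add.mpr ⟨fun i hi' => ?_, fun i hi' => ?_⟩
    · rw [stack_left _ _ hi', hk.old _ (by rw [Nat.add_mul]; omega) (by rw [Nat.add_mul]; omega),
        Nat.add_mul, ← two_mul]
      exact hj.new i hi'
    · rw [stack_right, ← hk.new i hi', Nat.add_mul, ← two_mul, Nat.add_assoc]

/-- Induction on the depth of the recursion, with the executions of the two inner calls supplied by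
the induction hypothesis. The number of columns stays `N` throughout. The lower half is reduced only
after clearing, and the correction goes back to the upper half; `Reduced.stack_clear` and
`inKer_stack_clear` are the mathematics of this step. -/
theorem rref (hf : MulProc R f N TM) (hfB : R.procs[fB]? = some (_root_.bmul f))
    (hfR : R.procs[fR]? = some (rref fB fR)) (hN : 0 < N) (hS : 3 * (N * N) + N + 200 ≤ S) (j : ℕ)
    (hd : 2 ^ j ∣ N) (m : ℕ → ℕ) (A : ℕ → ℕ → ZMod 2) (m0 : m 0 = 2 ^ j) (m1 : m 1 = N)
    (m2 : m 2 = S) (hA : Holds S m 0 0 (2 ^ j) N A) :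
    Run R (_root_.rref fB fR) m (rrefTime TM N j) (fun m' => ∃ E piv, Reduced (2 ^ j) N E piv ∧
      (∀ x, InKer (2 ^ j) N A x ↔ InKer (2 ^ j) N E x) ∧ Holds S m' 0 0 (2 ^ j) N E ∧
      ∀ i < 2 ^ j, slot S m' 0 (2 ^ j * N + i) = piv i) := by
  induction j generalizing m A with
  | zero => exact rref_leaf m0 m1 m2 hN hS hA
  | succ j ih =>
    have hd' : 2 ^ j ∣ N := (pow_dvd_pow 2 (Nat.le_succ j)).trans hd
    have hle : 2 ^ (j + 1) ≤ N := Nat.le_of_dvd hN hd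
    have h1 : 1 ≤ 2 ^ j := Nat.one_le_two_pow
    have ih := ih hd'
    rw [rrefTime]
    have hclear := fun {tk pk ov o B E piv m} => Run.clearCmd (h := 2 ^ j) (S := S) (tk := tk)
      (pk := pk) (ov := ov) (o := o) (B := B) (E := E) (piv := piv) (m := m) hf hfB
    generalize bmulTime TM N (2 ^ j) = TB at *
    generalize rrefTime TM N j = TR at *
    -- From here on `h` is half the number of rows, and that it is a power of two is forgotten; the
    -- linear arithmetic below treats `h * N` as an atom.
    rw [pow_succ, mul_two] at m0 hA hle ⊢
    generalize 2 ^ j = h at *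
    have hNN : (h + h) * N ≤ N * N := Nat.mul_le_mul_right _ hle
    rw [Nat.add_mul] at hNN
    have hhN : h * 1 ≤ h * N := Nat.mul_le_mul_left _ hN
    have hX := R.hX
    have hlow : ∀ q < h * N, slot S m 0 q = (A (q / N) (q % N)).val := fun q hq => by
      rw [← hA q (by rw [Nat.add_mul]; omega), Nat.zero_add]
    have hhigh : ∀ q < h * N, slot S m 0 (h * N + q) = (A (h + q / N) (q % N)).val :=
      fun q hq => by
        have := hA.get (i := h + q / N) (j := q % N)
          (by have := div_lt_of_lt_mul hq; omega) (mod_lt_of_lt_mul hq)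
        rw [← this, Nat.zero_add, Nat.add_mul, Nat.add_assoc, div_mul_add_mod]
    refine bounded fun hm => ?_
    refine Run.le (Run.ite_true (T := 2 * TR + 2 * TB + 20000 * (h * N) + 99000) (by decide)
      (by simp [m0]; omega) ?_) (by omega)
    refine Run.cons (Run.set (v := h) (by norm_num) (by decide) (by simp [m0]; omega)
      (fun hm => by have := hm 0; omega)) (by omega) fun ma T1 hT1 ha => ?_
    have a1 : ma 1 = N := by simp [ha, m1]
    have a2 : ma 2 = S := by simp [ha, m2]
    have a3 : ma 3 = h := by simp [ha]
    have as : ∀ k q, slot S ma k q = slot S m k q := fun k q => by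
      rw [ha, slot_update (by norm_num)]
    refine Run.cons (Run.tab (S := S) (ov := 64) (nv := h * N)
      (g := fun q => (A (q / N) (q % N)).val) a2 (by decide) (fun _ _ => rfl)
      (fun m' hm' => by simp [hm'.reg, a3, a1]) (by omega)
      (fun q hq m' h63 hw => by
        rw [eval_ld, hw.reg 2 (by norm_num), a2, eval_add, eval_reg, h63, eval_ofNat, Nat.zero_add,
          hw.oth 0 _ (by norm_num) (by omega), as, hlow q hq])
      (fun _ _ _ => (ZMod.val_two_le _).trans (by omega))) (by omega) fun mb T2 hT2 hb => ?_
    have b1 : mb 1 = N := by rw [hb.reg 1 (by norm_num), a1]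
    have b2 : mb 2 = S := by rw [hb.reg 2 (by norm_num), a2]
    have b3 : mb 3 = h := by rw [hb.reg 3 (by norm_num), a3]
    refine Run.cons (Run.send (S := S) (av := h) (nv := h * N) (lv := h * N + h) hfR b2
      (by decide) (fun m' hm' => by simp [hm'.reg, b3]) (fun m' hm' => by simp [hm'.reg, b1, b3])
      (fun m' hm' => by simp [hm'.reg, b1, b3]) (by omega) (by omega) (fun hm => b3 ▸ hm 3)
      (T := TR) (fun mr c0 c1 c2 hc => ih mr A c0 (c1.trans b1) c2 (fun q hq => by
        rw [Nat.zero_add, hc q hq]; exact hb.new q hq))) (by omega)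
      fun mc T3 hT3 ⟨mr, ⟨E₁, p₁, r₁, k₁, hE₁, hp₁⟩, hc⟩ => ?_
    have c1 : mc 1 = N := by rw [hc.reg 1 (by norm_num), b1]
    have c2 : mc 2 = S := by rw [hc.reg 2 (by norm_num), b2]
    have c3 : mc 3 = h := by rw [hc.reg 3 (by norm_num), b3]
    have cs : ∀ q < S, slot S mc 0 q = slot S m 0 q := fun q hq => by
      rw [hc.oth 0 q (by norm_num) (by norm_num) hq, hb.oth 0 q (by norm_num) hq, as]
    have cE : Holds S mc 2 64 h N E₁ := fun q hq => by
      rw [hc.new q (by omega), ← hE₁ q hq, Nat.zero_add]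
    have cp : ∀ i < h, slot S mc 2 (64 + (h * N + i)) = p₁ i := fun i hi => by
      rw [hc.new _ (by omega), hp₁ i hi]
    refine Run.cons (hclear (tk := 0) (pk := 2) (ov := h * N) (E := E₁)
      (B := fun i => A (h + i)) c1 c2 c3 h1 hd' hN hS (by norm_num) (by norm_num) (by decide)
      (fun m' hm' => by simp [hm'.reg, c3, c1]) (by omega)
      (fun q hq => by rw [cs _ (by omega), hhigh q hq]) cE cp) (by omega)
      fun md T4 hT4 ⟨hdr, hds, hdp⟩ => ?_
    have d1 : md 1 = N := by rw [hdr 1 (by norm_num), c1]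
    have d2 : md 2 = S := by rw [hdr 2 (by norm_num), c2]
    have d3 : md 3 = h := by rw [hdr 3 (by norm_num), c3]
    refine Run.cons (Run.tab (S := S) (ov := 64) (nv := h * N)
      (g := fun q => (A (h + q / N) (q % N) +
        clearing h N (fun i => A (h + i)) E₁ p₁ (q / N) (q % N)).val)
      d2 (by decide) (fun _ _ => rfl) (fun m' hm' => by simp [hm'.reg, d3, d1]) (by omega)
      (fun q hq m' h63 hw => by
        simp only [eval_mod, eval_add, eval_ld, eval_mul, eval_reg, eval_ofNat, h63,
          hw.reg 1 (by norm_num), hw.reg 2 (by norm_num), hw.reg 3 (by norm_num), d1, d2, d3]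
        rw [hw.oth 0 _ (by norm_num) (by omega), hw.oth 4 _ (by norm_num) (by omega),
          hds 0 _ (by norm_num) (by norm_num) (by omega), cs _ (by omega), hhigh q hq, hdp q hq,
          ZMod.val_add])
      (fun _ _ _ => (ZMod.val_two_le _).trans (by omega))) (by omega) fun me T5 hT5 he => ?_
    have e1 : me 1 = N := by rw [he.reg 1 (by norm_num), d1]
    have e2 : me 2 = S := by rw [he.reg 2 (by norm_num), d2]
    have e3 : me 3 = h := by rw [he.reg 3 (by norm_num), d3]
    refine Run.cons (Run.send (S := S) (av := h) (nv := h * N) (lv := h * N + h) hfR e2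
      (by decide) (fun m' hm' => by simp [hm'.reg, e3]) (fun m' hm' => by simp [hm'.reg, e1, e3])
      (fun m' hm' => by simp [hm'.reg, e1, e3]) (by omega) (by omega) (fun hm => e3 ▸ hm 3)
      (T := TR) (fun mr' c0 c1 c2 hc => ih mr' (fun i j => A (h + i) j +
          clearing h N (fun i => A (h + i)) E₁ p₁ i j) c0 (c1.trans e1) c2 (fun q hq => by
        rw [Nat.zero_add, hc q hq]; exact he.new q hq))) (by omega)
      fun mf T6 hT6 ⟨mr', ⟨E₂, p₂, r₂, k₂, hE₂, hp₂⟩, hf'⟩ => ?_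
    have f1 : mf 1 = N := by rw [hf'.reg 1 (by norm_num), e1]
    have f2 : mf 2 = S := by rw [hf'.reg 2 (by norm_num), e2]
    have f3 : mf 3 = h := by rw [hf'.reg 3 (by norm_num), e3]
    have fs : ∀ q < S, slot S mf 2 q = slot S mc 2 q := fun q hq => by
      rw [hf'.oth 2 q (by norm_num) (by norm_num) hq, he.oth 2 q (by norm_num) hq,
        hds 2 q (by norm_num) (by norm_num) hq]
    have fE₁ : Holds S mf 2 64 h N E₁ := cE.congr fun q hq => fs _ (by omega)
    have fE₂ : Holds S mf 5 64 h N E₂ := fun q hq => by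
      rw [hf'.new q (by omega), ← hE₂ q hq, Nat.zero_add]
    have fp₂ : ∀ i < h, slot S mf 5 (64 + (h * N + i)) = p₂ i := fun i hi => by
      rw [hf'.new _ (by omega), hp₂ i hi]
    refine Run.cons (hclear (tk := 2) (pk := 5) (ov := 64) (E := E₂)
      (B := E₁) f1 f2 f3 h1 hd' hN hS (by norm_num) (by norm_num) (by decide)
      (fun _ _ => rfl) (by omega) fE₁ fE₂ fp₂) (by omega) fun mg T7 hT7 ⟨hgr, hgs, hgp⟩ => ?_
    have g1 : mg 1 = N := by rw [hgr 1 (by norm_num), f1]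
    have g2 : mg 2 = S := by rw [hgr 2 (by norm_num), f2]
    have g3 : mg 3 = h := by rw [hgr 3 (by norm_num), f3]
    have gs2 : ∀ q < S, slot S mg 2 q = slot S mc 2 q := fun q hq => by
      rw [hgs 2 q (by norm_num) (by norm_num) hq, fs q hq]
    have gs5 : ∀ q < S, slot S mg 5 q = slot S mf 5 q := fun q hq => by
      rw [hgs 5 q (by norm_num) (by norm_num) hq]
    refine Run.imp (Run.le (rref_output g1 g2 g3 hN (by omega) r₁.le r₂.le
      (cE.congr fun q hq => gs2 _ (by omega)) (fE₂.congr fun q hq => gs5 _ (by omega)) hgp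
      (fun i hi => by rw [gs2 _ (by omega), cp i hi])
      (fun i hi => by rw [gs5 _ (by omega), fp₂ i hi])) (by omega)) fun mk hk => ?_
    refine ⟨_, _, r₁.stack_clear r₂ k₂, fun x => ?_, hk⟩
    conv_lhs => rw [← stack_self h A]
    exact inKer_stack_clear k₁ k₂ x

end Run

/-! ### The Gauss–Jordan form as a square matrix -/

/-- `X` is the reduced row echelon form of `A` with its rows arranged such that the pivots are on
the diagonal. -/
structure GaussJordan (N : ℕ) (A X : ℕ → ℕ → ZMod 2) : Prop where
  ker : ∀ x, InKer N N A x ↔ InKer N N X x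
  le : ∀ i < N, ∀ j < N, X i j ≠ 0 → i ≤ j
  unit : ∀ i < N, ∀ j < N, X j j ≠ 0 → X i j = if i = j then 1 else 0
  row : ∀ i < N, X i i = 0 → ∀ j < N, X i j = 0

/-- The first `k` rows of `E`, each moved to the row given by its pivot. -/
def spread (k : ℕ) (E : ℕ → ℕ → ZMod 2) (piv : ℕ → ℕ) (i j : ℕ) : ZMod 2 :=
  ∑ t ∈ Finset.range k, if piv t = i then E t j else 0

namespace Reduced

variable {N : ℕ} {A E : ℕ → ℕ → ZMod 2} {piv : ℕ → ℕ} (h : Reduced N N E piv)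
include h

/-- Two rows with the same pivot would give two ones in a unit vector. Hence rows moved to their
pivots never collide. -/
theorem inj {t s : ℕ} (ht : t < N) (hs : s < N) (hp : piv t < N) (he : piv s = piv t) : s = t := by
  have h1 := h.unit s hs s hs (he ▸ hp)
  rw [he, h.unit s hs t ht hp, if_pos rfl] at h1
  by_contra hne
  rw [if_neg hne] at h1
  exact zero_ne_one h1

theorem spread_piv {t j k : ℕ} (hk : k ≤ N) (ht : t < k) (hp : piv t < N) :
    spread k E piv (piv t) j = E t j := by
  unfold spread
  rw [Finset.sum_eq_single_of_mem t (Finset.mem_range.mpr ht), if_pos rfl]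
  intro s hs hst
  exact if_neg fun he => hst (h.inj (by omega) (by have := Finset.mem_range.mp hs; omega) hp he)

omit h in
theorem spread_eq_zero {i j k : ℕ} (hi : ∀ t < k, piv t ≠ i) : spread k E piv i j = 0 :=
  Finset.sum_eq_zero fun t ht => if_neg (hi t (Finset.mem_range.mp ht))

omit h in
theorem exists_of_spread_ne_zero {i j k : ℕ} (hX : spread k E piv i j ≠ 0) :
    ∃ t < k, piv t = i := by
  by_contra! hcon
  exact hX (spread_eq_zero hcon)

theorem spread_succ {i j k : ℕ} (hk : k < N) (hi : i < N) :
    spread (k + 1) E piv i j = if i = piv k then E k j else spread k E piv i j := by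
  split_ifs with he
  · subst he
    exact h.spread_piv (by omega) (by omega) hi
  · unfold spread
    rw [Finset.sum_range_succ, if_neg (Ne.symm he), add_zero]

/-- Zero rows have the pivot `N`, fall out of the matrix and impose no condition on the kernel. Once
rows are numbered by their pivots, the list of pivots is just the diagonal. -/
theorem gaussJordan (hker : ∀ x, InKer N N A x ↔ InKer N N E x) :
    GaussJordan N A (spread N E piv) := by
  refine ⟨fun x => (hker x).trans ⟨fun hE i hi => ?_, fun hX t ht => ?_⟩, ?_, ?_, ?_⟩
  · by_cases he : ∃ t < N, piv t = i
    · obtain ⟨t, ht, rfl⟩ := he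
      rw [← hE t ht]
      exact Finset.sum_congr rfl fun j _ => by rw [h.spread_piv le_rfl ht hi]
    · push Not at he
      exact Finset.sum_eq_zero fun j _ => by rw [spread_eq_zero he, zero_mul]
  · by_cases hp : piv t < N
    · rw [← hX (piv t) hp]
      exact Finset.sum_congr rfl fun j _ => by rw [h.spread_piv le_rfl ht hp]
    · refine Finset.sum_eq_zero fun j hj => ?_
      have hj := Finset.mem_range.mp hj
      rw [h.zero t ht j hj (by omega), zero_mul]
  · intro i hi j hj hX
    obtain ⟨t, ht, rfl⟩ := exists_of_spread_ne_zero hX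
    rw [h.spread_piv le_rfl ht hi] at hX
    by_contra hlt
    exact hX (h.zero t ht j hj (by omega))
  · intro i hi j hj hX
    obtain ⟨t, ht, rfl⟩ := exists_of_spread_ne_zero hX
    split_ifs with he
    · subst he
      rw [h.spread_piv le_rfl ht hi, h.unit t ht t ht hi, if_pos rfl]
    · by_cases hs : ∃ s < N, piv s = i
      · obtain ⟨s, hs, rfl⟩ := hs
        rw [h.spread_piv le_rfl hs hi, h.unit s hs t ht hj, if_neg]
        rintro rfl
        exact he rfl
      · push Not at hs
        exact spread_eq_zero hs
  · intro i hi hX j hj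
    refine spread_eq_zero fun t ht he => ?_
    subst he
    rw [h.spread_piv le_rfl ht hi, h.unit t ht t ht hi, if_pos rfl] at hX
    exact one_ne_zero hX

end Reduced

/-- Computes the Gauss–Jordan form of an `N × N` matrix, where `fR` is the number of `rref`. -/
def gaussJordan (fR : ℕ) : Cmd := prog [
  tab 1 64 (reg 1 * reg 1) (ld 0 (0 + reg 63)),
  send fR 1 (reg 1) (reg 1 * reg 1) 2 (reg 1 * reg 1 + reg 1),
  tab 0 0 (reg 1 * reg 1) 0,
  forr 10 (reg 1) (tab 0 (ld 2 (64 + (reg 1 * reg 1 + reg 10)) * reg 1) (reg 1)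
    (ld 2 (64 + (reg 10 * reg 1 + reg 63))))]

-- Each row is written at the offset `piv k * N`. For a zero row this is the space just behind the
-- matrix, so no case distinction is needed in the program.
set_option maxHeartbeats 800000 in
theorem Run.gaussJordan {m : ℕ → ℕ} {S N f fB fR J : ℕ} {TM : ℕ → ℕ} (hf : MulProc R f N TM)
    (hfB : R.procs[fB]? = some (_root_.bmul f)) (hfR : R.procs[fR]? = some (_root_.rref fB fR))
    (hN : N = 2 ^ J) (hS : 3 * (N * N) + N + 200 ≤ S) (A : ℕ → ℕ → ZMod 2) (m1 : m 1 = N)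
    (m2 : m 2 = S) (hA : Holds S m 0 0 N N A) :
    Run R (_root_.gaussJordan fR) m (rrefTime TM N J + 10000 * (N * N) + 20000)
      (fun m' => ∃ X, GaussJordan N A X ∧ Holds S m' 0 0 N N X) := by
  have hpos : 0 < N := hN ▸ Nat.two_pow_pos J
  have hX := R.hX
  have hNN : N * 1 ≤ N * N := Nat.mul_le_mul_left _ hpos
  refine Run.cons (Run.tab (S := S) (ov := 64) (nv := N * N)
    (g := fun q => (A (q / N) (q % N)).val) m2 (by decide) (fun _ _ => rfl)
    (fun m' hm' => by simp [hm'.reg, m1]) (by omega)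
    (fun q hq m' h63 hw => by
      rw [eval_ld, hw.reg 2 (by norm_num), m2, eval_add, eval_reg, h63, eval_ofNat,
        hw.oth 0 _ (by norm_num) (by omega), hA q hq])
    (fun _ _ _ => (ZMod.val_two_le _).trans (by omega))) (by omega) fun ma T1 hT1 ha => ?_
  have a1 : ma 1 = N := by rw [ha.reg 1 (by norm_num), m1]
  have a2 : ma 2 = S := by rw [ha.reg 2 (by norm_num), m2]
  refine Run.cons (Run.send (S := S) (av := N) (nv := N * N) (lv := N * N + N) hfR a2
    (by decide) (fun m' hm' => by simp [hm'.reg, a1]) (fun m' hm' => by simp [hm'.reg, a1])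
    (fun m' hm' => by simp [hm'.reg, a1]) (by omega) (by omega) (fun hm => a1 ▸ hm 1)
    (T := rrefTime TM N J) (fun mr c0 c1 c2 hc => Run.rref hf hfB hfR hpos hS J (hN ▸ dvd_rfl) mr A
      (c0.trans hN) (c1.trans a1) c2 (fun q hq => by
      rw [← hN] at hq
      rw [Nat.zero_add, hc q hq]; exact ha.new q hq))) (by omega)
    fun mb T2 hT2 ⟨mr, ⟨E, piv, hr, hk, hE, hp⟩, hb⟩ => ?_
  rw [← hN] at hr hk hE hp
  have b1 : mb 1 = N := by rw [hb.reg 1 (by norm_num), a1]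
  have b2 : mb 2 = S := by rw [hb.reg 2 (by norm_num), a2]
  have bE : Holds S mb 2 64 N N E := fun q hq => by
    rw [hb.new q (by omega), ← hE q hq, Nat.zero_add]
  have bp : ∀ i < N, slot S mb 2 (64 + (N * N + i)) = piv i := fun i hi => by
    rw [hb.new _ (by omega), hp i hi]
  refine Run.cons (Run.tab (S := S) (ov := 0) (nv := N * N)
    (g := fun _ => 0) b2 (by decide) (fun _ _ => rfl)
    (fun m' hm' => by simp [hm'.reg, b1]) (by omega) (fun q hq m' h63 hw => rfl)
    (fun _ _ _ => Nat.zero_le _)) (by omega) fun mc T3 hT3 hc => ?_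
  refine Run.cons (Run.forr (T := 1100 * (N + 1)) (nv := N)
    (I := fun k m' => m' 1 = N ∧ m' 2 = S ∧ (∀ q < S, slot S m' 2 q = slot S mb 2 q) ∧
      Holds S m' 0 0 N N (spread k E piv)) (by norm_num) (by decide) (fun hm => by
        have := hm 1
        rw [hc.reg 1 (by norm_num), b1] at this
        exact this)
    (fun j m' hI => by simp [hI.1]) ?_ ?_) ?_ fun md T4 hT4 hd => ?_
  · refine ⟨by simp [hc.reg, b1], by simp [hc.reg, b2], fun q hq => ?_, fun q hq => ?_⟩
    · rw [slot_update (by norm_num), hc.oth 2 q (by norm_num) hq]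
    · rw [slot_update (by norm_num), hc.new q hq]
      simp [spread]
  · rintro k hkN md hmd ⟨d1, d2, ds, dX⟩ d10
    have hpN := hr.le k hkN
    have hpNN : piv k * N ≤ N * N := Nat.mul_le_mul_right _ hpN
    have hkNN : k * N + N ≤ N * N := by rw [← Nat.succ_mul]; exact Nat.mul_le_mul_right _ hkN
    refine Run.imp (Run.tab (S := S) (ov := piv k * N) (nv := N) (g := fun j => (E k j).val) d2
      (by decide) (fun m' hm' => ?_) (fun m' hm' => by simp [hm'.reg, d1]) (by omega)
      (fun q hq m' h63 hw => ?_) (fun _ _ _ => (ZMod.val_two_le _).trans (by omega)))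
      fun me he => ?_
    · simp only [eval_ld, eval_mul, eval_add, eval_reg, eval_ofNat, hm'.reg 1 (by norm_num),
        hm'.reg 2 (by norm_num), hm'.reg 10 (by norm_num), d1, d2, d10]
      rw [hm'.oth 2 _ (by norm_num) (by omega), ds _ (by omega), bp k hkN]
    · simp only [eval_ld, eval_mul, eval_add, eval_reg, eval_ofNat, hw.reg 1 (by norm_num),
        hw.reg 2 (by norm_num), hw.reg 10 (by norm_num), d1, d2, d10, h63]
      rw [hw.oth 2 _ (by norm_num) (by omega), ds _ (by omega)]
      exact bE.get hkN hq
    · refine ⟨by rw [he.reg 10 (by norm_num), d10], ?_, ?_, fun q hq => ?_, fun q hq => ?_⟩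
      · rw [Function.update_of_ne (by norm_num), he.reg 1 (by norm_num), d1]
      · rw [Function.update_of_ne (by norm_num), he.reg 2 (by norm_num), d2]
      · rw [slot_update (by norm_num), he.oth 2 _ (by norm_num) hq, ds q hq]
      · rw [slot_update (by norm_num), Nat.zero_add, hr.spread_succ hkN (div_lt_of_lt_mul hq)]
        have hq' := div_mul_add_mod q N
        have hqm := mod_lt_of_lt_mul hq
        split_ifs with hqk
        · rw [← he.new _ hqm, ← hqk, hq']
        · rw [he.old q (by omega), ← dX q hq, Nat.zero_add]
          rcases Nat.lt_or_gt_of_ne hqk with hlt | hlt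
          · left
            have : (q / N + 1) * N ≤ piv k * N := Nat.mul_le_mul_right _ hlt
            rw [Nat.add_mul] at this
            omega
          · right
            have : (piv k + 1) * N ≤ q / N * N := Nat.mul_le_mul_right _ hlt
            rw [Nat.add_mul] at this
            omega
  · have : N * (1100 * (N + 1) + 1000) = 1100 * (N * N) + 2100 * N := by ring
    omega
  · have : N * (1100 * (N + 1) + 1000) = 1100 * (N * N) + 2100 * N := by ring
    exact Run.nil (by omega) ⟨_, hr.gaussJordan hk, hd.2.2.2⟩

/-! ### Incidence matrices -/

/-- The number of pairs of equal words among the first `k` words of one list and the first `k + 1`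
words of another one. -/
def agreements (k : ℕ) (u v : ℕ → ℕ) : ℕ :=
  ∑ z ∈ Finset.range (k * (k + 1)), if u (z / (k + 1)) = v (z % (k + 1)) then 1 else 0

/-- The slot `0` holds a list of `n` simplices, where the list of the `i`-th simplex begins at the
entry `off i`. -/
structure Stored (S n : ℕ) (m off card : ℕ → ℕ) (vert : ℕ → ℕ → ℕ) : Prop where
  size : slot S m 0 1 = n
  off_zero : off 0 = 2
  off_succ : ∀ i, off (i + 1) = off i + 1 + card i
  off_le : ∀ i < n, off i + 1 + card i ≤ S
  card_eq : ∀ i < n, slot S m 0 (off i) = card i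
  vert_eq : ∀ i < n, ∀ x < card i, slot S m 0 (off i + 1 + x) = vert i x

theorem Stored.congr {S n : ℕ} {m m' off card : ℕ → ℕ} {vert : ℕ → ℕ → ℕ}
    (h : Stored S n m off card vert) (hS : 1 < S) (he : ∀ j < S, slot S m' 0 j = slot S m 0 j) :
    Stored S n m' off card vert where
  size := by rw [he 1 hS, h.size]
  off_zero := h.off_zero
  off_succ := h.off_succ
  off_le := h.off_le
  card_eq i hi := by rw [he _ (by have := h.off_le i hi; omega), h.card_eq i hi]
  vert_eq i hi x hx := by rw [he _ (by have := h.off_le i hi; omega), h.vert_eq i hi x hx]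

/-- The numbers less than `n` of the simplices with `k` vertices. -/
def ofCard (n : ℕ) (card : ℕ → ℕ) (k : ℕ) : List ℕ := (List.range n).filter fun i => card i = k

theorem mem_ofCard {n k i : ℕ} {card : ℕ → ℕ} : i ∈ ofCard n card k ↔ i < n ∧ card i = k := by
  simp [ofCard]

theorem length_ofCard_le (n k : ℕ) (card : ℕ → ℕ) : (ofCard n card k).length ≤ n :=
  (List.length_filter_le _ _).trans (by simp)

/-- The incidence matrix of the simplices with `k` and with `k + 1` vertices. -/
def incidence (n : ℕ) (card : ℕ → ℕ) (vert : ℕ → ℕ → ℕ) (k i j : ℕ) : ZMod 2 :=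
  if i < (ofCard n card k).length ∧ j < (ofCard n card (k + 1)).length ∧
    agreements k (vert ((ofCard n card k).getD i 0)) (vert ((ofCard n card (k + 1)).getD j 0)) = k
  then 1 else 0

/-- Writes the addresses of the simplices to the slot `1`. -/
def locate : Cmd := prog [
  .store (lit 5) (ld 0 1),
  .store (lit 6) 2,
  forr 10 (reg 5) (prog [tab 1 (reg 10) 1 (reg 6), .store (lit 6) (reg 6 + (ld 0 (reg 6) + 1))])]

/-- Counts the vertices that the `reg 10 / reg 8`-th of the simplices in the slot `2` and the
`reg 10 % reg 8`-th of the simplices in the slot `3` have in common. -/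
def compare : Cmd := prog [
  .store (lit 11) 0,
  forr 12 (reg 0 * (reg 0 + 1)) (.store (lit 11) (reg 11 +
    eq (ld 0 (ld 2 (reg 10 / reg 8) + 1 + reg 12 / (reg 0 + 1)))
      (ld 0 (ld 3 (reg 10 % reg 8) + 1 + reg 12 % (reg 0 + 1)))))]

/-- Computes the incidence matrix of the simplices with `k = reg 0` and with `k + 1` vertices. Their
numbers are returned in the registers `7` and `8`. -/
def incidenceCmd : Cmd := prog [
  locate,
  filt 10 2 7 (reg 5) (ld 1 (reg 10)) (eq (ld 0 (ld 1 (reg 10))) (reg 0)),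
  filt 10 3 8 (reg 5) (ld 1 (reg 10)) (eq (ld 0 (ld 1 (reg 10))) (reg 0 + 1)),
  tab 4 0 (reg 1 * reg 1) 0,
  forr 10 (reg 7 * reg 8) (prog [
    compare,
    tab 4 (reg 10 / reg 8 * reg 1 + reg 10 % reg 8) 1 (eq (reg 11) (reg 0))]),
  tab 0 0 (reg 1 * reg 1) (ld 4 (0 + reg 63))]

namespace Run

variable {m off card : ℕ → ℕ} {vert : ℕ → ℕ → ℕ} {S N n k : ℕ}

theorem locate (h : Stored S n m off card vert) (m2 : m 2 = S) (hn : n < S) :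
    Run R locate m (5000 * n + 5000) (fun m' => m' 0 = m 0 ∧ m' 1 = m 1 ∧ m' 2 = S ∧ m' 5 = n ∧
      (∀ j < S, slot S m' 0 j = slot S m 0 j) ∧ ∀ i < n, slot S m' 1 i = off i) := by
  refine bounded fun hm => ?_
  have hX := R.hX
  have hSX : S ≤ R.X := m2 ▸ hm 2
  refine Run.cons (Run.set (v := n) (by norm_num) (by decide) (by simp [m2, h.size])
    (fun _ => by omega)) (by omega) fun ma T1 hT1 ha => ?_
  refine Run.cons (Run.set (v := 2) (by norm_num) (by decide) (by simp)
    (fun _ => by omega)) (by omega) fun mb T2 hT2 hb => ?_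
  refine Run.cons (Run.forr (T := 3000) (nv := n)
    (I := fun j m' => m' 0 = m 0 ∧ m' 1 = m 1 ∧ m' 2 = S ∧ m' 5 = n ∧ m' 6 = off j ∧
      (∀ j < S, slot S m' 0 j = slot S m 0 j) ∧ ∀ i < j, slot S m' 1 i = off i)
    (by norm_num) (by decide) (fun hm => by omega)
    (fun j m' hI => by simp [hI.2.2.2.1]) ?_ ?_) (by omega)
    fun mc T3 hT3 hc => Run.nil (by omega) ⟨hc.1, hc.2.1, hc.2.2.1, hc.2.2.2.1, hc.2.2.2.2.2⟩
  · subst hb ha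
    refine ⟨by simp, by simp, by simp [m2], by simp, by simp [h.off_zero], fun j hj => ?_,
      fun i hi => by omega⟩
    rw [slot_update (by norm_num), slot_update (by norm_num), slot_update (by norm_num)]
  · rintro j hj md hmd ⟨d0, d1, d2, d5, d6, ds, di⟩ d10
    have hle := h.off_le j hj
    refine Run.cons (Run.tab (S := S) (ov := j) (nv := 1) (g := fun _ => off j) d2 (by decide)
      (fun m' hm' => by simp [hm'.reg, d10]) (fun _ _ => rfl) (by omega)
      (fun i hi m' h63 hw => by simp [hw.reg, d6]) (fun _ _ _ => by omega)) (by omega)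
      fun me T3 hT3 he => ?_
    refine Run.cons (Run.set (v := off (j + 1)) (by norm_num) (by decide) ?_
      (fun _ => by rw [h.off_succ]; omega)) (by omega) fun mf T4 hT4 hf => Run.nil (by omega) ?_
    · simp only [eval_add, eval_reg, eval_ld, eval_ofNat, he.reg 6 (by norm_num),
        he.reg 2 (by norm_num), d6, d2]
      rw [he.oth 0 _ (by norm_num) (by omega), ds _ (by omega), h.card_eq j hj, h.off_succ]
      omega
    · subst hf
      refine ⟨by simp [he.reg, d10], by simp [he.reg, d0], by simp [he.reg, d1],
        by simp [he.reg, d2], by simp [he.reg, d5], by simp, fun q hq => ?_, fun i hi => ?_⟩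
      · rw [slot_update (by norm_num), slot_update (by norm_num), he.oth 0 q (by norm_num) hq,
          ds q hq]
      · rw [slot_update (by norm_num), slot_update (by norm_num)]
        rcases Nat.lt_succ_iff_lt_or_eq.mp hi with hi | rfl
        · rw [he.old i (by omega) (by omega), di i hi]
        · exact he.new 0 (by norm_num)

/-- All `k * (k + 1)` pairs of vertices are compared. This quadratic cost is affordable because `k`
is logarithmic in the number of simplices whenever the comparison takes place. -/
theorem compare {b i j : ℕ} (h : Stored S n m off card vert) (m0 : m 0 = k) (m2 : m 2 = S)
    (m8 : m 8 = b) (m10 : m 10 = i * b + j) (hj : j < b)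
    (hkS : k * (k + 1) ≤ S) {s t : ℕ} (hs : s < n) (ht : t < n) (cs : card s = k)
    (ct : card t = k + 1) (h2 : slot S m 2 i = off s) (h3 : slot S m 3 j = off t) :
    Run R compare m (1401 * (k * (k + 1)) + 3000) (fun m' =>
      (∀ r, r ≠ 11 → r ≠ 12 → r < 64 → m' r = m r) ∧ (∀ k j, slot S m' k j = slot S m k j) ∧
      m' 11 = agreements k (vert s) (vert t)) := by
  refine bounded fun hm => ?_
  have hX := R.hX
  have hSX : S ≤ R.X := m2 ▸ hm 2
  refine Run.cons (Run.set (v := 0) (by norm_num) (by decide) (by simp)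
    (fun _ => by omega)) (by omega) fun ma T1 hT1 ha => ?_
  refine Run.cons (Run.forr (T := 401) (nv := k * (k + 1))
    (I := fun z m' => (∀ r, r ≠ 11 → r ≠ 12 → r < 64 → m' r = m r) ∧
      (∀ k j, slot S m' k j = slot S m k j) ∧ m' 11 = ∑ z ∈ Finset.range z,
        if vert s (z / (k + 1)) = vert t (z % (k + 1)) then 1 else 0)
    (by norm_num) (by decide) (fun hm => by omega)
    (fun j m' hI => by simp [hI.1, m0]) ?_ ?_) (by omega)
    fun mc T3 hT3 hc => Run.nil (by omega) hc
  · subst ha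
    refine ⟨fun r h1 h2 hr => ?_, fun k j => ?_, ?_⟩
    · rw [Function.update_of_ne h2, Function.update_of_ne h1]
    · rw [slot_update (by norm_num), slot_update (by norm_num)]
    · simp
  · rintro z hz mb hmb ⟨hr, hsl, h11⟩ h12
    have hz1 := div_lt_of_lt_mul hz
    have hz2 := mod_lt_of_lt_mul hz
    refine Run.imp (Run.set (v := ∑ z ∈ Finset.range (z + 1),
        if vert s (z / (k + 1)) = vert t (z % (k + 1)) then 1 else 0) (by norm_num) (by decide) ?_
        (fun _ => ?_)) fun mc hc => ?_
    · simp only [eval_add, eval_reg, eval_ld, eval_ofNat, eval_eq, eval_div, eval_mod, h11, h12,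
        hr 2 (by norm_num) (by norm_num) (by norm_num), hr 8 (by norm_num) (by norm_num)
        (by norm_num), hr 10 (by norm_num) (by norm_num) (by norm_num),
        hr 0 (by norm_num) (by norm_num) (by norm_num), m0, m2, m8, m10, hsl, mul_add_div' hj,
        mul_add_mod' hj, h2, h3]
      rw [h.vert_eq s hs _ (by omega), h.vert_eq t ht _ (by omega), Finset.sum_range_succ]
    · calc _ ≤ ∑ z ∈ Finset.range (z + 1), 1 := Finset.sum_le_sum fun z _ => by split_ifs <;> simp
        _ ≤ R.X := by simp; omega
    · subst hc
      refine ⟨by simp [h12], fun r h1 h2 hr' => ?_, fun k j => ?_, by simp⟩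
      · rw [Function.update_of_ne h2, Function.update_of_ne h1, hr r h1 h2 hr']
      · rw [slot_update (by norm_num), slot_update (by norm_num), hsl]

set_option maxHeartbeats 800000 in
theorem incidenceCmd (h : Stored S n m off card vert) (m0 : m 0 = k) (m1 : m 1 = N) (m2 : m 2 = S)
    (hn : n ≤ N) (hcard : ∀ i < n, card i ≤ N) (hS : 3 * (N * N) + N + 200 ≤ S) :
    Run R _root_.incidenceCmd m (20000 * n + (ofCard n card k).length * (ofCard n card (k + 1)).length *
      (1401 * (k * (k + 1)) + 9000) + 3000 * (N * N) + 50000) (fun m' =>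
      m' 7 = (ofCard n card k).length ∧ m' 8 = (ofCard n card (k + 1)).length ∧
      Holds S m' 0 0 N N (incidence n card vert k)) := by
  refine bounded fun hm => ?_
  have hX := R.hX
  have hSX : S ≤ R.X := m2 ▸ hm 2
  refine Run.cons (Run.locate h m2 (by omega)) (by omega)
    fun ma T1 hT1 ⟨a0, a1, a2, a5, as, ai⟩ => ?_
  rw [m0] at a0
  rw [m1] at a1
  have ha := h.congr (by omega) as
  refine Run.cons (Run.filt (S := S) (nv := n) (g := off) (P := fun i => card i = k) (by norm_num)
    (by norm_num) (by norm_num) (by norm_num) (by norm_num) a2 (by decide) (by omega)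
    (fun m' hm' => by simp [hm'.reg, a5]) (fun j hj m' h10 hm' => ?_) (fun j hj m' h10 hm' => ?_)
    (fun _ j hj => by have := h.off_le j hj; omega)) (by omega) fun mb T2 hT2 hb => ?_
  · rw [eval_ld, eval_reg, h10, hm'.reg 2 (by norm_num) (by norm_num) (by norm_num), a2,
      hm'.oth 1 _ (by norm_num) (by omega), ai j hj]
  · have := h.off_le j hj
    rw [eval_eq, eval_ld, eval_ld, eval_reg, eval_reg, h10,
      hm'.reg 2 (by norm_num) (by norm_num) (by norm_num),
      hm'.reg 0 (by norm_num) (by norm_num) (by norm_num), a2, a0,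
      hm'.oth 1 _ (by norm_num) (by omega), ai j hj, hm'.oth 0 _ (by norm_num) (by omega),
      ha.card_eq j hj]
  have b0 : mb 0 = k := by rw [hb.reg 0 (by norm_num) (by norm_num) (by norm_num), a0]
  have b1 : mb 1 = N := by rw [hb.reg 1 (by norm_num) (by norm_num) (by norm_num), a1]
  have b2 : mb 2 = S := by rw [hb.reg 2 (by norm_num) (by norm_num) (by norm_num), a2]
  have b5 : mb 5 = n := by rw [hb.reg 5 (by norm_num) (by norm_num) (by norm_num), a5]
  refine Run.cons (Run.filt (S := S) (nv := n) (g := off) (P := fun i => card i = k + 1)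
    (by norm_num) (by norm_num) (by norm_num) (by norm_num) (by norm_num) b2 (by decide) (by omega)
    (fun m' hm' => by simp [hm'.reg, b5]) (fun j hj m' h10 hm' => ?_) (fun j hj m' h10 hm' => ?_)
    (fun _ j hj => by have := h.off_le j hj; omega)) (by omega) fun mc T3 hT3 hc => ?_
  · rw [eval_ld, eval_reg, h10, hm'.reg 2 (by norm_num) (by norm_num) (by norm_num), b2,
      hm'.oth 1 _ (by norm_num) (by omega), hb.oth 1 _ (by norm_num) (by omega), ai j hj]
  · have := h.off_le j hj
    rw [eval_eq, eval_ld, eval_ld, eval_add, eval_reg, eval_reg, h10,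
      hm'.reg 2 (by norm_num) (by norm_num) (by norm_num),
      hm'.reg 0 (by norm_num) (by norm_num) (by norm_num), b2, b0,
      hm'.oth 1 _ (by norm_num) (by omega), hb.oth 1 _ (by norm_num) (by omega), ai j hj,
      hm'.oth 0 _ (by norm_num) (by omega), hb.oth 0 _ (by norm_num) (by omega),
      ha.card_eq j hj, eval_ofNat]
  have hc7 : mc 7 = (ofCard n card k).length := by
    rw [hc.reg 7 (by norm_num) (by norm_num) (by norm_num), hb.count, List.length_map, ofCard]
  have hc8 : mc 8 = (ofCard n card (k + 1)).length := by rw [hc.count, List.length_map, ofCard]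
  have c2' : ∀ i, i < (ofCard n card k).length →
      slot S mc 2 i = off ((ofCard n card k).getD i 0) := fun i hi => by
    have := length_ofCard_le n k card
    rw [hc.oth 2 i (by norm_num) (by omega), hb.new i (by rwa [List.length_map]), List.getElem_map,
      List.getD_eq_getElem _ _ hi]
    rfl
  have c3' : ∀ i, i < (ofCard n card (k + 1)).length →
      slot S mc 3 i = off ((ofCard n card (k + 1)).getD i 0) := fun i hi => by
    rw [hc.new i (by rwa [List.length_map]), List.getElem_map, List.getD_eq_getElem _ _ hi]
    rfl
  have hmem : ∀ k i, i < (ofCard n card k).length →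
      (ofCard n card k).getD i 0 < n ∧ card ((ofCard n card k).getD i 0) = k := fun k i hi => by
    rw [List.getD_eq_getElem _ _ hi]
    exact mem_ofCard.mp (List.getElem_mem hi)
  have hmem₁ := hmem k
  have hmem₂ := hmem (k + 1)
  clear hmem
  have ha' := length_ofCard_le n k card
  have hb' := length_ofCard_le n (k + 1) card
  have e : ∀ i j, incidence n card vert k i j = if i < (ofCard n card k).length ∧
    j < (ofCard n card (k + 1)).length ∧ agreements k (vert ((ofCard n card k).getD i 0))
      (vert ((ofCard n card (k + 1)).getD j 0)) = k then 1 else 0 := fun _ _ => rfl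
  generalize (ofCard n card k).length = a at *
  generalize (ofCard n card (k + 1)).length = b at *
  have c0 : mc 0 = k := by rw [hc.reg 0 (by norm_num) (by norm_num) (by norm_num), b0]
  have c1 : mc 1 = N := by rw [hc.reg 1 (by norm_num) (by norm_num) (by norm_num), b1]
  have c2 : mc 2 = S := by rw [hc.reg 2 (by norm_num) (by norm_num) (by norm_num), b2]
  have cs : ∀ j < S, slot S mc 0 j = slot S ma 0 j := fun j hj => by
    rw [hc.oth 0 j (by norm_num) hj, hb.oth 0 j (by norm_num) hj]
  have hcS := ha.congr (by omega) cs
  refine Run.cons (Run.tab (S := S) (ov := 0) (nv := N * N)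
    (g := fun _ => 0) c2 (by decide) (fun _ _ => rfl)
    (fun m' hm' => by simp [hm'.reg, c1]) (by omega) (fun q hq m' h63 hw => rfl)
    (fun _ _ _ => Nat.zero_le _)) (by omega) fun md T4 hT4 hd => ?_
  have hab : a * b ≤ N * N := Nat.mul_le_mul (by omega) (by omega)
  refine Run.cons (Run.forr (T := 1401 * (k * (k + 1)) + 8000) (nv := a * b)
    (I := fun q m' => m' 0 = k ∧ m' 1 = N ∧ m' 2 = S ∧ m' 7 = a ∧ m' 8 = b ∧
      (∀ j < S, slot S m' 0 j = slot S mc 0 j) ∧ (∀ j < S, slot S m' 2 j = slot S mc 2 j) ∧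
      (∀ j < S, slot S m' 3 j = slot S mc 3 j) ∧ ∀ i < N, ∀ j < N, slot S m' 4 (i * N + j) =
        if i < a ∧ j < b ∧ i * b + j < q ∧ agreements k (vert ((ofCard n card k).getD i 0))
          (vert ((ofCard n card (k + 1)).getD j 0)) = k then 1 else 0)
    (by norm_num) (by decide) (fun hm => by omega)
    (fun j m' hI => by simp [hI.2.2.2.1, hI.2.2.2.2.1]) ?_ ?_) ?_ fun me T5 hT5 he => ?_
  · refine ⟨by simp [hd.reg, c0], by simp [hd.reg, c1], by simp [hd.reg, c2],
      by simp [hd.reg, hc7], by simp [hd.reg, hc8], fun j hj => ?_, fun j hj => ?_,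
      fun j hj => ?_, fun i hi j hj => ?_⟩
    · rw [slot_update (by norm_num), hd.oth 0 j (by norm_num) hj]
    · rw [slot_update (by norm_num), hd.oth 2 j (by norm_num) hj]
    · rw [slot_update (by norm_num), hd.oth 3 j (by norm_num) hj]
    · rw [slot_update (by norm_num), if_neg (by omega)]
      have := hd.new _ (add_mul_lt hi hj)
      rwa [Nat.zero_add] at this
  · rintro q hq mf hmf ⟨f0, f1, f2, f7, f8, fs0, fs2, fs3, fs4⟩ f10
    have hq1 := div_lt_of_lt_mul hq
    have hq2 := mod_lt_of_lt_mul hq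
    obtain ⟨hs, hs'⟩ := hmem₁ _ hq1
    obtain ⟨ht, ht'⟩ := hmem₂ _ hq2
    -- Only here, with an actual simplex of `k + 1` vertices at hand, is `k` bounded. The given `p`
    -- may be far larger than `n`; then there are no pairs and the loop body never runs.
    have hkN : k + 1 ≤ N := ht' ▸ hcard _ ht
    have hkk : k * (k + 1) ≤ N * N := Nat.mul_le_mul (by omega) hkN
    have hlt := add_mul_lt (show q / b < N by omega) (show q % b < N by omega)
    refine Run.cons (Run.compare (b := b) (i := q / b) (j := q % b) (hcS.congr (by omega) fs0)
      f0 f2 f8 (by rw [f10, div_mul_add_mod]) hq2 (by omega) hs ht hs' ht'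
      (by rw [fs2 _ (by omega), c2' _ hq1]) (by rw [fs3 _ (by omega), c3' _ hq2])) (by omega)
      fun mg T6 hT6 ⟨gr, gs, g11⟩ => ?_
    have g0 : mg 0 = k := by rw [gr 0 (by norm_num) (by norm_num) (by norm_num), f0]
    have g1 : mg 1 = N := by rw [gr 1 (by norm_num) (by norm_num) (by norm_num), f1]
    have g2 : mg 2 = S := by rw [gr 2 (by norm_num) (by norm_num) (by norm_num), f2]
    have g7 : mg 7 = a := by rw [gr 7 (by norm_num) (by norm_num) (by norm_num), f7]
    have g8 : mg 8 = b := by rw [gr 8 (by norm_num) (by norm_num) (by norm_num), f8]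
    have g10 : mg 10 = q := by rw [gr 10 (by norm_num) (by norm_num) (by norm_num), f10]
    refine Run.cons (Run.tab (S := S) (ov := q / b * N + q % b) (nv := 1)
      (g := fun _ => if agreements k (vert ((ofCard n card k).getD (q / b) 0))
          (vert ((ofCard n card (k + 1)).getD (q % b) 0)) = k then 1 else 0) g2
      (by decide) (fun m' hm' => by simp [hm'.reg, g10, g8, g1]) (fun _ _ => rfl) (by omega)
      (fun i hi m' h63 hw => by simp [hw.reg, g11, g0])
      (fun _ _ _ => by split_ifs <;> omega)) (by omega)
      fun mh T7 hT7 hh => Run.nil (by omega) ?_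
    refine ⟨by simp [hh.reg, g10], by simp [hh.reg, g0], by simp [hh.reg, g1],
      by simp [hh.reg, g2], by simp [hh.reg, g7], by simp [hh.reg, g8], fun j hj => ?_,
      fun j hj => ?_, fun j hj => ?_, fun i hi j hj => ?_⟩
    · rw [slot_update (by norm_num), hh.oth 0 j (by norm_num) hj, gs, fs0 j hj]
    · rw [slot_update (by norm_num), hh.oth 2 j (by norm_num) hj, gs, fs2 j hj]
    · rw [slot_update (by norm_num), hh.oth 3 j (by norm_num) hj, gs, fs3 j hj]
    · rw [slot_update (by norm_num)]
      have hij := add_mul_lt hi hj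
      by_cases heq : i * N + j = q / b * N + q % b
      · have hi' : i = q / b := by
          have := congrArg (· / N) heq
          simpa only [mul_add_div' hj, mul_add_div' (show q % b < N by omega)] using this
        have hj' : j = q % b := by
          have := congrArg (· % N) heq
          simpa only [mul_add_mod' hj, mul_add_mod' (show q % b < N by omega)] using this
        have := hh.new 0 (by norm_num)
        rw [heq, ← Nat.add_zero (q / b * N + q % b), this, hi', hj', div_mul_add_mod]
        simp [hq1, hq2]
      · rw [hh.old _ (by omega) (by omega), gs, fs4 i hi j hj]
        refine if_congr (and_congr_right fun hia => and_congr_right fun hjb =>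
          and_congr_left fun _ => ⟨fun h => by omega, fun h => ?_⟩) rfl rfl
        rcases Nat.lt_succ_iff_lt_or_eq.mp h with h | rfl
        · exact h
        · exact absurd (by rw [mul_add_div' hjb, mul_add_mod' hjb]) heq
  · have : a * b * (1401 * (k * (k + 1)) + 8000 + 1000) =
      a * b * (1401 * (k * (k + 1)) + 9000) := by ring
    omega
  · obtain ⟨e0, e1, e2, e7, e8, -, -, -, e4⟩ := he
    have hfin : a * b * (1401 * (k * (k + 1)) + 8000 + 1000) =
      a * b * (1401 * (k * (k + 1)) + 9000) := by ring
    refine Run.cons (Run.tab (S := S) (ov := 0) (nv := N * N)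
      (g := fun q => (_root_.incidence n card vert k (q / N) (q % N)).val) e2 (by decide)
      (fun _ _ => rfl) (fun m' hm' => by simp [hm'.reg, e1]) (by omega)
      (fun q hq m' h63 hw => ?_) (fun _ _ _ => (ZMod.val_two_le _).trans (by omega))) (by omega)
      fun mf T6 hT6 hf => Run.nil (by omega)
        ⟨by rw [hf.reg 7 (by norm_num), e7], by rw [hf.reg 8 (by norm_num), e8], hf.new⟩
    have := e4 _ (div_lt_of_lt_mul hq) _ (mod_lt_of_lt_mul hq)
    rw [div_mul_add_mod] at this
    simp only [eval_add, eval_ld, eval_reg, eval_ofNat, h63, hw.reg 2 (by norm_num), e2]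
    rw [hw.oth 4 _ (by norm_num) (by omega), Nat.zero_add, this, e]
    have hlt : q / N < a → q % N < b → q / N * b + q % N < a * b := fun h h' => add_mul_lt h h'
    split_ifs with h1 h2 h2
    · exact (ZMod.val_one 2).symm
    · exact absurd ⟨h1.1, h1.2.1, h1.2.2.2⟩ h2
    · exact absurd ⟨h2.1, h2.2.1, hlt h2.1 h2.2.1, h2.2.2⟩ h1
    · exact ZMod.val_zero.symm

end Run

/-! ### The matrices of the algorithm -/

theorem Stored.of_lt {S n B : ℕ} {m m' off card : ℕ → ℕ} {vert : ℕ → ℕ → ℕ}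
    (h : Stored S n m off card vert) (hB : 1 < B) (hoff : ∀ i < n, off i + 1 + card i ≤ B)
    (he : ∀ j < B, slot S m' 0 j = slot S m 0 j) : Stored S n m' off card vert where
  size := by rw [he 1 hB, h.size]
  off_zero := h.off_zero
  off_succ := h.off_succ
  off_le := h.off_le
  card_eq i hi := by rw [he _ (by have := hoff i hi; omega), h.card_eq i hi]
  vert_eq i hi x hx := by rw [he _ (by have := hoff i hi; omega), h.vert_eq i hi x hx]

/-- Makes the matrix `[∂_{p+1} | 1 - Y]` fit into the same `N × N` format as the first one. -/
theorem length_ofCard_add_le (n : ℕ) (card : ℕ → ℕ) (k : ℕ) :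
    (ofCard n card k).length + (ofCard n card (k + 1)).length ≤ n := by
  have h1 := List.length_eq_length_filter_add (l := List.range n) (fun i => decide (card i = k))
  rw [List.length_range] at h1
  have h2 : (ofCard n card (k + 1)).length ≤
      ((List.range n).filter fun i => !decide (card i = k)).length := by
    refine List.Sublist.length_le (List.monotone_filter_right _ fun i hi => ?_)
    simp only [decide_eq_true_eq] at hi
    simp [hi]
  unfold ofCard at *
  omega

/-- The matrix with the columns of `D` followed, from the column `c₂` on, by the first `c₁` columns
of `X + 1`. -/
def extend (c₁ c₂ : ℕ) (D X : ℕ → ℕ → ZMod 2) (i j : ℕ) : ZMod 2 :=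
  D i j + if c₂ ≤ j ∧ j - c₂ < c₁ then X i (j - c₂) + if i = j - c₂ then 1 else 0 else 0

/-- Computes the slot size and the size `N` of the matrices, a power of `2`. -/
def setup (fC : ℕ) : Cmd := prog [
  .call fC 0 (reg 1 * reg 1 + reg 1 + 2) 64 (reg 1 * reg 1 + reg 1 + 2),
  .store (lit 2) (16 * ((reg 1 + 8) * (reg 1 + 8))),
  .store (lit 3) (reg 1),
  .store (lit 1) 1,
  .loop (reg 3 - reg 1) (.store (lit 1) (2 * reg 1))]

/-- Computes the incidence matrices of the faces with `p` and `p + 1` vertices, and of those with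
`p + 1` and `p + 2` vertices. -/
def incidences (fI : ℕ) : Cmd := prog [
  tab 1 64 (reg 3 * reg 3 + reg 3 + 2) (ld 0 (reg 63)),
  send fI 1 (reg 0) (reg 3 * reg 3 + reg 3 + 2) 2 (reg 1 * reg 1),
  send fI 1 (reg 0 + 1) (reg 3 * reg 3 + reg 3 + 2) 3 (reg 1 * reg 1),
  .store (lit 4) (ld 2 8),
  .store (lit 5) (ld 3 8)]

/-- Computes the Gauss–Jordan forms. -/
def eliminations (fG : ℕ) : Cmd := prog [
  tab 4 64 (reg 1 * reg 1) (ld 2 (64 + reg 63)),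
  send fG 4 0 (reg 1 * reg 1) 5 (reg 1 * reg 1),
  tab 6 64 (reg 1 * reg 1) ((ld 3 (64 + reg 63) +
    (1 - lt (reg 63 % reg 1) (reg 5)) * lt (reg 63 % reg 1 - reg 5) (reg 4) *
      (ld 5 (64 + (reg 63 / reg 1 * reg 1 + (reg 63 % reg 1 - reg 5))) +
        eq (reg 63 / reg 1) (reg 63 % reg 1 - reg 5))) % 2),
  send fG 6 0 (reg 1 * reg 1) 7 (reg 1 * reg 1)]

/-- A time bound for `incidenceCmd`. -/
def incidenceTime (n : ℕ) (card : ℕ → ℕ) (N k : ℕ) : ℕ :=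
  20000 * n + (ofCard n card k).length * (ofCard n card (k + 1)).length *
      (1401 * (k * (k + 1)) + 9000) + 3000 * (N * N) + 50000

/-- A time bound for `gaussJordan`. -/
def gaussJordanTime (TM : ℕ → ℕ) (J : ℕ) : ℕ :=
  rrefTime TM (2 ^ J) J + 10000 * (2 ^ J * 2 ^ J) + 20000

namespace Run

variable {m off card : ℕ → ℕ} {vert : ℕ → ℕ → ℕ} {S N n p f fB fR fC fI fG J : ℕ} {TM : ℕ → ℕ}

/-- Calling a procedure that does nothing is a block copy. It shifts the input by 64 words to make
room for registers; source and target may overlap, since the copy passes through a separate memory.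
The first 64 words stay in place, so `p` and `n` are found in the registers 0 and 1. -/
theorem setup (hC : R.procs[fC]? = some .skip) (m1 : m 1 = n) (hn : 1 ≤ n)
    (hX : 16 * ((n + 8) * (n + 8)) ≤ R.X) :
    Run R (setup fC) m (2 * (n * n) + 1000 * n + 10000) (fun m' => m' 0 = m 0 ∧
      m' 1 = 2 ^ Nat.clog 2 n ∧ m' 2 = 16 * ((n + 8) * (n + 8)) ∧ m' 3 = n ∧
      ∀ j < n * n + n + 2, slot (16 * ((n + 8) * (n + 8))) m' 0 j = m j) := by
  have hXX := R.hX
  have hnn : (n + 8) * (n + 8) = n * n + 16 * n + 64 := by ring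
  refine Run.cons (Run.call_run (T := 1) (Q' := fun m' => m' = _) hC (by decide) (by decide)
    (by decide) (by decide) fun hm => ⟨_, _, .skip _, le_rfl, hm, rfl⟩)
    (by simp [m1]; omega) fun ma T1 hT1 ha => ?_
  obtain ⟨mc, rfl, ha⟩ := ha
  simp only [eval_add, eval_mul, eval_reg, eval_ofNat, m1] at ha hT1
  have hlow : ∀ r < 64, ma r = m r := fun r hr => by rw [ha]; exact if_neg (by omega)
  have hdata : ∀ j < n * n + n + 2, ma (64 + j) = m j := fun j hj => by
    rw [ha]
    beta_reduce
    rw [if_pos (by omega), Nat.add_sub_cancel_left, if_pos hj, Nat.zero_add]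
  clear ha
  -- As `N ≤ 2 * n`, this size leaves room for the input, for three `N × N` matrices and for the
  -- output.
  refine Run.cons (Run.set (v := 16 * ((n + 8) * (n + 8))) (by norm_num) (by decide)
    (by simp [hlow, m1]) (fun _ => hX)) (by omega) fun mb T2 hT2 hb => ?_
  refine Run.cons (Run.set (v := n) (by norm_num) (by decide)
    (by simp [hb, hlow, m1]) (fun _ => by omega)) (by omega) fun mc T3 hT3 hc => ?_
  refine Run.cons (Run.set (v := 1) (by norm_num) (by decide) (by simp) (fun _ => by omega))
    (by omega) fun md T4 hT4 hd => ?_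
  have hpow : ∀ j < Nat.clog 2 n, 2 ^ j < n := fun j hj =>
    (Nat.lt_clog_iff_pow_lt (by norm_num)).mp hj
  have hclog : Nat.clog 2 n ≤ n := by
    by_contra hlt
    exact absurd (hpow n (by omega)) (by have := Nat.lt_two_pow_self (n := n); omega)
  have hlepow := Nat.le_pow_clog (b := 2) (by norm_num) n
  generalize Nat.clog 2 n = J at *
  have hJ : J * (401 + 201) + 201 ≤ 602 * n + 201 := by omega
  refine Run.cons (Run.loop (T := 401) (by decide) J
    (fun j m' => m' 0 = m 0 ∧ m' 1 = 2 ^ j ∧ m' 2 = 16 * ((n + 8) * (n + 8)) ∧ m' 3 = n ∧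
      ∀ j < n * n + n + 2, slot (16 * ((n + 8) * (n + 8))) m' 0 j = m j) ?_ ?_ ?_)
    ((Nat.add_le_add_right hJ 1).trans (by clear hJ hpow; omega))
    fun me T5 hT5 he => Run.nil (by clear hpow; omega) he
  · subst hd hc hb
    refine ⟨by simp [hlow], by simp, by simp, by simp, fun j hj => ?_⟩
    rw [slot_update (by norm_num), slot_update (by norm_num), slot_update (by norm_num), ← hdata j hj]
    simp [slot]
  · rintro j hj mf ⟨f0, f1, f2, f3, fs⟩
    have := hpow j hj
    refine ⟨by simp [f1, f3]; omega, Run.imp (Run.set (v := 2 ^ (j + 1)) (by norm_num) (by decide)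
      (by simp [f1, pow_succ, mul_comm]) (fun _ => by rw [pow_succ]; omega)) fun mg hg => ?_⟩
    subst hg
    refine ⟨by simp [f0], by simp, by simp [f2], by simp [f3], fun j hj => ?_⟩
    rw [slot_update (by norm_num), fs j hj]
  · rintro mf ⟨f0, f1, f2, f3, fs⟩
    simp [f1, f3, hlepow]

theorem incidences (hI : R.procs[fI]? = some _root_.incidenceCmd) (hn : n ≤ N)
    (hS : 3 * (N * N) + N + 200 ≤ S) (hnS : n * n + n + 200 ≤ S) (m0 : m 0 = p) (m1 : m 1 = N)
    (m2 : m 2 = S) (m3 : m 3 = n) (hp : p + 1 ≤ R.X) (h : Stored S n m off card vert)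
    (hoff : ∀ i < n, off i + 1 + card i ≤ n * n + n + 2) (hcard : ∀ i < n, card i ≤ N) :
    Run R (incidences fI) m (incidenceTime n card N p + incidenceTime n card N (p + 1) +
      2000 * (N * N) + 2000 * N + 30000) (fun m' => m' 1 = N ∧ m' 2 = S ∧
        m' 4 = (ofCard n card (p + 1)).length ∧ m' 5 = (ofCard n card (p + 2)).length ∧
        Holds S m' 2 64 N N (incidence n card vert p) ∧
        Holds S m' 3 64 N N (incidence n card vert (p + 1))) := by
  refine bounded fun hm => ?_
  have hX := R.hX
  have hSX : S ≤ R.X := m2 ▸ hm 2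
  have hnN : n * n ≤ N * N := Nat.mul_le_mul hn hn
  have hlen := length_ofCard_add_le n card (p + 1)
  have hpX : p ≤ R.X := by omega
  have hn₁ : (ofCard n card (p + 1)).length ≤ R.X := by omega
  have hn₂ : (ofCard n card (p + 2)).length ≤ R.X := by
    rw [show p + 2 = p + 1 + 1 from rfl]; omega
  clear hlen
  refine Run.cons (Run.tab (S := S) (ov := 64) (nv := n * n + n + 2)
    (g := fun q => slot S m 0 q) m2 (by decide) (fun _ _ => rfl)
    (fun m' hm' => by simp [hm'.reg, m3]) (by omega)
    (fun q hq m' h63 hw => by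
      rw [eval_ld, hw.reg 2 (by norm_num), m2, eval_reg, h63,
        hw.oth 0 _ (by norm_num) (by omega)])
    (fun hm _ _ => hm _)) (by nlinarith) fun ma T1 hT1 ha => ?_
  have a0 : ma 0 = p := by rw [ha.reg 0 (by norm_num), m0]
  have a1 : ma 1 = N := by rw [ha.reg 1 (by norm_num), m1]
  have a2 : ma 2 = S := by rw [ha.reg 2 (by norm_num), m2]
  have a3 : ma 3 = n := by rw [ha.reg 3 (by norm_num), m3]
  refine Run.cons (Run.send (S := S) (av := p) (nv := n * n + n + 2) (lv := N * N) hI a2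
    (by decide) (fun m' hm' => by simp [hm'.reg, a0]) (fun m' hm' => by simp [hm'.reg, a3])
    (fun m' hm' => by simp [hm'.reg, a1]) (by omega) (by omega) (fun _ => hpX)
    (T := incidenceTime n card N p) (fun mr c0 c1 c2 hc => Run.incidenceCmd
      (h.of_lt (by omega) hoff fun j hj => by rw [hc j hj]; exact ha.new j hj) c0 (c1.trans a1) c2
      hn hcard hS)) (by omega) fun mb T2 hT2 ⟨mr, ⟨hr7, hr8, hrD⟩, hb⟩ => ?_
  have b0 : mb 0 = p := by rw [hb.reg 0 (by norm_num), a0]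
  have b1 : mb 1 = N := by rw [hb.reg 1 (by norm_num), a1]
  have b2 : mb 2 = S := by rw [hb.reg 2 (by norm_num), a2]
  have b3 : mb 3 = n := by rw [hb.reg 3 (by norm_num), a3]
  have bs : ∀ j < n * n + n + 2, slot S mb 1 (64 + j) = slot S m 0 j := fun j hj => by
    rw [hb.src (by norm_num) _ (by omega) (by omega)]; exact ha.new j hj
  refine Run.cons (Run.send (S := S) (av := p + 1) (nv := n * n + n + 2) (lv := N * N) hI b2
    (by decide) (fun m' hm' => by simp [hm'.reg, b0]) (fun m' hm' => by simp [hm'.reg, b3])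
    (fun m' hm' => by simp [hm'.reg, b1]) (by omega) (by omega) (fun _ => hp)
    (T := incidenceTime n card N (p + 1)) (fun mr c0 c1 c2 hc => Run.incidenceCmd
      (h.of_lt (by omega) hoff fun j hj => by rw [hc j hj]; exact bs j hj) c0 (c1.trans b1) c2
      hn hcard hS)) (by omega) fun mc T3 hT3 ⟨mr', ⟨hr7', hr8', hrD'⟩, hc⟩ => ?_
  have c1 : mc 1 = N := by rw [hc.reg 1 (by norm_num), b1]
  have c2 : mc 2 = S := by rw [hc.reg 2 (by norm_num), b2]
  have c3 : mc 3 = n := by rw [hc.reg 3 (by norm_num), b3]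
  -- The registers of the procedure come back in front of its result, so the entry 8 is its register
  -- 8, the number of columns of the incidence matrix.
  have e8 : slot S mc 2 8 = (ofCard n card (p + 1)).length := by
    rw [hc.oth 2 8 (by norm_num) (by norm_num) (by omega), hb.res 8 (by norm_num), hr8]
  have e8' : slot S mc 3 8 = (ofCard n card (p + 2)).length := by
    rw [hc.res 8 (by norm_num), hr8']
  have cD : Holds S mc 2 64 N N (_root_.incidence n card vert p) := fun q hq => by
    rw [hc.oth 2 _ (by norm_num) (by norm_num) (by omega), hb.new q hq, ← hrD q hq, Nat.zero_add]
  have cD' : Holds S mc 3 64 N N (_root_.incidence n card vert (p + 1)) := fun q hq => by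
    rw [hc.new q hq, ← hrD' q hq, Nat.zero_add]
  refine Run.cons (Run.set (v := (ofCard n card (p + 1)).length) (by norm_num) (by decide)
    (by simp [c2, e8]) (fun _ => hn₁)) (by omega) fun md T4 hT4 hd => ?_
  refine Run.cons (Run.set (v := (ofCard n card (p + 2)).length) (by norm_num) (by decide)
    (by simp [hd, c2, e8']) (fun _ => hn₂)) (by omega) fun me T5 hT5 he =>
      Run.nil (by omega) ?_
  have es : ∀ k j, slot S me k j = slot S mc k j := fun k j => by
    rw [he, slot_update (by norm_num), hd, slot_update (by norm_num)]
  exact ⟨by simp [he, hd, c1], by simp [he, hd, c2], by simp [he, hd], by simp [he],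
    cD.congr fun q _ => es _ _, cD'.congr fun q _ => es _ _⟩

variable {n₁ n₂ : ℕ} {D D' : ℕ → ℕ → ZMod 2}

theorem eliminations (hf : MulProc R f N TM) (hfB : R.procs[fB]? = some (_root_.bmul f))
    (hfR : R.procs[fR]? = some (_root_.rref fB fR))
    (hG : R.procs[fG]? = some (_root_.gaussJordan fR)) (hN : N = 2 ^ J) (hn : n₁ + n₂ ≤ N)
    (hS : 3 * (N * N) + N + 200 ≤ S) (e1 : m 1 = N) (e2 : m 2 = S) (e4 : m 4 = n₁) (e5 : m 5 = n₂)
    (cD : Holds S m 2 64 N N D) (cD' : Holds S m 3 64 N N D') :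
    Run R (eliminations fG) m (2 * gaussJordanTime TM J + 10000 * (N * N) + 50000)
      (fun m' => ∃ X X', GaussJordan N D X ∧ GaussJordan N (extend n₁ n₂ D' X) X' ∧
        m' 1 = N ∧ m' 2 = S ∧ m' 4 = n₁ ∧ m' 5 = n₂ ∧ Holds S m' 5 64 N N X ∧
        Holds S m' 6 64 N N (extend n₁ n₂ D' X) ∧ Holds S m' 7 64 N N X') := by
  refine bounded fun hm => ?_
  have hX := R.hX
  have hSX : S ≤ R.X := e2 ▸ hm 2
  have hGT : gaussJordanTime TM J = rrefTime TM N J + 10000 * (N * N) + 20000 := by rw [hN]; rfl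
  have hgauss := fun {A m} => Run.gaussJordan (A := A) (m := m) hf hfB hfR hN hS
  rw [← hGT] at hgauss
  generalize gaussJordanTime TM J = TG at *
  clear hGT
  refine Run.cons (Run.tab (S := S) (ov := 64) (nv := N * N) (g := fun q => (D (q / N) (q % N)).val)
    e2 (by decide) (fun _ _ => rfl) (fun m' hm' => by simp [hm'.reg, e1]) (by omega)
    (fun q hq m' h63 hw => by
      rw [eval_ld, hw.reg 2 (by norm_num), e2, eval_add, eval_reg, h63, eval_ofNat,
        hw.oth 2 _ (by norm_num) (by omega), cD q hq])
    (fun hm _ _ => (ZMod.val_two_le _).trans (by omega))) (by omega) fun mf T6 hT6 hf' => ?_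
  have f1 : mf 1 = N := by rw [hf'.reg 1 (by norm_num), e1]
  have f2 : mf 2 = S := by rw [hf'.reg 2 (by norm_num), e2]
  refine Run.cons (Run.send (S := S) (av := 0) (nv := N * N) (lv := N * N) hG f2
    (by decide) (fun m' hm' => rfl) (fun m' hm' => by simp [hm'.reg, f1])
    (fun m' hm' => by simp [hm'.reg, f1]) (by omega) (by omega) (fun _ => by omega)
    (T := TG) (fun mr c0 c1 c2 hc => hgauss (A := D) (c1.trans f1) c2 fun q hq => by
      rw [Nat.zero_add, hc q hq]; exact hf'.new q hq)) (by omega)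
    fun mg T7 hT7 ⟨mx, ⟨X, hGJ, hX'⟩, hg⟩ => ?_
  have g1 : mg 1 = N := by rw [hg.reg 1 (by norm_num), f1]
  have g2 : mg 2 = S := by rw [hg.reg 2 (by norm_num), f2]
  have g4 : mg 4 = n₁ := by rw [hg.reg 4 (by norm_num), hf'.reg 4 (by norm_num), e4]
  have g5 : mg 5 = n₂ := by rw [hg.reg 5 (by norm_num), hf'.reg 5 (by norm_num), e5]
  have gD' : Holds S mg 3 64 N N D' := cD'.congr fun q hq => by
    rw [hg.oth 3 _ (by norm_num) (by norm_num) (by omega), hf'.oth 3 _ (by norm_num) (by omega)]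
  have gX : Holds S mg 5 64 N N X := fun q hq => by
    rw [hg.new q hq, ← hX' q hq, Nat.zero_add]
  refine Run.cons (Run.tab (S := S) (ov := 64) (nv := N * N)
    (g := fun q => (extend n₁ n₂ D' X (q / N) (q % N)).val)
    g2 (by decide) (fun _ _ => rfl) (fun m' hm' => by simp [hm'.reg, g1]) (by omega)
    (fun q hq m' h63 hw => ?_)
    (fun hm _ _ => (ZMod.val_two_le _).trans (by omega))) (by omega) fun mh T8 hT8 hh => ?_
  · simp only [eval_ld, eval_add, eval_mul, eval_sub, eval_div, eval_mod, eval_lt, eval_eq,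
      eval_reg, eval_ofNat, h63, hw.reg 1 (by norm_num), hw.reg 2 (by norm_num),
      hw.reg 4 (by norm_num), hw.reg 5 (by norm_num), g1, g2, g4, g5]
    rw [hw.oth 3 _ (by norm_num) (by omega), gD' q hq]
    -- Three ranges of columns: those of `D'`, those of `X + 1`, and the padding. In the program a
    -- product of two comparisons selects the middle range.
    by_cases h1 : q % N < n₂
    · have hE : extend n₁ n₂ D' X (q / N) (q % N) = D' (q / N) (q % N) := by
        unfold extend
        rw [if_neg (c := _ ∧ _) (by omega), add_zero]
      rw [hE, if_pos h1, Nat.sub_self, Nat.zero_mul, Nat.zero_mul, Nat.add_zero,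
        Nat.mod_eq_of_lt (ZMod.val_lt _)]
    · by_cases h2 : q % N - n₂ < n₁
      · have hE : extend n₁ n₂ D' X (q / N) (q % N) = D' (q / N) (q % N) +
            (X (q / N) (q % N - n₂) + if q / N = q % N - n₂ then 1 else 0) := by
          unfold extend
          rw [if_pos (c := _ ∧ _) ⟨by omega, h2⟩]
        have := add_mul_lt (div_lt_of_lt_mul hq) (show q % N - n₂ < N by omega)
        rw [hE, if_neg h1, if_pos h2, hw.oth 5 _ (by norm_num) (by omega),
          gX.get (div_lt_of_lt_mul hq) (by omega), ZMod.val_add, ZMod.val_add]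
        split_ifs <;> simp [ZMod.val_one]
      · have hE : extend n₁ n₂ D' X (q / N) (q % N) = D' (q / N) (q % N) := by
          unfold extend
          rw [if_neg (c := _ ∧ _) (by omega), add_zero]
        rw [hE, if_neg h2, Nat.mul_zero, Nat.zero_mul, Nat.add_zero,
          Nat.mod_eq_of_lt (ZMod.val_lt _)]
  have h1' : mh 1 = N := by rw [hh.reg 1 (by norm_num), g1]
  have h2' : mh 2 = S := by rw [hh.reg 2 (by norm_num), g2]
  refine Run.cons (Run.send (S := S) (av := 0) (nv := N * N) (lv := N * N) hG h2'
    (by decide) (fun m' hm' => rfl) (fun m' hm' => by simp [hm'.reg, h1'])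
    (fun m' hm' => by simp [hm'.reg, h1']) (by omega) (by omega) (fun _ => by omega)
    (T := TG) (fun mr c0 c1 c2 hc => hgauss (A := extend n₁ n₂ D' X) (c1.trans h1') c2
      fun q hq => by rw [Nat.zero_add, hc q hq]; exact hh.new q hq)) (by omega)
    fun mi T9 hT9 ⟨my, ⟨X', hGJ', hY⟩, hi⟩ => Run.nil (by omega) ⟨X, X', hGJ, hGJ', ?_⟩
  have hr : ∀ r < 60, mi r = m r := fun r hr => by
    rw [hi.reg r hr, hh.reg r hr, hg.reg r hr, hf'.reg r hr]
  refine ⟨by rw [hr 1 (by norm_num), e1], by rw [hr 2 (by norm_num), e2],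
    by rw [hr 4 (by norm_num), e4],
    by rw [hr 5 (by norm_num), e5], gX.congr fun q hq => ?_, fun q hq => ?_, fun q hq => ?_⟩
  · rw [hi.oth 5 _ (by norm_num) (by norm_num) (by omega), hh.oth 5 _ (by norm_num) (by omega)]
  · rw [hi.src (by norm_num) _ (by omega) (by omega)]
    exact hh.new q hq
  · rw [hi.new q hq, ← hY q hq, Nat.zero_add]

end Run

/-! ### The output of the algorithm -/

/-- The numbers `b < n` for which the diagonal entry of `X` in the place `c + b` is `v`. -/
def diag (c n : ℕ) (X : ℕ → ℕ → ZMod 2) (v : ZMod 2) : List ℕ :=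
  (List.range n).filter fun b => X (c + b) (c + b) = v

theorem mem_diag {c n b : ℕ} {X : ℕ → ℕ → ZMod 2} {v : ZMod 2} :
    b ∈ diag c n X v ↔ b < n ∧ X (c + b) (c + b) = v := by
  simp [diag]

theorem length_diag_le (c n : ℕ) (X : ℕ → ℕ → ZMod 2) (v : ZMod 2) : (diag c n X v).length ≤ n :=
  (List.length_filter_le _ _).trans (by simp)

theorem getD_diag {c n a : ℕ} {X : ℕ → ℕ → ZMod 2} {v : ZMod 2} (ha : a < (diag c n X v).length) :
    (diag c n X v).getD a 0 < n ∧ X (c + (diag c n X v).getD a 0) (c + (diag c n X v).getD a 0) = v :=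
  mem_diag.mp (by rw [List.getD_eq_getElem _ _ ha]; exact List.getElem_mem ha)

theorem length_diag_add (n : ℕ) (X : ℕ → ℕ → ZMod 2) :
    (diag 0 n X 1).length + (diag 0 n X 0).length = n := by
  have h1 := List.length_eq_length_filter_add (l := List.range n)
    (fun i => decide (X (0 + i) (0 + i) = 1))
  have h2 : ∀ x : ZMod 2, decide (x = 0) = !decide (x = 1) := by decide
  rw [List.length_range] at h1
  simp only [diag, h2]
  exact h1.symm

/-- The output for `n₁` simplices, where `X` is the first Gauss–Jordan form and `X'` the one of the
matrix `M`. -/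
structure Result (n₁ n₂ : ℕ) (X M X' : ℕ → ℕ → ZMod 2) (pl ql hb : List ℕ) (w : ℕ → ℕ) :
    Prop where
  rank : w 0 = pl.length
  nullity : w 1 = ql.length
  betti : w 2 = hb.length
  first : ∀ a < pl.length, w (3 + a) = pl.getD a 0
  last : ∀ a < ql.length, w (3 + pl.length + a) = ql.getD a 0
  relation : ∀ q < pl.length * ql.length, w (3 + pl.length + ql.length + q) =
    (X (pl.getD (q / ql.length) 0) (ql.getD (q % ql.length) 0)).val
  chain : ∀ q < hb.length * n₁,
    w (3 + pl.length + ql.length + pl.length * ql.length + q) =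
      (M (q % n₁) (n₂ + hb.getD (q / n₁) 0)).val
  vector : ∀ q < n₁ * hb.length,
    w (3 + pl.length + ql.length + pl.length * ql.length + hb.length * n₁ + q) =
      (X' (n₂ + hb.getD (q % hb.length) 0) (n₂ + q / hb.length)).val

/-- Selects the diagonal entries of the matrix in the slot `x` that are equal to `v`. -/
def selectDiag (x k c : ℕ) (b v : WordExpr) : Cmd :=
  filt 10 k c (reg 4) (reg 10)
    (eq (ld x (64 + ((b + reg 10) * reg 1 + (b + reg 10)))) v)

/-- Determines the pivots. -/
def select : Cmd := prog [
  selectDiag 5 8 6 0 1,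
  selectDiag 5 9 7 0 0,
  selectDiag 7 10 8 (reg 5) 1]

/-- Writes the output to the slot `11`. -/
def compose : Cmd := prog [
  tab 11 0 1 (reg 6),
  tab 11 1 1 (reg 7),
  tab 11 2 1 (reg 8),
  tab 11 3 (reg 6) (ld 8 (reg 63)),
  tab 11 (3 + reg 6) (reg 7) (ld 9 (reg 63)),
  tab 11 (3 + reg 6 + reg 7) (reg 6 * reg 7)
    (ld 5 (64 + (ld 8 (reg 63 / reg 7) * reg 1 + ld 9 (reg 63 % reg 7)))),
  tab 11 (3 + reg 6 + reg 7 + reg 6 * reg 7) (reg 8 * reg 4)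
    (ld 6 (64 + (reg 63 % reg 4 * reg 1 + (reg 5 + ld 10 (reg 63 / reg 4))))),
  tab 11 (3 + reg 6 + reg 7 + reg 6 * reg 7 + reg 8 * reg 4) (reg 4 * reg 8)
    (ld 7 (64 + ((reg 5 + ld 10 (reg 63 % reg 8)) * reg 1 + (reg 5 + reg 63 / reg 8))))]

/-- The length of the output. -/
def outputLength : WordExpr :=
  3 + reg 6 + reg 7 + reg 6 * reg 7 + reg 8 * reg 4 + reg 4 * reg 8

namespace Run

variable {m : ℕ → ℕ} {S N n₁ n₂ fC : ℕ} {X M X' : ℕ → ℕ → ZMod 2} {pl ql hb : List ℕ}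

theorem selectDiag {x k c bv : ℕ} {b v : WordExpr} {w : ZMod 2} (hc : c < 60) (hc4 : 10 < c + 5)
    (hc10 : 10 ≠ c) (hxk : x ≠ k)
    (hsm : (adr k (reg c + reg 63)).Small ∧
      (eq (ld x (64 + ((b + reg 10) * reg 1 + (b + reg 10)))) v).Small ∧
      (reg c + eq (ld x (64 + ((b + reg 10) * reg 1 + (b + reg 10)))) v).Small)
    (m1 : m 1 = N) (m2 : m 2 = S) (m4 : m 4 = n₁) (hS : 3 * (N * N) + N + 200 ≤ S)
    (hb : ∀ m', Filtering S 10 k c m m' → b.eval m' = bv)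
    (hv : ∀ m', Filtering S 10 k c m m' → v.eval m' = w.val) (hN : bv + n₁ ≤ N)
    (hX : Holds S m x 64 N N X) :
    Run R (_root_.selectDiag x k c b v) m (4000 * (n₁ + 1))
      (Filtered S 10 k c (diag bv n₁ X w) m) := by
  refine bounded fun hm => ?_
  have hSX : S ≤ R.X := m2 ▸ hm 2
  have := Run.filt (R := R) (m := m) (r := 10) (k := k) (c := c) (n := reg 4) (e := reg 10)
    (p := eq (ld x (64 + ((b + reg 10) * reg 1 + (b + reg 10)))) v)
    (S := S) (nv := n₁) (g := fun i => i) (P := fun i => X (bv + i) (bv + i) = w)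
    (by norm_num) hc hc10 (by norm_num) (by omega) m2
    ⟨by decide, hsm.1, by decide, hsm.2.2⟩ (by omega)
    (fun m' hm' => by rw [eval_reg, hm'.reg 4 (by norm_num) (by norm_num) (by omega), m4])
    (fun j hj m' h10 hm' => by rw [eval_reg, h10])
    (fun j hj m' h10 hm' => by
      have hlt := add_mul_lt (show bv + j < N by omega) (show bv + j < N by omega)
      rw [eval_eq, eval_ld, hm'.reg 2 (by norm_num) (by norm_num) (by omega), m2, hv m' hm']
      simp only [eval_add, eval_mul, eval_reg, eval_ofNat, hb m' hm', h10,
        hm'.reg 1 (by norm_num) (by norm_num) (by omega), m1]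
      rw [hm'.oth x _ hxk (by omega), hX.get (by omega) (by omega)]
      simp only [(ZMod.val_injective 2).eq_iff])
    (fun _ j hj => by omega)
  simpa [diag, _root_.selectDiag] using this

theorem select (m1 : m 1 = N) (m2 : m 2 = S) (m4 : m 4 = n₁) (m5 : m 5 = n₂)
    (hS : 3 * (N * N) + N + 200 ≤ S) (hN : n₁ + n₂ ≤ N)
    (h5 : Holds S m 5 64 N N X) (h6 : Holds S m 6 64 N N M) (h7 : Holds S m 7 64 N N X') :
    Run R select m (12000 * n₁ + 20000) (fun m' => m' 1 = N ∧ m' 2 = S ∧ m' 4 = n₁ ∧ m' 5 = n₂ ∧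
      m' 6 = (diag 0 n₁ X 1).length ∧ m' 7 = (diag 0 n₁ X 0).length ∧
      m' 8 = (diag n₂ n₁ X' 1).length ∧ Holds S m' 5 64 N N X ∧ Holds S m' 6 64 N N M ∧
      Holds S m' 7 64 N N X' ∧
      (∀ a < (diag 0 n₁ X 1).length, slot S m' 8 a = (diag 0 n₁ X 1).getD a 0) ∧
      (∀ a < (diag 0 n₁ X 0).length, slot S m' 9 a = (diag 0 n₁ X 0).getD a 0) ∧
      ∀ a < (diag n₂ n₁ X' 1).length, slot S m' 10 a = (diag n₂ n₁ X' 1).getD a 0) := by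
  have l1 := length_diag_le 0 n₁ X 1
  have l0 := length_diag_le 0 n₁ X 0
  refine Run.cons (Run.selectDiag (bv := 0) (w := 1) (by norm_num) (by norm_num) (by norm_num)
    (by norm_num) (by decide) m1 m2 m4 hS (fun _ _ => rfl) (fun _ _ => rfl) (by omega) h5)
    (by omega) fun ma T1 hT1 ha => ?_
  have ar : ∀ x < 60, x ≠ 10 → x ≠ 6 → ma x = m x := ha.reg
  have as : ∀ x j, x ≠ 8 → j < S → slot S ma x j = slot S m x j := ha.oth
  refine Run.cons (Run.selectDiag (S := S) (N := N) (n₁ := n₁) (X := X) (bv := 0) (w := 0)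
    (by norm_num) (by norm_num) (by norm_num)
    (by norm_num) (by decide) (by rw [ar 1 (by norm_num) (by norm_num) (by norm_num), m1])
    (by rw [ar 2 (by norm_num) (by norm_num) (by norm_num), m2])
    (by rw [ar 4 (by norm_num) (by norm_num) (by norm_num), m4]) hS (fun _ _ => rfl)
    (fun _ _ => rfl) (by omega) (h5.congr fun q hq => as 5 _ (by norm_num) (by omega)))
    (by omega) fun mb T2 hT2 hb => ?_
  have br : ∀ x < 60, x ≠ 10 → x ≠ 6 → x ≠ 7 → mb x = m x := fun x hx h h' h'' => by
    rw [hb.reg x hx h h'', ar x hx h h']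
  have bs : ∀ x j, x ≠ 8 → x ≠ 9 → j < S → slot S mb x j = slot S m x j := fun x j h h' hj => by
    rw [hb.oth x j h' hj, as x j h hj]
  refine Run.cons (Run.selectDiag (S := S) (N := N) (n₁ := n₁) (X := X') (bv := n₂) (w := 1)
    (by norm_num) (by norm_num) (by norm_num)
    (by norm_num) (by decide)
    (by rw [br 1 (by norm_num) (by norm_num) (by norm_num) (by norm_num), m1])
    (by rw [br 2 (by norm_num) (by norm_num) (by norm_num) (by norm_num), m2])
    (by rw [br 4 (by norm_num) (by norm_num) (by norm_num) (by norm_num), m4]) hS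
    (fun m' hm' => by
      rw [eval_reg, hm'.reg 5 (by norm_num) (by norm_num) (by norm_num),
        br 5 (by norm_num) (by norm_num) (by norm_num) (by norm_num), m5])
    (fun _ _ => rfl) (by omega)
    (h7.congr fun q hq => bs 7 _ (by norm_num) (by norm_num) (by omega)))
    (by omega) fun mc T3 hT3 hc => Run.nil (by omega) ?_
  have cr : ∀ x < 60, x ≠ 10 → x ≠ 6 → x ≠ 7 → x ≠ 8 → mc x = m x := fun x hx h h' h'' h3 => by
    rw [hc.reg x hx h h3, br x hx h h' h'']
  have cs : ∀ x j, x ≠ 8 → x ≠ 9 → x ≠ 10 → j < S → slot S mc x j = slot S m x j :=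
    fun x j h h' h'' hj => by rw [hc.oth x j h'' hj, bs x j h h' hj]
  refine ⟨by rw [cr, m1] <;> norm_num, by rw [cr, m2] <;> norm_num, by rw [cr, m4] <;> norm_num,
    by rw [cr, m5] <;> norm_num, ?_, ?_, hc.count,
    h5.congr fun q hq => cs _ _ (by norm_num) (by norm_num) (by norm_num) (by omega),
    h6.congr fun q hq => cs _ _ (by norm_num) (by norm_num) (by norm_num) (by omega),
    h7.congr fun q hq => cs _ _ (by norm_num) (by norm_num) (by norm_num) (by omega),
    fun a h => ?_, fun a h => ?_, fun a h => ?_⟩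
  · rw [hc.reg 6 (by norm_num) (by norm_num) (by norm_num),
      hb.reg 6 (by norm_num) (by norm_num) (by norm_num), ha.count]
  · rw [hc.reg 7 (by norm_num) (by norm_num) (by norm_num), hb.count]
  · rw [hc.oth 8 _ (by norm_num) (by omega), hb.oth 8 _ (by norm_num) (by omega), ha.new a h,
      List.getD_eq_getElem _ _ h]
  · rw [hc.oth 9 _ (by norm_num) (by omega), hb.new a h, List.getD_eq_getElem _ _ h]
  · rw [hc.new a h, List.getD_eq_getElem _ _ h]

/-- The first `c` words of `w` have been written to the slot `11`. -/
structure _root_.Composing (S c : ℕ) (w m m' : ℕ → ℕ) : Prop extends Near S 11 m m' where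
  out : ∀ j < c, slot S m' 11 j = w j

theorem append {c nv : ℕ} {o n e : WordExpr} {w m₀ : ℕ → ℕ} (h : Composing S c w m₀ m)
    (m2 : m₀ 2 = S) (hsm : (n - reg 63).Small ∧ (adr 11 (o + reg 63)).Small ∧ e.Small)
    (ho : ∀ m', Near S 11 m₀ m' → o.eval m' = c) (hn : ∀ m', Near S 11 m₀ m' → n.eval m' = nv)
    (hb : c + nv ≤ S)
    (he : ∀ j < nv, ∀ m', m' 63 = j → Near S 11 m₀ m' → e.eval m' = w (c + j))
    (hw : ∀ i < c + nv, w i ≤ R.X) :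
    Run R (_root_.tab 11 o n e) m (1100 * (nv + 1)) (Composing S (c + nv) w m₀) := by
  have key : ∀ m', Near S 11 m m' → Near S 11 m₀ m' := fun m' h' =>
    ⟨fun r hr => by rw [h'.reg r hr, h.reg r hr], fun k j hk hj => by
      rw [h'.oth k j hk hj, h.oth k j hk hj]⟩
  refine Run.imp (Run.tab (S := S) (g := fun j => w (c + j))
    (by rw [h.reg 2 (by norm_num), m2]) hsm (fun m' h' => ho m' (key m' h'))
    (fun m' h' => hn m' (key m' h')) hb (fun j hj m' h63 hw => he j hj m' h63 (key m' hw.toNear))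
    (fun _ j hj => hw _ (by omega))) fun m' hm' => ⟨key m' hm'.toNear, fun j hj => ?_⟩
  rcases Nat.lt_or_ge j c with hlt | hge
  · rw [hm'.old j (by omega) (Or.inl hlt), h.out j hlt]
  · obtain ⟨i, rfl⟩ := Nat.exists_eq_add_of_le hge
    exact hm'.new i (by omega)

theorem compose {w : ℕ → ℕ} {r s g : ℕ} (hw : Result n₁ n₂ X M X' pl ql hb w)
    (hr : pl.length = r) (hs : ql.length = s) (hg : hb.length = g)
    (m1 : m 1 = N) (m2 : m 2 = S) (m4 : m 4 = n₁) (m5 : m 5 = n₂) (m6 : m 6 = r) (m7 : m 7 = s)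
    (m8 : m 8 = g) (hS : 3 + r + s + r * s + g * n₁ + n₁ * g ≤ S)
    (hNS : 3 * (N * N) + N + 200 ≤ S) (hN : n₁ + n₂ ≤ N)
    (hX : ∀ i < 3 + r + s + r * s + g * n₁ + n₁ * g, w i ≤ R.X)
    (hpl : ∀ a < r, pl.getD a 0 < n₁) (hql : ∀ a < s, ql.getD a 0 < n₁)
    (hhb : ∀ a < g, hb.getD a 0 < n₁)
    (h5 : Holds S m 5 64 N N X) (h6 : Holds S m 6 64 N N M) (h7 : Holds S m 7 64 N N X')
    (s8 : ∀ a < r, slot S m 8 a = pl.getD a 0) (s9 : ∀ a < s, slot S m 9 a = ql.getD a 0)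
    (s10 : ∀ a < g, slot S m 10 a = hb.getD a 0) :
    Run R compose m (1200 * (3 + r + s + r * s + g * n₁ + n₁ * g) + 10000)
      (Composing S (3 + r + s + r * s + g * n₁ + n₁ * g) w m) := by
  subst hr hs hg
  have h0 : Composing S 0 w m m := ⟨⟨fun _ _ => rfl, fun _ _ _ _ => rfl⟩, fun j hj => by omega⟩
  have k0 := hw.rank
  have k1 := hw.nullity
  have k2 := hw.betti
  have k3 := hw.first
  have k4 := hw.last
  have k5 := hw.relation
  have k6 := hw.chain
  have k7 := hw.vector
  generalize pl.length = r at *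
  generalize ql.length = s at *
  generalize hb.length = g at *
  generalize hrs : r * s = rs at *
  generalize hgn : g * n₁ = gn at *
  generalize hng : n₁ * g = ng at *
  refine Run.cons (Run.append (nv := 1) h0 m2 (by decide) (fun _ _ => rfl) (fun _ _ => rfl)
    (by omega) (fun j hj m' h63 h' => by
      rw [eval_reg, h'.reg 6 (by norm_num), m6, ← k0]; congr 1; omega)
    (fun i hi => hX i (by omega))) (by omega) fun ma T1 hT1 ha => ?_
  refine Run.cons (Run.append (nv := 1) ha m2 (by decide) (fun _ _ => rfl) (fun _ _ => rfl)
    (by omega) (fun j hj m' h63 h' => by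
      rw [eval_reg, h'.reg 7 (by norm_num), m7, ← k1]; congr 1; omega)
    (fun i hi => hX i (by omega))) (by omega) fun mb T2 hT2 hb' => ?_
  refine Run.cons (Run.append (nv := 1) hb' m2 (by decide) (fun _ _ => rfl) (fun _ _ => rfl)
    (by omega) (fun j hj m' h63 h' => by
      rw [eval_reg, h'.reg 8 (by norm_num), m8, ← k2]; congr 1; omega)
    (fun i hi => hX i (by omega))) (by omega) fun mc T3 hT3 hc => ?_
  rw [show 0 + 1 + 1 + 1 = 3 from rfl] at hc
  refine Run.cons (Run.append (nv := r) hc m2 (by decide) (fun _ _ => rfl)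
    (fun m' h' => by rw [eval_reg, h'.reg 6 (by norm_num), m6])
    (by omega) (fun j hj m' h63 h' => by
      rw [eval_ld, eval_reg, h63, h'.reg 2 (by norm_num), m2, h'.oth 8 _ (by norm_num) (by omega),
        s8 j hj, k3 j hj])
    (fun i hi => hX i (by omega))) (by omega) fun md T4 hT4 hd => ?_
  refine Run.cons (Run.append (nv := s) hd m2 (by decide)
    (fun m' h' => by simp only [eval_add, eval_ofNat, eval_reg, h'.reg 6 (by norm_num), m6])
    (fun m' h' => by rw [eval_reg, h'.reg 7 (by norm_num), m7])
    (by omega) (fun j hj m' h63 h' => by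
      rw [eval_ld, eval_reg, h63, h'.reg 2 (by norm_num), m2, h'.oth 9 _ (by norm_num) (by omega),
        s9 j hj, k4 j hj])
    (fun i hi => hX i (by omega))) (by omega) fun me T5 hT5 he => ?_
  refine Run.cons (Run.append (nv := rs) he m2 (by decide)
    (fun m' h' => by simp only [eval_add, eval_ofNat, eval_reg, h'.reg 6 (by norm_num),
      h'.reg 7 (by norm_num), m6, m7])
    (fun m' h' => by simp only [eval_mul, eval_reg, h'.reg 6 (by norm_num),
      h'.reg 7 (by norm_num), m6, m7, hrs])
    (by omega) (fun j hj m' h63 h' => ?_)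
    (fun i hi => hX i (by omega))) (by omega) fun mf T6 hT6 hf => ?_
  · have hj' := hj
    rw [← hrs] at hj'
    have hp := hpl _ (div_lt_of_lt_mul hj')
    have hq := hql _ (mod_lt_of_lt_mul hj')
    have hlt := add_mul_lt (show pl.getD (j / s) 0 < N by omega) (show ql.getD (j % s) 0 < N by omega)
    have hle := Nat.mod_le j s
    have hle' := Nat.div_le_self j s
    simp only [eval_ld, eval_add, eval_mul, eval_div, eval_mod, eval_reg, eval_ofNat, h63,
      h'.reg 1 (by norm_num), h'.reg 2 (by norm_num), h'.reg 7 (by norm_num), m1, m2, m7]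
    rw [h'.oth 8 _ (by norm_num) (by omega), h'.oth 9 _ (by norm_num) (by omega),
      s8 _ (div_lt_of_lt_mul hj'), s9 _ (mod_lt_of_lt_mul hj'), h'.oth 5 _ (by norm_num) (by omega),
      h5.get (by omega) (by omega), k5 j hj]
  refine Run.cons (Run.append (nv := gn) hf m2 (by decide)
    (fun m' h' => by simp only [eval_add, eval_mul, eval_ofNat, eval_reg, h'.reg 6 (by norm_num),
      h'.reg 7 (by norm_num), m6, m7, hrs])
    (fun m' h' => by simp only [eval_mul, eval_reg, h'.reg 8 (by norm_num),
      h'.reg 4 (by norm_num), m8, m4, hgn])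
    (by omega) (fun j hj m' h63 h' => ?_)
    (fun i hi => hX i (by omega))) (by omega) fun mh T7 hT7 hh => ?_
  · have hj' := hj
    rw [← hgn] at hj'
    have hp := hhb _ (div_lt_of_lt_mul hj')
    have hq := mod_lt_of_lt_mul hj'
    have hlt := add_mul_lt (show j % n₁ < N by omega)
      (show n₂ + hb.getD (j / n₁) 0 < N by omega)
    have hle' := Nat.div_le_self j n₁
    simp only [eval_ld, eval_add, eval_mul, eval_div, eval_mod, eval_reg, eval_ofNat, h63,
      h'.reg 1 (by norm_num), h'.reg 2 (by norm_num), h'.reg 4 (by norm_num),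
      h'.reg 5 (by norm_num), m1, m2, m4, m5]
    rw [h'.oth 10 _ (by norm_num) (by omega),
      s10 _ (div_lt_of_lt_mul hj'), h'.oth 6 _ (by norm_num) (by omega),
      h6.get (by omega) (by omega), k6 j hj]
  refine Run.cons (Run.append (nv := ng) hh m2 (by decide)
    (fun m' h' => by simp only [eval_add, eval_mul, eval_ofNat, eval_reg, h'.reg 6 (by norm_num),
      h'.reg 7 (by norm_num), h'.reg 8 (by norm_num), h'.reg 4 (by norm_num), m6, m7, m8, m4,
      hrs, hgn])
    (fun m' h' => by simp only [eval_mul, eval_reg, h'.reg 8 (by norm_num),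
      h'.reg 4 (by norm_num), m8, m4, hng])
    (by omega) (fun j hj m' h63 h' => ?_)
    (fun i hi => hX i (by omega))) (by omega) fun mi T8 hT8 hi => Run.nil (by omega) hi
  · have hj' := hj
    rw [← hng] at hj'
    have hp := hhb _ (mod_lt_of_lt_mul hj')
    have hq := div_lt_of_lt_mul hj'
    have hlt := add_mul_lt (show n₂ + hb.getD (j % g) 0 < N by omega)
      (show n₂ + j / g < N by omega)
    have hle' := Nat.mod_le j g
    simp only [eval_ld, eval_add, eval_mul, eval_div, eval_mod, eval_reg, eval_ofNat, h63,
      h'.reg 1 (by norm_num), h'.reg 2 (by norm_num), h'.reg 8 (by norm_num),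
      h'.reg 5 (by norm_num), m1, m2, m8, m5]
    rw [h'.oth 10 _ (by norm_num) (by omega),
      s10 _ (mod_lt_of_lt_mul hj'), h'.oth 7 _ (by norm_num) (by omega),
      h7.get (by omega) (by omega), k7 j hj]

end Run

/-! ### The complete program -/

/-- The main command. -/
def annotate (fC fI fG : ℕ) : Cmd := prog [
  setup fC, incidences fI, eliminations fG, select, compose,
  .call fC (adr 11 0) outputLength 0 outputLength]

/-- The size of the matrices. -/
def paddedSize (n : ℕ) : ℕ := 2 ^ Nat.clog 2 n

theorem le_paddedSize (n : ℕ) : n ≤ paddedSize n := Nat.le_pow_clog (by norm_num) n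

theorem paddedSize_le {n : ℕ} (hn : 1 ≤ n) : paddedSize n ≤ 2 * n := by
  unfold paddedSize
  rcases Nat.eq_zero_or_pos (Nat.clog 2 n) with h | h
  · rw [h]; omega
  · have := (Nat.lt_clog_iff_pow_lt (b := 2) (by norm_num) (x := n)).mp (Nat.sub_lt h one_pos)
    have e : 2 ^ Nat.clog 2 n = 2 ^ (Nat.clog 2 n - 1) * 2 := by
      rw [← pow_succ, Nat.sub_add_cancel h]
    omega

/-- The size of the slots. -/
def slotSize (n : ℕ) : ℕ := 16 * ((n + 8) * (n + 8))

/-- A time bound for `annotate`. -/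
def annotateTime (TM card : ℕ → ℕ) (n p : ℕ) : ℕ :=
  incidenceTime n card (paddedSize n) p + incidenceTime n card (paddedSize n) (p + 1) +
    2 * gaussJordanTime TM (Nat.clog 2 n) + 20000 * (paddedSize n * paddedSize n) +
    20000 * paddedSize n + 200000

namespace Run

variable {m off card : ℕ → ℕ} {vert : ℕ → ℕ → ℕ} {n p f fB fR fC fI fG : ℕ} {TM : ℕ → ℕ}

/-- The predicate `Q` separates machine and mathematics: the execution delivers Gauss–Jordan forms,
and `hQ` has to supply, for any such forms, the sequence of words that is to be written together
with whatever is claimed about it. -/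
theorem annotate (hf : MulProc R f (paddedSize n) TM) (hC : R.procs[fC]? = some .skip)
    (hfB : R.procs[fB]? = some (_root_.bmul f)) (hfR : R.procs[fR]? = some (_root_.rref fB fR))
    (hG : R.procs[fG]? = some (_root_.gaussJordan fR))
    (hI : R.procs[fI]? = some _root_.incidenceCmd) (m0 : m 0 = p) (m1 : m 1 = n) (hn : 1 ≤ n)
    (hp : p + 1 ≤ R.X) (hSX : slotSize n ≤ R.X)
    (hst : ∀ m', (∀ j < n * n + n + 2, slot (slotSize n) m' 0 j = m j) →
      Stored (slotSize n) n m' off card vert)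
    (hoff : ∀ i < n, off i + 1 + card i ≤ n * n + n + 2) (hcard : ∀ i < n, card i ≤ n)
    {Q : ℕ → (ℕ → ℕ) → Prop}
    (hQ : ∀ X X' pl ql hb,
      GaussJordan (paddedSize n) (incidence n card vert p) X →
      GaussJordan (paddedSize n) (extend (ofCard n card (p + 1)).length
        (ofCard n card (p + 2)).length (incidence n card vert (p + 1)) X) X' →
      pl = diag 0 (ofCard n card (p + 1)).length X 1 →
      ql = diag 0 (ofCard n card (p + 1)).length X 0 →
      hb = diag (ofCard n card (p + 2)).length (ofCard n card (p + 1)).length X' 1 →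
      ∃ w, Result (ofCard n card (p + 1)).length (ofCard n card (p + 2)).length X
          (extend (ofCard n card (p + 1)).length (ofCard n card (p + 2)).length
            (incidence n card vert (p + 1)) X) X' pl ql hb w ∧
        (∀ i, w i ≤ R.X) ∧ Q (3 + pl.length + ql.length + pl.length * ql.length +
          hb.length * (ofCard n card (p + 1)).length +
          (ofCard n card (p + 1)).length * hb.length) w) :
    Run R (annotate fC fI fG) m (annotateTime TM card n p)
      (fun m' => ∃ w len, Q len w ∧ ∀ i < len, m' i = w i) := by
  have hnN := le_paddedSize n
  have hNn := paddedSize_le hn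
  have hlen := length_ofCard_add_le n card (p + 1)
  have hNN : paddedSize n * paddedSize n ≤ 2 * n * (2 * n) := Nat.mul_le_mul hNn hNn
  have hnn : n * n ≤ paddedSize n * paddedSize n := Nat.mul_le_mul hnN hnN
  have hS : slotSize n = 16 * (n * n) + 256 * n + 1024 := by unfold slotSize; ring
  have hNS : 3 * (paddedSize n * paddedSize n) + paddedSize n + 200 ≤ slotSize n := by
    have e : 2 * n * (2 * n) = 4 * (n * n) := by ring
    omega
  have hT : annotateTime TM card n p = incidenceTime n card (paddedSize n) p +
    incidenceTime n card (paddedSize n) (p + 1) + 2 * gaussJordanTime TM (Nat.clog 2 n) +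
    20000 * (paddedSize n * paddedSize n) + 20000 * paddedSize n + 200000 := rfl
  have hN : paddedSize n = 2 ^ Nat.clog 2 n := rfl
  generalize hn₁ : (ofCard n card (p + 1)).length = n₁ at *
  rw [show p + 1 + 1 = p + 2 from rfl] at hlen
  generalize annotateTime TM card n p = T at *
  refine Run.cons (Run.setup hC m1 hn hSX) (by omega) fun ma T1 hT1 ⟨a0, a1, a2, a3, as⟩ => ?_
  rw [← hN] at a1
  generalize hN' : paddedSize n = N at *
  change ma 2 = slotSize n at a2
  change ∀ j < n * n + n + 2, slot (slotSize n) ma 0 j = m j at as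
  refine Run.cons (Run.incidences hI hnN hNS (by omega) (a0.trans m0) a1 a2 a3 hp (hst ma as) hoff
    fun i hi => (hcard i hi).trans hnN) (by omega) fun mb T2 hT2 ⟨b1, b2, b4, b5, bD, bD'⟩ => ?_
  rw [hn₁] at b4
  generalize (ofCard n card (p + 2)).length = n₂ at *
  refine Run.cons (Run.eliminations hf hfB hfR hG hN (by omega) hNS b1 b2 b4 b5 bD bD')
    (by omega) fun mc T3 hT3 ⟨X, X', hGJ, hGJ', c1, c2, c4, c5, h5, h6, h7⟩ => ?_
  obtain ⟨w, hw, hwX, hQw⟩ := hQ X X' _ _ _ hGJ hGJ' rfl rfl rfl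
  have l1 := length_diag_add n₁ X
  have l2 := length_diag_le n₂ n₁ X' 1
  refine Run.cons (Run.select c1 c2 c4 c5 hNS (by omega) h5 h6 h7) (by omega)
    fun md T4 hT4 ⟨d1, d2, d4, d5, d6, d7, d8, h5, h6, h7, s8, s9, s10⟩ => ?_
  have p1 := fun a => getD_diag (c := 0) (n := n₁) (a := a) (X := X) (v := 1)
  have p2 := fun a => getD_diag (c := 0) (n := n₁) (a := a) (X := X) (v := 0)
  have p3 := fun a => getD_diag (c := n₂) (n := n₁) (a := a) (X := X') (v := 1)
  have hrs : (diag 0 n₁ X 1).length * (diag 0 n₁ X 0).length ≤ N * N :=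
    Nat.mul_le_mul (by omega) (by omega)
  have hg1 : (diag n₂ n₁ X' 1).length * n₁ ≤ N * N := Nat.mul_le_mul (by omega) (by omega)
  have hg2 : n₁ * (diag n₂ n₁ X' 1).length ≤ N * N := Nat.mul_le_mul (by omega) (by omega)
  have key := Run.compose (S := slotSize n) hw rfl rfl rfl d1 d2 d4 d5 d6 d7 d8 (by omega) hNS
    (by omega) (fun i _ => hwX i) (fun a h => (p1 a h).1) (fun a h => (p2 a h).1)
    (fun a h => (p3 a h).1) h5 h6 h7 s8 s9 s10
  generalize hL : 3 + (diag 0 n₁ X 1).length + (diag 0 n₁ X 0).length +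
    (diag 0 n₁ X 1).length * (diag 0 n₁ X 0).length +
    (diag n₂ n₁ X' 1).length * n₁ + n₁ * (diag n₂ n₁ X' 1).length = L at *
  refine Run.cons key (by omega) fun me T5 hT5 he => ?_
  have hol : outputLength.eval me = L := by
    simp only [outputLength, eval_add, eval_mul, eval_reg, eval_ofNat, he.reg 4 (by norm_num),
      he.reg 6 (by norm_num), he.reg 7 (by norm_num), he.reg 8 (by norm_num), d4, d6, d7, d8]
    exact hL
  -- A block copy moves the output to the address 0. It overwrites the registers, whose values,
  -- including the length, have been read before.
  refine Run.cons (Run.call_run (T := 1) (Q' := fun m' => m' = _) hC (by decide) (by decide)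
    (by decide) (by decide) fun hm => ⟨_, _, .skip _, le_rfl, hm, rfl⟩)
    (by rw [hol]; omega) fun mf T6 hT6 hf => Run.nil (by rw [hol] at hT6; omega) ⟨w, L, hQw, ?_⟩
  obtain ⟨mc, rfl, rfl⟩ := hf
  intro i hi
  rw [hol]
  beta_reduce
  rw [eval_ofNat, if_pos (by omega), if_pos (by omega), ← he.out i hi, eval_adr,
    he.reg 2 (by norm_num), d2]
  rfl

end Run

/-! ### Linear algebra over `ℤ/2` -/

open Matrix

/-- `Y` is the reduced row echelon form of `A` with its rows arranged such that the pivots are on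
the diagonal. -/
structure Echelon {ι : Type*} {n : ℕ} (A : Matrix ι (Fin n) (ZMod 2))
    (Y : Matrix (Fin n) (Fin n) (ZMod 2)) : Prop where
  ker : ∀ x, A *ᵥ x = 0 ↔ Y *ᵥ x = 0
  le : ∀ i j, Y i j ≠ 0 → i ≤ j
  unit : ∀ i j, Y j j ≠ 0 → Y i j = if i = j then 1 else 0
  row : ∀ i, Y i i = 0 → ∀ j, Y i j = 0

theorem ZMod.two_eq_one_of_ne_zero {x : ZMod 2} (hx : x ≠ 0) : x = 1 := by
  revert x; decide

namespace Echelon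

variable {ι : Type*} {n : ℕ} {A : Matrix ι (Fin n) (ZMod 2)}
  {Y : Matrix (Fin n) (Fin n) (ZMod 2)} (h : Echelon A Y)
include h

/-- A nonzero row of `Y` has a one on the diagonal and zeros in the other pivot columns, while the
rows of `Y` at non-pivots vanish; only one summand survives. -/
theorem mul_self : Y * Y = Y := by
  ext i j
  rw [mul_apply]
  by_cases hi : Y i i = 0
  · simp [h.row i hi]
  · rw [Finset.sum_eq_single i, ZMod.two_eq_one_of_ne_zero hi, one_mul]
    · intro t _ ht
      by_cases htt : Y t t = 0
      · rw [h.row t htt, mul_zero]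
      · rw [h.unit i t htt, if_neg ht.symm, zero_mul]
    · simp

/-- By idempotence the columns of `1 - Y` lie in the kernel of `Y`, which is that of `A`. -/
theorem mul_eq_self : A * Y = A := by
  have h1 : ∀ j, A *ᵥ (1 - Y).col j = 0 := fun j => by
    rw [h.ker]
    have : (Y * (1 - Y)).col j = 0 := by rw [mul_sub, mul_one, h.mul_self, sub_self]; rfl
    rw [← this]
    rfl
  have h2 : A * (1 - Y) = 0 := by
    ext i j
    exact congrFun (h1 j) i
  rw [Matrix.mul_sub, Matrix.mul_one] at h2
  exact (sub_eq_zero.mp h2).symm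

theorem one_sub_mulVec {x : Fin n → ZMod 2} (hx : A *ᵥ x = 0) : (1 - Y) *ᵥ x = x := by
  rw [sub_mulVec, one_mulVec, (h.ker x).mp hx, sub_zero]

theorem one_sub_col {j : Fin n} (hj : Y j j ≠ 0) (i : Fin n) : (1 - Y) i j = 0 := by
  rw [Matrix.sub_apply, h.unit i j hj, one_apply, sub_self]

/-- A column is a combination of the columns of the pivots. -/
theorem apply_eq_sum (i : ι) (j : Fin n) :
    A i j = ∑ t with Y t t = 1, A i t * Y t j := by
  conv_lhs => rw [← h.mul_eq_self]
  rw [mul_apply, Finset.sum_filter]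
  refine Finset.sum_congr rfl fun t _ => ?_
  split_ifs with ht
  · rfl
  · rw [h.row t (by by_contra h0; exact ht (ZMod.two_eq_one_of_ne_zero h0)), mul_zero]

theorem pivot_iff (i : Fin n) :
    Y i i = 1 ↔ A.col i ∉ Submodule.span (ZMod 2) (A.col '' {j | j < i}) := by
  constructor
  · intro hi hmem
    have hS : ({j | j < i} : Set (Fin n)) = ↑(Finset.univ.filter (· < i)) := by ext; simp
    rw [hS, Submodule.mem_span_image_finset_iff_exists_fun'] at hmem
    obtain ⟨c, hc⟩ := hmem
    -- A dependence of the column `i` on earlier columns is a kernel vector supported in `j ≤ i`.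
    -- Row `i` of the triangular matrix `Y` sees only its entry in the place `i`, which is `-1`.
    have hker : A *ᵥ (fun j => (if j < i then c j else 0) - if j = i then 1 else 0) = 0 := by
      ext k
      have hk := congrFun hc k
      simp only [Finset.sum_apply, Pi.smul_apply, smul_eq_mul, col_apply, Finset.sum_filter] at hk
      simp only [mulVec, dotProduct, mul_sub, Finset.sum_sub_distrib, Pi.zero_apply]
      rw [sub_eq_zero]
      simpa [mul_comm] using hk
    have hi' := congrFun ((h.ker _).mp hker) i
    simp only [mulVec, dotProduct, mul_sub, Finset.sum_sub_distrib, Pi.zero_apply, mul_ite, mul_one,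
      mul_zero, Finset.sum_ite_eq', Finset.mem_univ, if_true] at hi'
    rw [Finset.sum_eq_zero, hi, zero_sub] at hi'
    · exact absurd hi' (by decide)
    · intro j _
      split_ifs with hj
      · rw [show Y i j = 0 by by_contra h0; exact absurd (h.le i j h0) (not_le.mpr hj), zero_mul]
      · rfl
  · intro hi
    by_contra hY
    refine hi ?_
    have h0 : Y i i = 0 := by
      by_contra h0
      exact hY (ZMod.two_eq_one_of_ne_zero h0)
    have : A.col i = ∑ t with Y t t = 1, Y t i • A.col t := by
      ext k
      simp only [Finset.sum_apply, Pi.smul_apply, smul_eq_mul, col_apply]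
      rw [h.apply_eq_sum k i]
      exact Finset.sum_congr rfl fun t _ => mul_comm _ _
    rw [this]
    -- A coefficient `Y t i ≠ 0` forces `t ≤ i`, and `t = i` is excluded by `Y i i = 0`.
    refine Submodule.sum_mem _ fun t ht => ?_
    by_cases hti : Y t i = 0
    · rw [hti, zero_smul]; exact Submodule.zero_mem _
    · refine Submodule.smul_mem _ _ (Submodule.subset_span ⟨t, lt_of_le_of_ne (h.le _ _ hti) ?_, rfl⟩)
      rintro rfl
      exact hti h0

end Echelon

/-! ### Correctness of the annotation -/

/-- The columns of `B` followed by those of `1 - Y`. -/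
def appendColumns {n₁ n₂ : ℕ} (B : Matrix (Fin n₁) (Fin n₂) (ZMod 2))
    (Y : Matrix (Fin n₁) (Fin n₁) (ZMod 2)) : Matrix (Fin n₁) (Fin (n₂ + n₁)) (ZMod 2) :=
  Matrix.of fun i => Fin.addCases (B i) ((1 - Y) i)

namespace Listing

variable {v : ℕ} {K : AbstractSimplicialComplex (Fin v)} (l : Listing K)

/-- The boundary matrix with numbered columns. -/
noncomputable def columnMatrix (p : ℕ) : Matrix (Face K p) (Fin (l.count (p + 1))) (ZMod 2) :=
  (boundaryMatrix K p).submatrix id (l.enum (p + 1))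

/-- The boundary matrix with numbered rows and columns. -/
noncomputable def numberedMatrix (p : ℕ) :
    Matrix (Fin (l.count p)) (Fin (l.count (p + 1))) (ZMod 2) :=
  (boundaryMatrix K p).submatrix (l.enum p) (l.enum (p + 1))

variable {l} {p : ℕ}

theorem mem_cycles_iff {z : Chain K p} :
    z ∈ cycles K p ↔ l.columnMatrix p *ᵥ (fun j => z (l.enum (p + 1) j)) = 0 := by
  have : l.columnMatrix p *ᵥ (fun j => z (l.enum (p + 1) j)) = boundaryMatrix K p *ᵥ z := by
    ext i
    simp only [columnMatrix, mulVec, dotProduct, submatrix_apply, id]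
    exact Equiv.sum_comp (l.enum (p + 1)) fun σ => boundaryMatrix K p i σ * z σ
  rw [this, cycles, LinearMap.mem_ker, mulVecLin_apply]

theorem mem_boundaries_iff {z : Chain K p} : z ∈ boundaries K p ↔
    ∃ y, l.numberedMatrix (p + 1) *ᵥ y = fun j => z (l.enum (p + 1) j) := by
  have key : ∀ y : Chain K (p + 1), ∀ j,
      (l.numberedMatrix (p + 1) *ᵥ fun i => y (l.enum (p + 2) i)) j =
      (boundaryMatrix K (p + 1) *ᵥ y) (l.enum (p + 1) j) := fun y j => by
    simp only [numberedMatrix, mulVec, dotProduct, submatrix_apply]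
    exact Equiv.sum_comp (l.enum (p + 2)) fun σ => boundaryMatrix K (p + 1) (l.enum (p + 1) j) σ * y σ
  rw [boundaries, LinearMap.mem_range]
  simp only [mulVecLin_apply]
  constructor
  · rintro ⟨y, rfl⟩
    exact ⟨_, funext fun j => key y j⟩
  · rintro ⟨y, hy⟩
    refine ⟨fun σ => y ((l.enum (p + 2)).symm σ), funext fun σ => ?_⟩
    have := key (fun σ => y ((l.enum (p + 2)).symm σ)) ((l.enum (p + 1)).symm σ)
    simp only [Equiv.symm_apply_apply, Equiv.apply_symm_apply] at this
    rw [← this, hy]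
    exact congrArg z (Equiv.apply_symm_apply _ _)

end Listing

namespace AnnotationOutput

variable {v : ℕ} {K : AbstractSimplicialComplex (Fin v)} {l : Listing K} {p : ℕ}

/-- The output is read off from the Gauss–Jordan forms `Y` and `Y'`, and `η` are the pivots of `Y'`
that belong to cycles. -/
structure ReadOff (o : AnnotationOutput (l.count (p + 1)))
    (Y : Matrix (Fin (l.count (p + 1))) (Fin (l.count (p + 1))) (ZMod 2))
    (Y' : Matrix (Fin (l.count (p + 2) + l.count (p + 1))) (Fin (l.count (p + 2) + l.count (p + 1)))
      (ZMod 2)) (η : Fin o.g → Fin (l.count (p + 1))) : Prop where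
  echelon : Echelon (l.columnMatrix p) Y
  echelon' : Echelon (appendColumns (l.numberedMatrix (p + 1)) Y) Y'
  mono : StrictMono fun a => o.order (.inl a)
  pivot : ∀ a, Y (o.order (.inl a)) (o.order (.inl a)) = 1
  free : ∀ b, Y (o.order (.inr b)) (o.order (.inr b)) = 0
  relation : ∀ a b, o.R a b = Y (o.order (.inl a)) (o.order (.inr b))
  inj : Function.Injective η
  pivot_iff : ∀ b, Y' (Fin.natAdd _ b) (Fin.natAdd _ b) = 1 ↔ ∃ i, η i = b
  chain : ∀ i b, o.hom i b = (1 - Y) b (η i)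
  vector : ∀ b i, o.ann b i = Y' (Fin.natAdd _ (η i)) (Fin.natAdd _ b)

namespace ReadOff

variable {o : AnnotationOutput (l.count (p + 1))}
  {Y : Matrix (Fin (l.count (p + 1))) (Fin (l.count (p + 1))) (ZMod 2)}
  {Y' : Matrix (Fin (l.count (p + 2) + l.count (p + 1))) (Fin (l.count (p + 2) + l.count (p + 1)))
    (ZMod 2)} {η : Fin o.g → Fin (l.count (p + 1))} (h : ReadOff o Y Y' η)

include h

theorem sum_pivots {M : Type*} [AddCommMonoid M] (f : Fin (l.count (p + 1)) → M) :
    ∑ t with Y t t = 1, f t = ∑ a, f (o.order (.inl a)) := by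
  rw [Finset.sum_filter, ← Equiv.sum_comp o.order, Fintype.sum_sum_type]
  simp [h.pivot, h.free]

theorem exists_inl_iff (i : Fin (l.count (p + 1))) : (∃ a, o.order (.inl a) = i) ↔ Y i i = 1 := by
  constructor
  · rintro ⟨a, rfl⟩
    exact h.pivot a
  · intro hi
    obtain ⟨x, rfl⟩ := o.order.surjective i
    rcases x with a | b
    · exact ⟨a, rfl⟩
    · rw [h.free] at hi
      exact absurd hi (by decide)

theorem earliestBasis : o.EarliestBasis :=
  ⟨h.mono, fun i => by rw [h.exists_inl_iff, h.echelon.pivot_iff]; rfl⟩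

theorem decomposition : o.Decomposition := by
  refine ⟨h.earliestBasis, ?_⟩
  ext τ x
  rcases x with a | b
  · rw [mul_apply, Finset.sum_eq_single a]
    · simp [firstColumns]
    · intro c _ hc
      simp [fromCols, one_apply_ne hc]
    · simp
  · rw [mul_apply]
    have := h.echelon.apply_eq_sum τ (o.order (.inr b))
    rw [h.sum_pivots fun t => l.columnMatrix p τ t * Y t (o.order (.inr b))] at this
    refine this.trans (Finset.sum_congr rfl fun a _ => ?_)
    rw [← h.relation]
    rfl

/-- The cycle given by a column of `1 - Y`. -/
noncomputable def columnCycle (h : ReadOff o Y Y' η) (j : Fin (l.count (p + 1))) : cycles K p :=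
  ⟨fun σ => (1 - Y) ((l.enum (p + 1)).symm σ) j, by
    rw [l.mem_cycles_iff]
    simp only [Equiv.symm_apply_apply]
    have : l.columnMatrix p * (1 - Y) = 0 := by
      rw [Matrix.mul_sub, h.echelon.mul_eq_self, Matrix.mul_one, sub_self]
    ext τ
    exact congrFun (congrFun this τ) j⟩

omit h

theorem columnCycle_apply (h : ReadOff o Y Y' η) (i j : Fin (l.count (p + 1))) :
    (h.columnCycle j : Chain K p) (l.enum (p + 1) i) = (1 - Y) i j := by
  change (1 - Y) ((l.enum (p + 1)).symm (l.enum (p + 1) i)) j = _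
  rw [Equiv.symm_apply_apply]

/-- Since these columns vanish, all columns of `1 - Y` can be carried along in the second
elimination without extracting the sentinel ones, and the indices of the simplices are kept. -/
theorem columnCycle_inl (h : ReadOff o Y Y' η) (a : Fin o.r) :
    h.columnCycle (o.order (.inl a)) = 0 := by
  ext σ
  obtain ⟨i, rfl⟩ := (l.enum (p + 1)).surjective σ
  rw [columnCycle_apply, h.echelon.one_sub_col (by rw [h.pivot]; decide)]
  rfl

/-- In pivot rows `1 - Y` has the entries `-R = R`; the other rows of `Y` are zero and leave the
identity. -/
theorem columnCycle_inr (h : ReadOff o Y Y' η) (b : Fin o.s) :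
    (h.columnCycle (o.order (.inr b)) : Chain K p) = o.sentinelCycle b := by
  ext σ
  obtain ⟨i, rfl⟩ := (l.enum (p + 1)).surjective σ
  obtain ⟨x, rfl⟩ := o.order.surjective i
  rw [columnCycle_apply, sentinelCycle, Equiv.symm_apply_apply, Equiv.symm_apply_apply,
    Matrix.sub_apply]
  rcases x with a | c
  · rw [one_apply_ne (by simp), zero_sub, CharTwo.neg_eq, ← h.relation]
    rfl
  · rw [h.echelon.row _ (h.free c), sub_zero, fromRows_apply_inr, one_apply, one_apply]
    simp

/-- A cycle is the sum of the cycles of its simplices. -/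
theorem eq_sum (h : ReadOff o Y Y' η) (z : cycles K p) :
    z = ∑ j, (z : Chain K p) (l.enum (p + 1) j) • h.columnCycle j := by
  ext σ
  obtain ⟨i, rfl⟩ := (l.enum (p + 1)).surjective σ
  have := congrFun (h.echelon.one_sub_mulVec ((l.mem_cycles_iff).mp z.2)) i
  rw [Submodule.coe_sum, Finset.sum_apply]
  simp only [Submodule.coe_smul, Pi.smul_apply, columnCycle_apply, smul_eq_mul]
  rw [← this, mulVec, dotProduct]
  exact Finset.sum_congr rfl fun j _ => mul_comm ((1 - Y) i j) _

theorem sentinelCycleBasis (h : ReadOff o Y Y' η) : o.SentinelCycleBasis := by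
  constructor
  · rw [Fintype.linearIndependent_iff]
    intro c hc b
    have := congrFun hc (o.simplex (.inr b))
    rw [Finset.sum_apply] at this
    simpa [sentinelCycle, simplex, one_apply] using this
  · apply le_antisymm
    · rw [Submodule.span_le]
      rintro _ ⟨b, rfl⟩
      rw [← h.columnCycle_inr b]
      exact Subtype.property _
    · intro z hz
      have := congrArg Subtype.val (h.eq_sum ⟨z, hz⟩)
      rw [Submodule.coe_sum] at this
      change z = _ at this
      rw [this]
      refine Submodule.sum_mem _ fun j _ => ?_
      obtain ⟨x, rfl⟩ := o.order.surjective j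
      rcases x with a | b
      · rw [h.columnCycle_inl, smul_zero]
        exact Submodule.zero_mem _
      · rw [Submodule.coe_smul, h.columnCycle_inr]
        exact Submodule.smul_mem _ _ (Submodule.subset_span ⟨b, rfl⟩)

theorem ann_inl (h : ReadOff o Y Y' η) (a : Fin o.r) : o.ann (o.order (.inl a)) = 0 := by
  ext i
  rw [h.vector]
  -- A zero column puts a unit vector into the kernel, and `Y'` has the same kernel, hence the same
  -- zero column.
  have h0 : appendColumns (l.numberedMatrix (p + 1)) Y *ᵥ
      Pi.single (Fin.natAdd _ (o.order (.inl a))) 1 = 0 := by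
    ext k
    rw [mulVec_single_one]
    simp only [col_apply, appendColumns, of_apply, Fin.addCases_right, Pi.zero_apply]
    exact h.echelon.one_sub_col (by rw [h.pivot]; decide) k
  have hi := congrFun ((h.echelon'.ker _).mp h0) (Fin.natAdd _ (η i))
  rwa [mulVec_single_one] at hi

theorem ann_eq (j : Fin (l.count (p + 1))) :
    o.ann j = o.annotation (l.enum (p + 1) j) := by
  rw [annotation, Equiv.symm_apply_apply]

theorem annotation_inl (h : ReadOff o Y Y' η) (a : Fin o.r) :
    o.annotation (o.simplex (.inl a)) = 0 := by
  rw [simplex, ← ann_eq, h.ann_inl]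

theorem homologyClass_eq_zero {z : cycles K p} :
    homologyClass z = 0 ↔ (z : Chain K p) ∈ boundaries K p := by
  rw [homologyClass, Submodule.Quotient.mk_eq_zero, Submodule.submoduleOf, Submodule.mem_comap]
  rfl

/-- This is the column `j` of `M Y' = M` for `M = [∂_{p+1} | 1 - Y]`: the left block contributes a
boundary, the right block the column cycles at pivots with coefficients from `Y'`. -/
theorem homologyClass_column (h : ReadOff o Y Y' η) (j : Fin (l.count (p + 1))) :
    homologyClass (h.columnCycle j) = ∑ i, o.ann j i • homologyClass (h.columnCycle (η i)) := by
  have hsum : ∑ i, o.ann j i • homologyClass (h.columnCycle (η i)) =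
      homologyClass (∑ i, o.ann j i • h.columnCycle (η i)) := by
    change _ = Submodule.mkQ _ _
    rw [map_sum]
    rfl
  rw [← sub_eq_zero, hsum]
  change homologyClass (h.columnCycle j - _) = 0
  rw [homologyClass_eq_zero, l.mem_boundaries_iff]
  refine ⟨fun t => Y' (Fin.castAdd _ t) (Fin.natAdd _ j), ?_⟩
  ext k
  have := congrFun (congrFun h.echelon'.mul_eq_self k) (Fin.natAdd _ j)
  rw [mul_apply, Fin.sum_univ_add] at this
  simp only [appendColumns, of_apply, Fin.addCases_right, Fin.addCases_left] at this
  rw [Submodule.coe_sub, Submodule.coe_sum, Pi.sub_apply, Finset.sum_apply, columnCycle_apply]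
  simp only [Submodule.coe_smul, Pi.smul_apply, columnCycle_apply, smul_eq_mul]
  rw [← this, eq_sub_iff_add_eq]
  congr 1
  -- Rows of `Y'` at non-pivots are zero, so the sum over the right block runs over the image of `η`
  -- only.
  rw [← Finset.sum_filter_of_ne (p := fun t => ∃ i, η i = t)]
  · rw [show Finset.univ.filter (fun t => ∃ i, η i = t) = Finset.univ.map ⟨η, h.inj⟩ by ext; simp,
      Finset.sum_map]
    exact Finset.sum_congr rfl fun i _ => by rw [h.vector, mul_comm]; rfl
  · intro t _ ht
    rw [← h.pivot_iff]
    by_contra hp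
    refine ht ?_
    rw [h.echelon'.row _ (by by_contra h0; exact hp (ZMod.two_eq_one_of_ne_zero h0)), mul_zero]

theorem linearIndependent (h : ReadOff o Y Y' η) :
    LinearIndependent (ZMod 2) fun i => homologyClass (h.columnCycle (η i)) := by
  rw [Fintype.linearIndependent_iff]
  intro c hc i
  have hsum : ∑ i, c i • homologyClass (h.columnCycle (η i)) =
      homologyClass (∑ i, c i • h.columnCycle (η i)) := by
    change _ = Submodule.mkQ _ _
    rw [map_sum]
    rfl
  rw [hsum, homologyClass_eq_zero, l.mem_boundaries_iff] at hc
  obtain ⟨y, hy⟩ := hc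
  -- If the combination with coefficients `c` is the boundary of `y`, then `(-y, c)`, with `c`
  -- placed at the pivots, is in the kernel of the extended matrix. The row `η i` of `Y'` will
  -- extract `c i` from it.
  have h0 : appendColumns (l.numberedMatrix (p + 1)) Y *ᵥ
      Fin.addCases (fun t => -y t) (fun b => ∑ i, if η i = b then c i else 0) = 0 := by
    ext k
    have hk := congrFun hy k
    rw [Submodule.coe_sum, Finset.sum_apply] at hk
    simp only [Submodule.coe_smul, Pi.smul_apply, columnCycle_apply, smul_eq_mul] at hk
    rw [mulVec, dotProduct, Fin.sum_univ_add]
    simp only [appendColumns, of_apply, Fin.addCases_right, Fin.addCases_left, Pi.zero_apply,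
      mul_neg, Finset.sum_neg_distrib]
    rw [neg_add_eq_zero]
    refine Eq.trans hk ?_
    simp only [Finset.mul_sum]
    rw [Finset.sum_comm]
    exact Finset.sum_congr rfl fun i _ => by simp [mul_comm]
  have hi := congrFun ((h.echelon'.ker _).mp h0) (Fin.natAdd _ (η i))
  rw [mulVec, dotProduct, Fin.sum_univ_add] at hi
  simp only [Fin.addCases_right, Fin.addCases_left, Pi.zero_apply] at hi
  rw [Finset.sum_eq_zero, zero_add] at hi
  · simp only [Finset.mul_sum] at hi
    rw [Finset.sum_comm] at hi
    simp only [mul_ite, mul_zero, Finset.sum_ite_eq, Finset.mem_univ, if_true] at hi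
    rw [← hi]
    symm
    rw [Finset.sum_eq_single i]
    · rw [(h.pivot_iff (η i)).mpr ⟨i, rfl⟩, one_mul]
    · intro k _ hk
      rw [h.echelon'.unit _ _ (by rw [(h.pivot_iff (η k)).mpr ⟨k, rfl⟩]; decide), if_neg, zero_mul]
      intro heq
      exact hk (h.inj (Fin.natAdd_injective _ _ heq)).symm
    · simp
  · intro t _
    -- The left block lies below the diagonal in a row of the right block, so `y` does not
    -- contribute.
    rw [show Y' (Fin.natAdd _ (η i)) (Fin.castAdd _ t) = 0 by
      by_contra hne
      have := Fin.le_def.mp (h.echelon'.le _ _ hne)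
      simp at this
      omega, zero_mul]

theorem sumOver_apply (f : Face K (p + 1) → Fin o.g → ZMod 2) (z : Chain K p) (i : Fin o.g) :
    sumOver f z i = ∑ j, z (l.enum (p + 1) j) * f (l.enum (p + 1) j) i := by
  rw [sumOver, Finset.sum_apply, Finset.sum_filter, ← Equiv.sum_comp (l.enum (p + 1))]
  refine Finset.sum_congr rfl fun j _ => ?_
  split_ifs with hz
  · rw [ZMod.two_eq_one_of_ne_zero hz, one_mul]
  · rw [not_not.mp hz, zero_mul]

theorem homologyClass_eq_sum (h : ReadOff o Y Y' η) (z : cycles K p) :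
    homologyClass z = ∑ i, (∑ j, (z : Chain K p) (l.enum (p + 1) j) * o.ann j i) •
      homologyClass (h.columnCycle (η i)) := by
  have h1 : homologyClass z = ∑ j, (z : Chain K p) (l.enum (p + 1) j) •
      homologyClass (h.columnCycle j) := by
    conv_lhs => rw [h.eq_sum z]
    change Submodule.mkQ _ _ = _
    rw [map_sum]
    rfl
  rw [h1]
  simp only [Finset.sum_smul]
  rw [Finset.sum_comm]
  refine Finset.sum_congr rfl fun j _ => ?_
  rw [h.homologyClass_column, Finset.smul_sum]
  exact Finset.sum_congr rfl fun i _ => (mul_smul _ _ _).symm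

/-- The basis of the homology group. -/
noncomputable def basis (h : ReadOff o Y Y' η) :
    Module.Basis (Fin o.g) (ZMod 2) (Homology K p) :=
  Module.Basis.mk h.linearIndependent fun x _ => by
    obtain ⟨z, rfl⟩ := Submodule.mkQ_surjective _ x
    change homologyClass z ∈ _
    rw [h.homologyClass_eq_sum]
    exact Submodule.sum_mem _ fun i _ => Submodule.smul_mem _ _ (Submodule.subset_span ⟨i, rfl⟩)

theorem basis_apply (h : ReadOff o Y Y' η) (i : Fin o.g) :
    h.basis i = homologyClass (h.columnCycle (η i)) := Module.Basis.mk_apply _ _ i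

theorem sumOver_eq (h : ReadOff o Y Y' η) (z : cycles K p) :
    sumOver o.annotation z = h.basis.equivFun (homologyClass z) := by
  rw [← LinearEquiv.symm_apply_eq, Module.Basis.equivFun_symm_apply, h.homologyClass_eq_sum]
  simp only [basis_apply, @sumOver_apply _ _ l, ← ann_eq]

theorem isAnnotation (h : ReadOff o Y Y' η) : IsAnnotation o.annotation := by
  refine ⟨?_, fun z z' => ?_⟩
  · rw [Module.finrank_eq_card_basis h.basis, Fintype.card_fin]
  · rw [h.sumOver_eq, h.sumOver_eq, h.basis.equivFun.injective.eq_iff]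

theorem annotation_inr (h : ReadOff o Y Y' η) (b : Fin o.s) {z : cycles K p}
    (hz : (z : Chain K p) = o.sentinelCycle b) :
    o.annotation (o.simplex (.inr b)) = h.basis.equivFun (homologyClass z) := by
  have : z = h.columnCycle (o.order (.inr b)) := Subtype.ext (hz.trans (h.columnCycle_inr b).symm)
  rw [this, ← LinearEquiv.symm_apply_eq, Module.Basis.equivFun_symm_apply, h.homologyClass_column]
  simp only [basis_apply, simplex, ← ann_eq]

theorem columnCycle_hom (h : ReadOff o Y Y' η) (i : Fin o.g) :
    (h.columnCycle (η i) : Chain K p) = o.homChain i := by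
  ext σ
  rw [homChain, h.chain]
  rfl

end ReadOff

end AnnotationOutput

/-! ### The input -/

theorem sum_range_mul_eq {M : Type*} [AddCommMonoid M] (f : ℕ → ℕ → M) (a b : ℕ) :
    ∑ z ∈ Finset.range (a * b), f (z / b) (z % b) =
      ∑ x ∈ Finset.range a, ∑ y ∈ Finset.range b, f x y := by
  induction a with
  | zero => simp
  | succ a ih =>
    rw [Nat.succ_mul, Finset.sum_range_add, ih, Finset.sum_range_succ]
    congr 1
    refine Finset.sum_congr rfl fun y hy => ?_
    have := Finset.mem_range.mp hy
    rw [mul_add_div' this, mul_add_mod' this]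

theorem List.getD_append_add {α : Type*} (u w : List α) (d : α) (i : ℕ) :
    (u ++ w).getD (u.length + i) d = w.getD i d := by
  rw [List.getD_append_right _ _ _ _ (by omega), Nat.add_sub_cancel_left]

/-- The vertices of a simplex in increasing order. -/
def vertexList {v : ℕ} (s : Finset (Fin v)) : List ℕ := (s.sort (· ≤ ·)).map Fin.val

theorem length_vertexList {v : ℕ} (s : Finset (Fin v)) : (vertexList s).length = s.card := by
  simp [vertexList]

theorem nodup_vertexList {v : ℕ} (s : Finset (Fin v)) : (vertexList s).Nodup :=
  (Finset.sort_nodup _ _).map Fin.val_injective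

theorem vertexList_subset_iff {v : ℕ} (s t : Finset (Fin v)) :
    (∀ x ∈ vertexList s, x ∈ vertexList t) ↔ s ⊆ t := by
  simp only [vertexList, List.mem_map, Finset.mem_sort]
  constructor
  · intro h x hx
    obtain ⟨y, hy, hxy⟩ := h x ⟨x, hx, rfl⟩
    rwa [Fin.val_injective hxy] at hy
  · rintro h _ ⟨x, hx, rfl⟩
    exact ⟨x, h hx, rfl⟩

/-- As `w` has no repetitions, each entry of `u` agrees with at most one entry of `w`. The total
thus counts the positions of `u` whose entry occurs in `w`. -/
theorem agreements_eq_iff {k : ℕ} {u w : List ℕ} (hu : u.length = k) (hw : w.length = k + 1)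
    (hnd : w.Nodup) : agreements k (fun x => u.getD x 0) (fun y => w.getD y 0) = k ↔
      ∀ x ∈ u, x ∈ w := by
  have h1 : ∀ a, (∑ y ∈ Finset.range (k + 1), if a = w.getD y 0 then 1 else 0) =
      if a ∈ w then 1 else 0 := fun a => by
    split_ifs with ha
    · obtain ⟨y, hy, rfl⟩ := List.getElem_of_mem ha
      rw [Finset.sum_eq_single y]
      · rw [if_pos (List.getD_eq_getElem _ _ hy).symm]
      · intro z hz hzy
        have hz' : z < w.length := by have := Finset.mem_range.mp hz; omega
        rw [List.getD_eq_getElem _ _ hz', if_neg]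
        intro he
        exact hzy ((hnd.getElem_inj_iff).mp he).symm
      · intro h
        exact absurd (Finset.mem_range.mpr (by omega)) h
    · refine Finset.sum_eq_zero fun y hy => if_neg ?_
      have hy' : y < w.length := by have := Finset.mem_range.mp hy; omega
      rw [List.getD_eq_getElem _ _ hy']
      rintro rfl
      exact ha (List.getElem_mem hy')
  unfold agreements
  rw [sum_range_mul_eq fun x y => if u.getD x 0 = w.getD y 0 then 1 else 0]
  simp only [h1]
  rw [← Finset.card_filter]
  constructor
  · intro h x hx
    obtain ⟨i, hi, rfl⟩ := List.getElem_of_mem hx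
    have h2 : (Finset.range k).filter (fun x => u.getD x 0 ∈ w) = Finset.range k :=
      Finset.eq_of_subset_of_card_le (Finset.filter_subset _ _) (by rw [h, Finset.card_range])
    have := Finset.mem_range.mpr (hu ▸ hi)
    rw [← h2] at this
    replace this := (Finset.mem_filter.mp this).2
    rwa [List.getD_eq_getElem _ _ hi] at this
  · intro h
    rw [Finset.filter_true_of_mem, Finset.card_range]
    intro i hi
    have hi' : i < u.length := by rw [hu]; exact Finset.mem_range.mp hi
    rw [List.getD_eq_getElem _ _ hi']
    exact h _ (List.getElem_mem hi')

namespace Listing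

variable {v : ℕ} {K : AbstractSimplicialComplex (Fin v)} (l : Listing K)

/-- The number of vertices of a simplex. -/
def card (i : ℕ) : ℕ := (l.list.getD i ∅).card

/-- The vertices of a simplex. -/
def vert (i x : ℕ) : ℕ := (vertexList (l.list.getD i ∅)).getD x 0

/-- The address of a simplex in the input. -/
def off (i : ℕ) : ℕ := 2 + ∑ j ∈ Finset.range i, (1 + l.card j)

theorem off_succ (i : ℕ) : l.off (i + 1) = l.off i + 1 + l.card i := by
  rw [off, Finset.sum_range_succ, off]; omega

/-- Every vertex is a face here. This bounds vertex numbers and cardinalities by `n`, so the input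
has at most `n² + n + 2` words. -/
theorem le_size : v ≤ l.size := by
  have h1 : (Finset.univ.image fun x : Fin v => ({x} : Finset (Fin v))) ⊆ l.list.toFinset := by
    intro s hs
    obtain ⟨x, -, rfl⟩ := Finset.mem_image.mp hs
    rw [List.mem_toFinset, l.mem_iff]
    exact K.singleton_mem x
  have h2 := (Finset.card_le_card h1).trans (List.toFinset_card_le _)
  rwa [Finset.card_image_of_injective _ Finset.singleton_injective, Finset.card_univ,
    Fintype.card_fin] at h2

theorem card_le (i : ℕ) : l.card i ≤ l.size :=
  ((Finset.card_le_univ _).trans (Fintype.card_fin v).le).trans l.le_size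

theorem off_le {i : ℕ} (hi : i < l.size) :
    l.off i + 1 + l.card i ≤ l.size * l.size + l.size + 2 := by
  rw [← l.off_succ, off]
  have h1 : ∑ j ∈ Finset.range (i + 1), (1 + l.card j) ≤ (i + 1) * (1 + l.size) := by
    rw [← Finset.card_range (i + 1), ← smul_eq_mul, Finset.card_range]
    exact (Finset.sum_le_card_nsmul _ _ (1 + l.size) fun j _ =>
      Nat.add_le_add_left (l.card_le j) 1).trans (by rw [Finset.card_range])
  have h2 : (i + 1) * (1 + l.size) ≤ l.size * (1 + l.size) := Nat.mul_le_mul_right _ hi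
  have h3 : l.size * (1 + l.size) = l.size * l.size + l.size := by ring
  omega

theorem facesOfCard_eq (k : ℕ) :
    l.facesOfCard k = (ofCard l.size l.card k).map fun i => l.list.getD i ∅ := by
  have h : l.list = (List.range l.size).map fun i => l.list.getD i ∅ := by
    refine List.ext_getElem (by simp [size]) fun i h₁ h₂ => ?_
    rw [List.getElem_map, List.getElem_range, List.getD_eq_getElem _ _ h₁]
  unfold facesOfCard ofCard
  conv_lhs => rw [h]
  rw [List.filter_map]
  rfl

theorem length_ofCard (k : ℕ) : (ofCard l.size l.card k).length = l.count k := by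
  rw [count, facesOfCard_eq, List.length_map]

theorem enum_val (k : ℕ) (i : Fin (l.count k)) :
    (l.enum k i : Finset (Fin v)) = l.list.getD ((ofCard l.size l.card k).getD i 0) ∅ := by
  change (l.facesOfCard k)[(i : ℕ)] = _
  have hi : (i : ℕ) < (ofCard l.size l.card k).length := by rw [length_ofCard]; exact i.2
  simp only [facesOfCard_eq, List.getElem_map]
  rw [List.getD_eq_getElem _ _ hi]

theorem incidence_eq (k : ℕ) (i : Fin (l.count k)) (j : Fin (l.count (k + 1))) :
    incidence l.size l.card l.vert k i j = l.numberedMatrix k i j := by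
  have hi := (l.enum k i).2.2
  have hj := (l.enum (k + 1) j).2.2
  unfold incidence numberedMatrix
  rw [length_ofCard, length_ofCard, submatrix_apply, boundaryMatrix, of_apply]
  refine if_congr ?_ rfl rfl
  rw [enum_val] at hi hj
  rw [enum_val, enum_val, ← vertexList_subset_iff,
    ← agreements_eq_iff ((length_vertexList _).trans hi) ((length_vertexList _).trans hj)
      (nodup_vertexList _)]
  exact ⟨fun h => h.2.2, fun h => ⟨i.2, j.2, h⟩⟩

theorem incidence_eq_zero {k i j : ℕ} (h : ¬ (i < l.count k ∧ j < l.count (k + 1))) :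
    incidence l.size l.card l.vert k i j = 0 := by
  unfold incidence
  rw [length_ofCard, length_ofCard, if_neg]
  tauto

theorem input_eq (p : ℕ) : l.input p =
    p :: l.size :: (l.list.map fun s => s.card :: vertexList s).flatten := by
  unfold input vertexList
  simp only [List.bind_eq_flatMap, List.pure_def, List.map_id', ← List.map_eq_flatMap]
  rfl

theorem getD_input_zero (p : ℕ) : (l.input p).getD 0 0 = p := rfl

theorem getD_input_one (p : ℕ) : (l.input p).getD 1 0 = l.size := rfl

theorem getD_input_off (p : ℕ) {i x : ℕ} (hi : i < l.size) (hx : x < 1 + l.card i) :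
    (l.input p).getD (l.off i + x) 0 =
      (l.card i :: vertexList (l.list.getD i ∅)).getD x 0 := by
  have key : ∀ (L : List (Finset (Fin v))) (i : ℕ), i < L.length → x < 1 + (L.getD i ∅).card →
      ((L.map fun s => s.card :: vertexList s).flatten).getD
        (∑ j ∈ Finset.range i, (1 + (L.getD j ∅).card) + x) 0 =
      ((L.getD i ∅).card :: vertexList (L.getD i ∅)).getD x 0 := by
    intro L
    induction L with
    | nil => intro i hi; exact absurd hi (by simp)
    | cons s L ih =>
      intro i hi hx
      rw [List.map_cons, List.flatten_cons]
      cases i with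
      | zero =>
        rw [Finset.range_zero, Finset.sum_empty, zero_add, List.getD_append]
        · rfl
        · rw [List.length_cons, length_vertexList]
          simpa [add_comm] using hx
      | succ i =>
        rw [Finset.sum_range_succ']
        have := ih i (by simpa using hi) hx
        simp only [List.getD_cons_succ, List.getD_cons_zero]
        rw [show ∑ j ∈ Finset.range i, (1 + (L.getD j ∅).card) + (1 + s.card) + x =
          (s.card :: vertexList s).length + (∑ j ∈ Finset.range i, (1 + (L.getD j ∅).card) + x) by
            rw [List.length_cons, length_vertexList]; omega, List.getD_append_add, this]
  have := key l.list i hi hx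
  rw [off, show 2 + ∑ j ∈ Finset.range i, (1 + l.card j) + x =
    (∑ j ∈ Finset.range i, (1 + l.card j) + x) + 1 + 1 by omega, input_eq]
  exact this

theorem stored (p : ℕ) {S : ℕ} {m : ℕ → ℕ} (hS : l.size * l.size + l.size + 2 ≤ S)
    (hm : ∀ j < l.size * l.size + l.size + 2, slot S m 0 j = (l.input p).getD j 0) :
    Stored S l.size m l.off l.card l.vert where
  size := (hm 1 (by omega)).trans (l.getD_input_one p)
  off_zero := rfl
  off_succ := l.off_succ
  off_le i hi := (l.off_le hi).trans hS
  card_eq i hi := by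
    have := l.off_le hi
    rw [hm _ (by omega)]
    exact l.getD_input_off p (x := 0) hi (by omega)
  vert_eq i hi x hx := by
    have := l.off_le hi
    rw [hm _ (by omega), Nat.add_assoc, Nat.add_comm 1, l.getD_input_off p hi (by omega)]
    rfl

end Listing

/-! ### The output -/

theorem bitList_eq_ofFn {a b : ℕ} (A : Matrix (Fin a) (Fin b) (ZMod 2)) :
    bitList A = List.ofFn fun q : Fin (a * b) =>
      (A ⟨q / b, div_lt_of_lt_mul q.2⟩ ⟨q % b, mod_lt_of_lt_mul q.2⟩).val := by
  rw [List.ofFn_mul, bitList]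
  simp only [mul_add_div' (Fin.is_lt _), mul_add_mod' (Fin.is_lt _), Fin.eta]

theorem length_bitList {a b : ℕ} (A : Matrix (Fin a) (Fin b) (ZMod 2)) :
    (bitList A).length = a * b := by
  rw [bitList_eq_ofFn, List.length_ofFn]

theorem getD_ofFn {n : ℕ} (f : Fin n → ℕ) {i : ℕ} (hi : i < n) :
    (List.ofFn f).getD i 0 = f ⟨i, hi⟩ := by
  rw [List.getD_eq_getElem _ _ (by rwa [List.length_ofFn]), List.getElem_ofFn]

theorem getD_bitList {a b q : ℕ} (A : Matrix (Fin a) (Fin b) (ZMod 2)) (hq : q < a * b) :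
    (bitList A).getD q 0 = (A ⟨q / b, div_lt_of_lt_mul hq⟩ ⟨q % b, mod_lt_of_lt_mul hq⟩).val := by
  rw [bitList_eq_ofFn, getD_ofFn _ hq]

namespace AnnotationOutput

variable {N : ℕ} (o : AnnotationOutput N)

theorem toList_eq : o.toList = [o.r, o.s, o.g] ++ ((List.ofFn fun i => (o.order (.inl i) : ℕ)) ++
    ((List.ofFn fun j => (o.order (.inr j) : ℕ)) ++
      (bitList o.R ++ (bitList o.hom ++ bitList o.ann)))) := by
  simp only [toList, List.append_assoc]

theorem getD_ofFn_append {n : ℕ} (f : Fin n → ℕ) (L : List ℕ) (i : ℕ) :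
    (List.ofFn f ++ L).getD (n + i) 0 = L.getD i 0 := by
  have := List.getD_append_add (List.ofFn f) L 0 i
  rwa [List.length_ofFn] at this

theorem getD_bitList_append {a b : ℕ} (A : Matrix (Fin a) (Fin b) (ZMod 2)) (L : List ℕ) (i : ℕ) :
    (bitList A ++ L).getD (a * b + i) 0 = L.getD i 0 := by
  rw [← length_bitList A, List.getD_append_add]

theorem getD_toList_three_add (i : ℕ) : o.toList.getD (3 + i) 0 =
    ((List.ofFn fun i => (o.order (.inl i) : ℕ)) ++
      ((List.ofFn fun j => (o.order (.inr j) : ℕ)) ++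
        (bitList o.R ++ (bitList o.hom ++ bitList o.ann)))).getD i 0 := by
  rw [toList_eq]
  exact List.getD_append_add [o.r, o.s, o.g] _ 0 i

theorem getD_toList_first {a : ℕ} (h : a < o.r) :
    o.toList.getD (3 + a) 0 = o.order (.inl ⟨a, h⟩) := by
  rw [getD_toList_three_add, List.getD_append _ _ _ _ (by rwa [List.length_ofFn]), getD_ofFn _ h]

theorem getD_toList_last {a : ℕ} (h : a < o.s) :
    o.toList.getD (3 + o.r + a) 0 = o.order (.inr ⟨a, h⟩) := by
  rw [Nat.add_assoc, getD_toList_three_add, getD_ofFn_append,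
    List.getD_append _ _ _ _ (by rwa [List.length_ofFn]), getD_ofFn _ h]

theorem getD_toList_R {q : ℕ} (h : q < o.r * o.s) : o.toList.getD (3 + o.r + o.s + q) 0 =
    (o.R ⟨q / o.s, div_lt_of_lt_mul h⟩ ⟨q % o.s, mod_lt_of_lt_mul h⟩).val := by
  rw [Nat.add_assoc, Nat.add_assoc, getD_toList_three_add, getD_ofFn_append, getD_ofFn_append,
    List.getD_append _ _ _ _ (by rwa [length_bitList]), getD_bitList _ h]

theorem getD_toList_hom {q : ℕ} (h : q < o.g * N) :
    o.toList.getD (3 + o.r + o.s + o.r * o.s + q) 0 =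
      (o.hom ⟨q / N, div_lt_of_lt_mul h⟩ ⟨q % N, mod_lt_of_lt_mul h⟩).val := by
  rw [Nat.add_assoc, Nat.add_assoc, Nat.add_assoc, getD_toList_three_add, getD_ofFn_append,
    getD_ofFn_append, getD_bitList_append, List.getD_append _ _ _ _ (by rwa [length_bitList]),
    getD_bitList _ h]

theorem getD_toList_ann {q : ℕ} (h : q < N * o.g) :
    o.toList.getD (3 + o.r + o.s + o.r * o.s + o.g * N + q) 0 =
      (o.ann ⟨q / o.g, div_lt_of_lt_mul h⟩ ⟨q % o.g, mod_lt_of_lt_mul h⟩).val := by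
  rw [Nat.add_assoc, Nat.add_assoc, Nat.add_assoc, Nat.add_assoc, getD_toList_three_add,
    getD_ofFn_append, getD_ofFn_append, getD_bitList_append, getD_bitList_append,
    getD_bitList _ h]

end AnnotationOutput

/-- Removes the padding. A vector is extended by zeros, the additional rows of `D` are zero on the
first `n` columns, and so are those of `X`, by triangularity. -/
theorem GaussJordan.echelon {N a n : ℕ} {D X : ℕ → ℕ → ZMod 2} (h : GaussJordan N D X)
    (A : Matrix (Fin a) (Fin n) (ZMod 2)) (ha : a ≤ N) (hn : n ≤ N)
    (hA : ∀ (i : Fin a) (j : Fin n), D i j = A i j)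
    (h0 : ∀ i < N, ∀ j < N, ¬ (i < a ∧ j < n) → D i j = 0) :
    Echelon A (Matrix.of fun i j : Fin n => X i j) where
  ker x := by
    have key : ∀ f : ℕ → ZMod 2, ∑ j ∈ Finset.range N,
        f j * (if h : j < n then x ⟨j, h⟩ else 0) = ∑ j : Fin n, f j * x j := fun f => by
      rw [← Finset.sum_subset (Finset.range_subset_range.mpr hn), Finset.sum_range]
      · simp
      · intro j _ hj
        rw [dif_neg (by simpa using hj), mul_zero]
    have h1 := h.ker fun j => if h : j < n then x ⟨j, h⟩ else 0
    simp only [InKer, key] at h1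
    have e1 : A *ᵥ x = 0 ↔ ∀ i < N, ∑ j : Fin n, D i j * x j = 0 := by
      rw [funext_iff]
      constructor
      · intro hx i hi
        by_cases hia : i < a
        · have := hx ⟨i, hia⟩
          rw [Pi.zero_apply, mulVec, dotProduct] at this
          rw [← this]
          exact Finset.sum_congr rfl fun j _ => congrArg (· * x j) (hA ⟨i, hia⟩ j)
        · exact Finset.sum_eq_zero fun j _ => by
            rw [h0 i hi j (by omega) (by tauto), zero_mul]
      · intro hx i
        rw [Pi.zero_apply, ← hx i (by omega), mulVec, dotProduct]
        exact Finset.sum_congr rfl fun j _ => congrArg (· * x j) (hA i j).symm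
    rw [e1, h1, funext_iff]
    constructor
    · intro hx i
      exact hx i (by omega)
    · intro hx i hi
      by_cases hin : i < n
      · exact hx ⟨i, hin⟩
      · refine Finset.sum_eq_zero fun j _ => ?_
        rw [show X i j = 0 by by_contra hne; have := h.le i hi j (by omega) hne; omega, zero_mul]
  le i j hij := h.le i (by omega) j (by omega) hij
  unit i j hj := by
    rw [of_apply, h.unit i (by omega) j (by omega) hj]
    exact if_congr Fin.val_inj rfl rfl
  row i hi j := h.row i (by omega) hi j (by omega)

/-- The kernel does not depend on how the rows are numbered; only the order of the columns matters.
-/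
theorem Echelon.submatrix {ι κ : Type*} {n : ℕ} {A : Matrix ι (Fin n) (ZMod 2)}
    {Y : Matrix (Fin n) (Fin n) (ZMod 2)} (e : κ ≃ ι) (h : Echelon (A.submatrix e id) Y) :
    Echelon A Y where
  ker x := by
    rw [← h.ker, funext_iff, funext_iff, ← e.forall_congr_right]
    rfl
  le := h.le
  unit := h.unit
  row := h.row

theorem pairwise_diag (c n : ℕ) (X : ℕ → ℕ → ZMod 2) (v : ZMod 2) :
    (diag c n X v).Pairwise (· < ·) := List.pairwise_lt_range.filter _

/-- An entry of `diag`. -/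
def diagEntry (c n : ℕ) (X : ℕ → ℕ → ZMod 2) (v : ZMod 2) (a : Fin (diag c n X v).length) : Fin n :=
  ⟨(diag c n X v).getD a 0, (getD_diag a.2).1⟩

theorem diagEntry_spec {c n : ℕ} {X : ℕ → ℕ → ZMod 2} {v : ZMod 2}
    (a : Fin (diag c n X v).length) :
    X (c + diagEntry c n X v a) (c + diagEntry c n X v a) = v := (getD_diag a.2).2

theorem diagEntry_strictMono (c n : ℕ) (X : ℕ → ℕ → ZMod 2) (v : ZMod 2) :
    StrictMono (diagEntry c n X v) := fun a b hab => by
  have := List.pairwise_iff_getElem.mp (pairwise_diag c n X v) a b a.2 b.2 hab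
  rw [← List.getD_eq_getElem _ 0, ← List.getD_eq_getElem _ 0] at this
  exact this

theorem exists_diagEntry {c n : ℕ} {X : ℕ → ℕ → ZMod 2} {v : ZMod 2} {b : Fin n}
    (hb : X (c + b) (c + b) = v) : ∃ a, diagEntry c n X v a = b := by
  obtain ⟨a, ha, hab⟩ := List.getElem_of_mem (mem_diag.mpr ⟨b.2, hb⟩)
  refine ⟨⟨a, ha⟩, Fin.ext ?_⟩
  rw [← hab, ← List.getD_eq_getElem _ 0]
  rfl

/-- The permutation that puts the pivots first. -/
noncomputable def pivotOrder (n : ℕ) (X : ℕ → ℕ → ZMod 2) :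
    Fin (diag 0 n X 1).length ⊕ Fin (diag 0 n X 0).length ≃ Fin n :=
  Equiv.ofBijective (Sum.elim (diagEntry 0 n X 1) (diagEntry 0 n X 0)) <| by
    rw [Fintype.bijective_iff_injective_and_card]
    refine ⟨Function.Injective.sumElim (diagEntry_strictMono _ _ _ _).injective
      (diagEntry_strictMono _ _ _ _).injective fun a b hab => ?_, ?_⟩
    · have h1 := diagEntry_spec a
      rw [hab, diagEntry_spec b] at h1
      exact absurd h1 (by decide)
    · rw [Fintype.card_sum, Fintype.card_fin, Fintype.card_fin, Fintype.card_fin,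
        length_diag_add]

/-- The output given by the two Gauss–Jordan forms and the matrix `M`. -/
noncomputable def assemble (n₁ n₂ : ℕ) (X M X' : ℕ → ℕ → ZMod 2) : AnnotationOutput n₁ where
  r := (diag 0 n₁ X 1).length
  s := (diag 0 n₁ X 0).length
  g := (diag n₂ n₁ X' 1).length
  order := pivotOrder n₁ X
  R := Matrix.of fun a b => X (diagEntry 0 n₁ X 1 a) (diagEntry 0 n₁ X 0 b)
  hom := Matrix.of fun i b => M b (n₂ + diagEntry n₂ n₁ X' 1 i)
  ann := Matrix.of fun b i => X' (n₂ + diagEntry n₂ n₁ X' 1 i) (n₂ + b)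

section

variable (n₁ n₂ : ℕ) (X M X' : ℕ → ℕ → ZMod 2)

theorem result_assemble : Result n₁ n₂ X M X' (diag 0 n₁ X 1) (diag 0 n₁ X 0) (diag n₂ n₁ X' 1)
    fun i => (assemble n₁ n₂ X M X').toList.getD i 0 where
  rank := rfl
  nullity := rfl
  betti := rfl
  first _ h := (assemble n₁ n₂ X M X').getD_toList_first h
  last _ h := (assemble n₁ n₂ X M X').getD_toList_last h
  relation _ h := (assemble n₁ n₂ X M X').getD_toList_R h
  chain _ h := (assemble n₁ n₂ X M X').getD_toList_hom h
  vector _ h := (assemble n₁ n₂ X M X').getD_toList_ann h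

theorem length_toList_assemble : (assemble n₁ n₂ X M X').toList.length =
    3 + (diag 0 n₁ X 1).length + (diag 0 n₁ X 0).length +
      (diag 0 n₁ X 1).length * (diag 0 n₁ X 0).length + (diag n₂ n₁ X' 1).length * n₁ +
      n₁ * (diag n₂ n₁ X' 1).length := by
  simp only [AnnotationOutput.toList, List.length_append, List.length_ofFn, length_bitList]
  rfl

theorem getD_toList_assemble_le (i : ℕ) : (assemble n₁ n₂ X M X').toList.getD i 0 ≤ n₁ + 1 := by
  have h : ∀ x ∈ (assemble n₁ n₂ X M X').toList, x ≤ n₁ + 1 := by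
    intro x hx
    simp only [AnnotationOutput.toList, List.mem_append, bitList_eq_ofFn, List.mem_ofFn,
      List.mem_cons, List.not_mem_nil, or_false] at hx
    have l1 := length_diag_le 0 n₁ X 1
    have l2 := length_diag_le 0 n₁ X 0
    have l3 := length_diag_le n₂ n₁ X' 1
    rcases hx with (((((rfl | rfl | rfl) | ⟨_, rfl⟩) | ⟨_, rfl⟩) | ⟨_, rfl⟩) | ⟨_, rfl⟩) | ⟨_, rfl⟩
    · exact l1.trans (Nat.le_succ _)
    · exact l2.trans (Nat.le_succ _)
    · exact l3.trans (Nat.le_succ _)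
    · omega
    · omega
    all_goals exact (ZMod.val_two_le _).trans (by omega)
  by_cases hi : i < (assemble n₁ n₂ X M X').toList.length
  · rw [List.getD_eq_getElem _ _ hi]
    exact h _ (List.getElem_mem hi)
  · rw [List.getD_eq_default _ _ (by omega)]
    omega

end

theorem readOff_assemble {v N p : ℕ} {K : AbstractSimplicialComplex (Fin v)} (l : Listing K)
    (hN : l.size ≤ N) {X X' : ℕ → ℕ → ZMod 2}
    (hX : GaussJordan N (incidence l.size l.card l.vert p) X)
    (hX' : GaussJordan N (extend (l.count (p + 1)) (l.count (p + 2))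
      (incidence l.size l.card l.vert (p + 1)) X) X') :
    (assemble (l.count (p + 1)) (l.count (p + 2)) X (extend (l.count (p + 1)) (l.count (p + 2))
      (incidence l.size l.card l.vert (p + 1)) X) X').ReadOff
      (Matrix.of fun i j => X i j) (Matrix.of fun i j => X' i j)
      (diagEntry (l.count (p + 2)) (l.count (p + 1)) X' 1) := by
  have hc0 : l.count p ≤ l.size := by rw [← l.length_ofCard]; exact length_ofCard_le _ _ _
  have hc1 : l.count (p + 1) + l.count (p + 2) ≤ l.size := by
    rw [← l.length_ofCard, ← l.length_ofCard]
    exact length_ofCard_add_le _ _ _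
  have hpp : l.count (p + 1 + 1) = l.count (p + 2) := rfl
  have hM : ∀ i b : Fin (l.count (p + 1)), extend (l.count (p + 1)) (l.count (p + 2))
      (incidence l.size l.card l.vert (p + 1)) X i (l.count (p + 2) + b) =
      (1 - Matrix.of fun i j : Fin (l.count (p + 1)) => X i j) i b := fun i b => by
    unfold extend
    rw [l.incidence_eq_zero (by omega), if_pos ⟨by omega, by omega⟩, Nat.add_sub_cancel_left,
      zero_add, Matrix.sub_apply, CharTwo.sub_eq_add, add_comm, one_apply]
    simp only [Fin.val_inj]
    rfl
  refine ⟨Echelon.submatrix (l.enum p) (hX.echelon (l.numberedMatrix p) (by omega) (by omega)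
      (l.incidence_eq p) fun i _ j _ h => l.incidence_eq_zero h),
    hX'.echelon _ (by omega) (by omega) (fun i j => ?_) (fun i hi j hj h => ?_),
    diagEntry_strictMono 0 _ X 1, fun a => ?_, fun b => ?_, fun a b => rfl,
    (diagEntry_strictMono _ _ _ _).injective, fun b => ⟨fun hb => exists_diagEntry hb, ?_⟩,
    fun i b => hM _ _, fun b i => rfl⟩
  · induction j using Fin.addCases with
    | left j =>
      simp only [appendColumns, of_apply, Fin.addCases_left]
      rw [← l.incidence_eq (p + 1) i j]
      unfold extend
      rw [if_neg (by simp), add_zero]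
      rfl
    | right j =>
      simp only [appendColumns, of_apply, Fin.addCases_right]
      exact hM i j
  · unfold extend
    by_cases hi1 : i < l.count (p + 1)
    · rw [l.incidence_eq_zero (by omega), if_neg (by omega), add_zero]
    · rw [l.incidence_eq_zero (by omega), zero_add]
      split_ifs with h1 h2
      · omega
      · rw [add_zero]
        -- Below the first rows, the columns of `X + 1` are padding as well: `X` is triangular and
        -- the row index exceeds the column index.
        by_contra hne
        have := hX.le i hi _ (by omega) hne
        omega
      · rfl
  · have := diagEntry_spec (c := 0) (n := l.count (p + 1)) (X := X) (v := 1) a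
    rw [zero_add] at this
    exact this
  · have := diagEntry_spec (c := 0) (n := l.count (p + 1)) (X := X) (v := 0) b
    rw [zero_add] at this
    exact this
  · rintro ⟨i, rfl⟩
    exact diagEntry_spec i

/-! ### The program -/

/-- The annotation program, given a program for the multiplication of matrices. -/
def annotationProgram (P : Program) : Program where
  procs := P.procs ++ [P.main, .skip, bmul P.procs.length,
    rref (P.procs.length + 2) (P.procs.length + 3), gaussJordan (P.procs.length + 3), incidenceCmd]
  main := annotate (P.procs.length + 1) (P.procs.length + 5) (P.procs.length + 4)

theorem getElem?_append_add {α : Type*} (u w : List α) (i : ℕ) :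
    (u ++ w)[u.length + i]? = w[i]? := by
  rw [List.getElem?_append_right (by omega), Nat.add_sub_cancel_left]

/-- The memory that a call creates is exactly the one in which the program would start on the list
of its input, so its guarantee carries over by `Exec.mono`. A number of steps is an integer, which
permits the floor. -/
theorem mulProc {P : Program} {c N : ℕ} {C ω : ℝ} {R : RAM}
    (hP : ∀ k : ℕ, 1 ≤ k → ∀ A B : Matrix (Fin k) (Fin k) (ZMod 2),
      P.Computes ((k + 2) ^ c) (C * (k : ℝ) ^ ω) (k :: (bitList A ++ bitList B)) (bitList (A * B)))
    (hW : (N + 2) ^ c ≤ R.W) (hR : R.procs = (annotationProgram P).procs) :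
    MulProc R P.procs.length N fun k => ⌊C * (k : ℝ) ^ ω⌋₊ := by
  refine ⟨P.main, ?_, fun k hk hkN A B m h0 hA hB hz => ?_⟩
  · rw [hR]
    exact getElem?_append_add P.procs _ 0
  · obtain ⟨m', t, he, ht, hm'⟩ := hP k hk (of fun i j => A i j) (of fun i j => B i j)
    have hm : (fun i => (k :: (bitList (of fun i j : Fin k => A i j) ++
        bitList (of fun i j : Fin k => B i j))).getD i 0) = m := by
      funext i
      rcases i with _ | i
      · exact h0.symm
      rw [List.getD_cons_succ]
      by_cases h1 : i < k * k
      · rw [List.getD_append _ _ _ _ (by rwa [length_bitList]), getD_bitList _ h1, Nat.add_comm,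
          hA i h1]
        rfl
      · obtain ⟨q, rfl⟩ := Nat.exists_eq_add_of_le (not_lt.mp h1)
        rw [AnnotationOutput.getD_bitList_append]
        by_cases h2 : q < k * k
        · rw [getD_bitList _ h2, show k * k + q + 1 = 1 + k * k + q by ring, hB q h2]
          rfl
        · rw [List.getD_eq_default _ _ (by rw [length_bitList]; omega), hz _ (by omega)]
    rw [hm] at he
    refine ⟨m', t, he.mono ((Nat.pow_le_pow_left (by omega) c).trans hW) (fun f c hc => ?_),
      Nat.le_floor ht, fun q hq => ?_⟩
    · rw [hR]
      change (P.procs ++ _)[f]? = _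
      rw [List.getElem?_append_left (List.getElem?_eq_some_iff.mp hc).1, hc]
    · have hq' : q < (bitList (of (fun i j : Fin k => A i j) * of fun i j : Fin k => B i j)).length := by
        rwa [length_bitList]
      rw [hm' q hq', ← List.getD_eq_getElem _ 0, getD_bitList _ hq, mul_apply, Finset.sum_range]
      rfl

theorem Listing.getD_input_le {v : ℕ} {K : AbstractSimplicialComplex (Fin v)} (l : Listing K)
    (p i : ℕ) : (l.input p).getD i 0 ≤ l.size + p := by
  have h : ∀ x ∈ l.input p, x ≤ l.size + p := by
    intro x hx
    have hv := l.le_size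
    rw [l.input_eq] at hx
    simp only [List.mem_cons, List.mem_flatten, List.mem_map] at hx
    rcases hx with rfl | rfl | ⟨_, ⟨s, -, rfl⟩, hx⟩
    · omega
    · omega
    · rcases List.mem_cons.mp hx with rfl | hx
      · have := (Finset.card_le_univ s).trans (Fintype.card_fin v).le
        omega
      · simp only [vertexList, List.mem_map] at hx
        obtain ⟨y, -, rfl⟩ := hx
        omega
  by_cases hi : i < (l.input p).length
  · rw [List.getD_eq_getElem _ _ hi]
    exact h _ (List.getElem_mem hi)
  · rw [List.getD_eq_default _ _ (by omega)]
    omega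

theorem pow_lt_pow_of_le {a b d e c : ℕ} (hb : 1 < b) (h : a ≤ b ^ d) (hc : d * e < c) :
    a ^ e < b ^ c :=
  (Nat.pow_le_pow_left h e).trans_lt ((pow_mul b d e).symm ▸ Nat.pow_lt_pow_right hb hc)

theorem annotationProgram_correct {P : Program} {c : ℕ} {C ω : ℝ}
    (hP : ∀ k : ℕ, 1 ≤ k → ∀ A B : Matrix (Fin k) (Fin k) (ZMod 2),
      P.Computes ((k + 2) ^ c) (C * (k : ℝ) ^ ω) (k :: (bitList A ++ bitList B)) (bitList (A * B)))
    (p v : ℕ) (K : AbstractSimplicialComplex (Fin v)) (l : Listing K) (hl : 1 ≤ l.size) :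
    ∃ o : AnnotationOutput (l.count (p + 1)),
      (annotationProgram P).Computes ((l.size + p + 2) ^ (1401 + 2 * c))
        (annotateTime (fun k => ⌊C * (k : ℝ) ^ ω⌋₊) l.card l.size p : ℕ) (l.input p) o.toList ∧
      ∃ Y Y' η, o.ReadOff Y Y' η := by
  have hpos : 3 ≤ l.size + p + 2 := by omega
  have hX : slotSize l.size + p + 100 ≤ (l.size + p + 2) ^ 7 := by
    unfold slotSize
    calc 16 * ((l.size + 8) * (l.size + 8)) + p + 100
        ≤ 3 ^ 5 * (l.size + p + 2) ^ 2 := by nlinarith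
      _ ≤ (l.size + p + 2) ^ 5 * (l.size + p + 2) ^ 2 := by gcongr
      _ = (l.size + p + 2) ^ 7 := by ring
  let R : RAM := {
    X := slotSize l.size + p + 100
    W := (l.size + p + 2) ^ (1401 + 2 * c)
    procs := (annotationProgram P).procs
    hX := by omega
    -- `X` is at most the seventh power of `n + p + 2`, and `7 * 200 = 1400 < 1401 + 2 * c`.
    hW := pow_lt_pow_of_le (by omega) hX (by omega) }
  have hW : (paddedSize l.size + 2) ^ c ≤ R.W := by
    have := paddedSize_le hl
    -- The summand `2 * c` of the exponent provides the words of the multiplication program for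
    -- matrices of size up to `2 * n`.
    calc (paddedSize l.size + 2) ^ c ≤ ((l.size + p + 2) ^ 2) ^ c := by
          refine Nat.pow_le_pow_left ?_ _
          nlinarith
      _ = (l.size + p + 2) ^ (2 * c) := (pow_mul _ _ _).symm
      _ ≤ _ := Nat.pow_le_pow_right (by omega) (by omega)
  have hle : ∀ i, (l.input p).getD i 0 ≤ R.X := fun i =>
    (l.getD_input_le p i).trans (by change _ ≤ slotSize l.size + p + 100; unfold slotSize; nlinarith)
  have hsize : l.size * l.size + l.size + 2 ≤ slotSize l.size := by unfold slotSize; nlinarith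
  have key := Run.annotate (R := R) (m := fun i => (l.input p).getD i 0) (n := l.size) (p := p)
    (fC := P.procs.length + 1) (fI := P.procs.length + 5) (fG := P.procs.length + 4)
    (card := l.card) (off := l.off) (vert := l.vert) (mulProc hP hW rfl)
    (getElem?_append_add P.procs _ 1) (getElem?_append_add P.procs _ 2)
    (getElem?_append_add P.procs _ 3) (getElem?_append_add P.procs _ 4)
    (getElem?_append_add P.procs _ 5) (l.getD_input_zero p) (l.getD_input_one p) hl
    (by change _ ≤ slotSize l.size + p + 100; omega)
    (by change _ ≤ slotSize l.size + p + 100; omega)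
    (fun m' hm' => l.stored p hsize hm') (fun i hi => l.off_le hi) (fun i _ => l.card_le i)
    (Q := fun len w => ∃ o : AnnotationOutput (l.count (p + 1)), len = o.toList.length ∧
      (w = fun i => o.toList.getD i 0) ∧ ∃ Y Y' η, o.ReadOff Y Y' η) ?_
  · obtain ⟨m', t, he, ht, -, w, len, ⟨o, rfl, rfl, ho⟩, hw⟩ := key hle
    refine ⟨o, ⟨m', t, he, by exact_mod_cast ht, fun i hi => ?_⟩, ho⟩
    rw [hw i hi]
    exact List.getD_eq_getElem _ _ hi
  · intro X X' pl ql hb hX hX' hpl hql hhb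
    rw [l.length_ofCard, l.length_ofCard] at *
    subst hpl hql hhb
    refine ⟨_, result_assemble _ _ _ _ _, fun i => ?_, _, (length_toList_assemble _ _ _ _ _).symm,
      rfl, _, _, _, readOff_assemble l (le_paddedSize _) hX hX'⟩
    refine (getD_toList_assemble_le _ _ _ _ _ _).trans ?_
    have : l.count (p + 1) ≤ l.size := by rw [← l.length_ofCard]; exact length_ofCard_le _ _ _
    change _ ≤ slotSize l.size + p + 100
    unfold slotSize
    nlinarith

/-! ### The running time -/

theorem two_pow_rpow (ω : ℝ) (j : ℕ) : ((2 : ℝ) ^ j) ^ ω = 2 ^ j * ((2 : ℝ) ^ (ω - 1)) ^ j := by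
  rw [← mul_pow]
  conv_rhs => rw [show (2 : ℝ) * 2 ^ (ω - 1) = 2 ^ ω by
    rw [Real.rpow_sub_one (by norm_num)]; field_simp]
  rw [← Real.rpow_natCast, ← Real.rpow_natCast, ← Real.rpow_mul (by norm_num),
    ← Real.rpow_mul (by norm_num), mul_comm]

/-- Here `y` stands for `2 ^ (ω - 1)`. With `h = 2 ^ j` and `N = 2 ^ J`, the `N / h` products of
cost `h ^ ω` amount to `N * h ^ (ω - 1) = 2 ^ J * y ^ j`; the overhead `h * N` is smaller as `y >
2`. -/
theorem bmulTime_le {TM : ℕ → ℕ} {A y : ℝ} (hy : 2 < y)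
    (hTM : ∀ j, (TM (2 ^ j) : ℝ) ≤ A * (2 ^ j * y ^ j)) {j J : ℕ} (hj : j ≤ J) :
    (bmulTime TM (2 ^ J) (2 ^ j) : ℝ) ≤ (A + 18303) * (2 ^ J * y ^ j) := by
  have h2y : (2 : ℝ) ^ j ≤ y ^ j := pow_le_pow_left₀ (by norm_num) hy.le j
  have h1 : (1 : ℝ) ≤ 2 ^ j := one_le_pow₀ (by norm_num)
  have h1J : (1 : ℝ) ≤ 2 ^ J := one_le_pow₀ (by norm_num)
  have hdiv : (2 : ℕ) ^ J / 2 ^ j = 2 ^ (J - j) := Nat.pow_div hj (by norm_num)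
  have hJ : (2 : ℝ) ^ J = 2 ^ (J - j) * 2 ^ j := by rw [← pow_add, Nat.sub_add_cancel hj]
  have h3 : (1 : ℝ) ≤ 2 ^ (J - j) := one_le_pow₀ (by norm_num)
  have hT := hTM j
  unfold bmulTime
  rw [hdiv]
  push_cast
  have e1 : (2 : ℝ) ^ j * 2 ^ j ≤ 2 ^ j * y ^ j := by gcongr
  have e2 : (5000 : ℝ) ≤ 5000 * (2 ^ j * y ^ j) := by nlinarith
  have e3 : (TM (2 ^ j) : ℝ) + 1103 * (2 ^ j * 2 ^ j) + 5000 ≤ (A + 6103) * (2 ^ j * y ^ j) := by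
    linarith
  have e4 : (2 : ℝ) ^ (J - j) * ((TM (2 ^ j) : ℝ) + 1103 * (2 ^ j * 2 ^ j) + 5000) ≤
      (A + 6103) * (2 ^ J * y ^ j) := by
    calc _ ≤ (2 : ℝ) ^ (J - j) * ((A + 6103) * (2 ^ j * y ^ j)) := by gcongr
      _ = _ := by rw [hJ]; ring
  have e5 : (2 : ℝ) ^ j * 2 ^ J ≤ 2 ^ J * y ^ j := by rw [mul_comm]; gcongr
  have e6 : (1 : ℝ) ≤ 2 ^ J * y ^ j := by nlinarith
  linarith

theorem rrefTime_le {TM : ℕ → ℕ} {A y : ℝ} (hA : 0 ≤ A) (hy : 2 < y)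
    (hTM : ∀ j, (TM (2 ^ j) : ℝ) ≤ A * (2 ^ j * y ^ j)) {J : ℕ} :
    ∀ j ≤ J, (rrefTime TM (2 ^ J) j : ℝ) ≤
      -- The part 12000 covers the leaf. The quotient `E` solves `E * y = 2 * E + (2 * A + 156606)`,
      -- the recursion with `2 * (A + 18303) + 20000 + 100000` as the cost of one level; this needs
      -- `y > 2`.
      (12000 + (2 * A + 156606) / (y - 2)) * (2 ^ J * y ^ j) := by
  have hy' : 0 < y - 2 := by linarith
  have h1J : (1 : ℝ) ≤ 2 ^ J := one_le_pow₀ (by norm_num)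
  intro j
  induction j with
  | zero =>
    intro _
    simp only [rrefTime, pow_zero, mul_one]
    push_cast
    have : 0 ≤ (2 * A + 156606) / (y - 2) := by positivity
    nlinarith
  | succ j ih =>
    intro hj
    have ih := ih (by omega)
    have hb := bmulTime_le hy hTM (show j ≤ J by omega)
    have h2y : (2 : ℝ) ^ j ≤ y ^ j := pow_le_pow_left₀ (by norm_num) hy.le j
    have h1 : (1 : ℝ) ≤ 2 ^ j := one_le_pow₀ (by norm_num)
    have e5 : (2 : ℝ) ^ j * 2 ^ J ≤ 2 ^ J * y ^ j := by rw [mul_comm]; gcongr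
    have e6 : (1 : ℝ) ≤ 2 ^ J * y ^ j := by nlinarith
    have e7 : (2 * A + 156606) / (y - 2) * (y - 2) = 2 * A + 156606 := div_mul_cancel₀ _ hy'.ne'
    simp only [rrefTime]
    push_cast
    generalize (2 * A + 156606) / (y - 2) = E at *
    have e8 : (12000 + E) * (2 ^ J * y ^ (j + 1)) =
        (2 * (12000 + E) + 12000 * (y - 2) + (2 * A + 156606)) * (2 ^ J * y ^ j) := by
      rw [← e7]; ring
    rw [e8]
    have e9 : 0 ≤ 12000 * (y - 2) * (2 ^ J * y ^ j) := by positivity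
    nlinarith

theorem exists_mul_succ_le {a : ℝ} (ha : 1 < a) :
    ∃ C, 0 ≤ C ∧ ∀ k : ℕ, (k : ℝ) * (k + 1) ≤ C * a ^ k := by
  obtain ⟨C, hC⟩ := (tendsto_pow_const_div_const_pow_of_one_lt 2 ha).bddAbove_range
  refine ⟨2 * max C 0, by positivity, fun k => ?_⟩
  have h1 : (k : ℝ) ^ 2 / a ^ k ≤ max C 0 := (hC ⟨k, rfl⟩).trans (le_max_left _ _)
  rw [div_le_iff₀ (by positivity)] at h1
  have h2 : (k : ℝ) ≤ k ^ 2 := by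
    exact_mod_cast Nat.le_self_pow (by norm_num) k
  nlinarith

/-- A simplex with `k + 1` vertices brings its `2 ^ (k + 1) - 1` nonempty faces with it. -/
theorem Listing.two_pow_le {v : ℕ} {K : AbstractSimplicialComplex (Fin v)} (l : Listing K) {k : ℕ}
    (hk : 0 < l.count (k + 1)) : 2 ^ k ≤ l.size := by
  obtain ⟨s, hs, hcard⟩ := l.enum (k + 1) ⟨0, hk⟩
  have h1 : s.powerset.erase ∅ ⊆ l.list.toFinset := by
    intro t ht
    rw [Finset.mem_erase, Finset.mem_powerset] at ht
    rw [List.mem_toFinset, l.mem_iff]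
    exact (K.isRelLowerSet_faces hs).2 ht.2 (Finset.nonempty_iff_ne_empty.mpr ht.1)
  have h2 := (Finset.card_le_card h1).trans (List.toFinset_card_le _)
  rw [Finset.card_erase_of_mem (Finset.empty_mem_powerset _), Finset.card_powerset, hcard,
    pow_succ] at h2
  have := Nat.one_le_two_pow (n := k)
  change _ ≤ l.list.length
  omega

/-- The factor `k * (k + 1)` is `O((2 ^ (ω - 2)) ^ k)`, which is `O(n ^ (ω - 2))` because `2 ^ k ≤
n`. Multiplied by the at most `n ^ 2` pairs this is `O(n ^ ω)`, uniformly in `k`. -/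
theorem incidenceTime_le {ω : ℝ} (hω : 2 < ω) :
    ∃ C : ℝ, 0 ≤ C ∧ ∀ (k v : ℕ) (K : AbstractSimplicialComplex (Fin v)) (l : Listing K),
      1 ≤ l.size →
        (incidenceTime l.size l.card (paddedSize l.size) k : ℝ) ≤ C * (l.size : ℝ) ^ ω := by
  obtain ⟨C, hC0, hC⟩ := exists_mul_succ_le
    (Real.one_lt_rpow (x := 2) (z := ω - 2) (by norm_num) (by linarith))
  refine ⟨1401 * C + 9000 + 82000, by positivity, fun k v K l hl => ?_⟩
  have hN : (paddedSize l.size : ℝ) ≤ 2 * l.size := by exact_mod_cast paddedSize_le hl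
  have hn : (1 : ℝ) ≤ l.size := by exact_mod_cast hl
  have hsq : (l.size : ℝ) ^ ω = l.size * l.size * (l.size : ℝ) ^ (ω - 2) := by
    rw [← pow_two, ← Real.rpow_natCast, ← Real.rpow_add (by linarith)]
    norm_num
  have hδ : (1 : ℝ) ≤ (l.size : ℝ) ^ (ω - 2) := Real.one_le_rpow hn (by linarith)
  have hab : ((l.count k * l.count (k + 1) * (1401 * (k * (k + 1)) + 9000) : ℕ) : ℝ) ≤
      (1401 * C + 9000) * (l.size : ℝ) ^ ω := by
    -- Without simplices of `k + 1` vertices there are no pairs, however large `k` is.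
    rcases Nat.eq_zero_or_pos (l.count (k + 1)) with h0 | hpos
    · rw [h0, Nat.mul_zero, Nat.zero_mul, Nat.cast_zero]
      positivity
    · have h2 : ((2 : ℝ) ^ (ω - 2)) ^ k ≤ (l.size : ℝ) ^ (ω - 2) := by
        rw [← Real.rpow_natCast, ← Real.rpow_mul (by norm_num), mul_comm, Real.rpow_mul (by norm_num),
          Real.rpow_natCast]
        exact Real.rpow_le_rpow (by positivity) (by exact_mod_cast l.two_pow_le hpos) (by linarith)
      have h3 : (l.count k : ℝ) ≤ l.size := by
        exact_mod_cast (l.length_ofCard k) ▸ length_ofCard_le _ _ _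
      have h4 : (l.count (k + 1) : ℝ) ≤ l.size := by
        exact_mod_cast (l.length_ofCard (k + 1)) ▸ length_ofCard_le _ _ _
      push_cast
      calc (l.count k : ℝ) * l.count (k + 1) * (1401 * (k * (k + 1)) + 9000)
          ≤ l.size * l.size * (1401 * (C * (l.size : ℝ) ^ (ω - 2)) +
              9000 * (l.size : ℝ) ^ (ω - 2)) := by
            have h5 : (k : ℝ) * (k + 1) ≤ C * (l.size : ℝ) ^ (ω - 2) := (hC k).trans (by gcongr)
            refine mul_le_mul (by gcongr) (by linarith) (by positivity) (by positivity)
        _ = _ := by rw [hsq]; ring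
  have hnn : (l.size : ℝ) ≤ l.size * l.size := by nlinarith
  have hω2 : (l.size : ℝ) * l.size ≤ (l.size : ℝ) ^ ω := by rw [hsq]; nlinarith
  have hNN : (paddedSize l.size : ℝ) * paddedSize l.size ≤ 4 * (l.size * l.size) := by
    calc (paddedSize l.size : ℝ) * paddedSize l.size ≤ (2 * l.size) * (2 * l.size) := by gcongr
      _ = _ := by ring
  unfold incidenceTime
  rw [l.length_ofCard, l.length_ofCard]
  rw [Nat.cast_add, Nat.cast_add, Nat.cast_add]
  push_cast at hab ⊢
  linarith

theorem annotateTime_le {ω : ℝ} (hω : 2 < ω) (C : ℝ) :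
    ∃ C' : ℝ, ∀ (p v : ℕ) (K : AbstractSimplicialComplex (Fin v)) (l : Listing K), 1 ≤ l.size →
      (annotateTime (fun k => ⌊C * (k : ℝ) ^ ω⌋₊) l.card l.size p : ℝ) ≤
        C' * (l.size : ℝ) ^ ω := by
  obtain ⟨D, hD0, hD⟩ := incidenceTime_le hω
  have hy : (2 : ℝ) < 2 ^ (ω - 1) := by
    have := Real.rpow_lt_rpow_of_exponent_lt (x := 2) (by norm_num) (show (1 : ℝ) < ω - 1 by linarith)
    rwa [Real.rpow_one] at this
  have hTM : ∀ j : ℕ, ((fun k : ℕ => ⌊C * (k : ℝ) ^ ω⌋₊) (2 ^ j) : ℝ) ≤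
      |C| * (2 ^ j * ((2 : ℝ) ^ (ω - 1)) ^ j) := fun j => by
    rw [← two_pow_rpow]
    beta_reduce
    push_cast
    -- `C` is not known to be nonnegative, hence the absolute value.
    refine (Nat.cast_le.mpr (Nat.floor_mono (mul_le_mul_of_nonneg_right (le_abs_self C)
      (by positivity)))).trans (Nat.floor_le (by positivity))
  obtain ⟨E, hE0, hE⟩ : ∃ E : ℝ, 0 ≤ E ∧ ∀ J : ℕ,
      (rrefTime (fun k : ℕ => ⌊C * (k : ℝ) ^ ω⌋₊) (2 ^ J) J : ℝ) ≤ E * ((2 : ℝ) ^ J) ^ ω := by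
    have h0 : (0 : ℝ) < 2 ^ (ω - 1) - 2 := by linarith
    refine ⟨12000 + (2 * |C| + 156606) / (2 ^ (ω - 1) - 2), by positivity, fun J => ?_⟩
    rw [two_pow_rpow]
    exact rrefTime_le (abs_nonneg C) hy hTM J le_rfl
  refine ⟨2 * D + 2 * (E * 2 ^ ω) + 500000, fun p v K l hl => ?_⟩
  have hN : (paddedSize l.size : ℝ) ≤ 2 * l.size := by exact_mod_cast paddedSize_le hl
  have hn : (1 : ℝ) ≤ l.size := by exact_mod_cast hl
  have hω2 : (l.size : ℝ) * l.size ≤ (l.size : ℝ) ^ ω := by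
    rw [← pow_two, ← Real.rpow_natCast]
    exact Real.rpow_le_rpow_of_exponent_le hn (by norm_num; linarith)
  have hnn : (l.size : ℝ) ≤ l.size * l.size := by nlinarith
  have hNN : (paddedSize l.size : ℝ) * paddedSize l.size ≤ 4 * (l.size * l.size) := by
    calc (paddedSize l.size : ℝ) * paddedSize l.size ≤ (2 * l.size) * (2 * l.size) := by gcongr
      _ = _ := by ring
  have hr := hE (Nat.clog 2 l.size)
  have hpow : ((2 : ℝ) ^ Nat.clog 2 l.size) ^ ω ≤ 2 ^ ω * (l.size : ℝ) ^ ω := by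
    rw [← Real.mul_rpow (by norm_num) (by positivity)]
    refine Real.rpow_le_rpow (by positivity) ?_ (by linarith)
    have := hN
    unfold paddedSize at this
    push_cast at this
    exact this
  have hE' : E * ((2 : ℝ) ^ Nat.clog 2 l.size) ^ ω ≤ E * 2 ^ ω * (l.size : ℝ) ^ ω := by
    rw [mul_assoc]
    gcongr
  have hd1 := hD p v K l hl
  have hd2 := hD (p + 1) v K l hl
  have hps : (2 : ℝ) ^ Nat.clog 2 l.size = paddedSize l.size := by unfold paddedSize; push_cast; rfl
  unfold annotateTime gaussJordanTime
  push_cast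
  rw [hps]
  linarith

theorem theorem6p2 (ω : ℝ) (hω : 2 < ω) (hmul : MatMulInTime ω) :
    ∃ (P : Program) (c : ℕ) (C : ℝ),
      ∀ (p v : ℕ) (K : AbstractSimplicialComplex (Fin v)) (l : Listing K), 1 ≤ l.size →
        ∃ o : AnnotationOutput (l.count (p + 1)),
          P.Computes ((l.size + p + 2) ^ c) (C * (l.size : ℝ) ^ ω) (l.input p) o.toList ∧
          o.Decomposition ∧
          o.SentinelCycleBasis ∧
          IsAnnotation o.annotation ∧
          (∀ a : Fin o.r, o.annotation (o.simplex (.inl a)) = 0) ∧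
          ∃ (h : Fin o.g → cycles K p) (b : Module.Basis (Fin o.g) (ZMod 2) (Homology K p)),
            (∀ i, (h i : Chain K p) = o.homChain i) ∧
            (∀ i, b i = homologyClass (h i)) ∧
            (∀ (j : Fin o.s) (z : cycles K p), (z : Chain K p) = o.sentinelCycle j →
              o.annotation (o.simplex (.inr j)) = b.equivFun (homologyClass z)) ∧
            ∀ z : cycles K p, sumOver o.annotation z = b.equivFun (homologyClass z) := by
  obtain ⟨P, c, C, hP⟩ := hmul
  obtain ⟨C', hC'⟩ := annotateTime_le hω C
  refine ⟨annotationProgram P, 1401 + 2 * c, C', fun p v K l hl => ?_⟩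
  obtain ⟨o, ⟨m, t, he, ht, hm⟩, Y, Y', η, h⟩ := annotationProgram_correct hP p v K l hl
  exact ⟨o, ⟨m, t, he, ht.trans (hC' p v K l hl), hm⟩, h.decomposition, h.sentinelCycleBasis,
    h.isAnnotation, h.annotation_inl, fun i => h.columnCycle (η i), h.basis, h.columnCycle_hom,
    h.basis_apply, fun j z hz => h.annotation_inr j hz, h.sumOver_eq⟩
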